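/- Let $k$ be a field. A *finite category* is a $k$-linear abelian category $\mathcal C$ that is equivalent, as a $k$-linear category, to the category of finite-dimensional modules over some finite-dimensional $k$-algebra $A$. A finite family $P=(P_i)_{i\in J}$ of projective objects of $\mathcal C$ is called *generating* if every object of $\mathcal C$ is a quotient of a finite direct sum of objects $P_i$. For a $k$-bilinear functor $F:\mathcal C^{\mathrm{op}}\times\mathcal C\to\mathcal D$ to a $k$-linear category and a family $P=(P_i)_{i\in J}$ of objects of $\mathcal C$, let $B_*F$ be the simplicial object of $\mathcal D$ with $$B_nF=\bigoplus_{X_0,\dots,X_n}\mathcal C(X_1,X_0)\otimes\cdots\otimes\mathcal C(X_n,X_{n-1})\otimes F(X_0,X_n),$$ where the $X_j$ run through the family (and $V\otimes Y$, for a vector space $V$ and $Y\in\mathcal D$, is the copower, with $\mathcal D(V\otimes Y,Z)\cong \mathrm{Hom}_k(V,\mathcal D(Y,Z))$). The outer faces act on $F$, the inner faces compose neighbouring morphisms, the degeneracies insert identities. The *derived coend* of $F$ over the family is the chain complex in $\mathcal D$ associated with $B_*F$ (differential $\sum_j(-1)^j\partial_j$). If $P$ is a finite generating family of projective objects of $\mathcal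 C$, $\mathcal D=\mathcal C$, and $F$ sends pairs of projective objects to projective objects, it is denoted $\int_{\mathrm f\mathbb L}^{X\in\mathrm{Proj}\,\mathcal C}F(X,X)$; the maps $F(P_i,P_i)\to\int^{X\in\mathcal C}F(X,X)$ define its augmentation. If the family consists of all projective objects, $\mathcal D=\mathrm{Vect}_k$ and $F(X,Y)=\mathcal C(X,Y)$, it is the *Hochschild complex* $\int_{\mathbb L}^{X\in\mathrm{Proj}\,\mathcal C}\mathcal C(X,X)$. **Theorem.** Let $\mathcal C$ be a finite category over $k$. Finite generating families of projective objects of $\mathcal C$ exist, and for every such family the following hold. 1. Let $F:\mathcal C^{\mathrm{op}}\boxtimes\mathcal C\to\mathcal C$ be an exact $k$-linear functor on the Deligne product (if $\mathcal C$ is identified with the finite-dimensional $A$-modules, $\mathcal C^{\mathrm{op}}\boxtimes\mathcal C$ is the category of finite-dimensional $A^{\mathrm{op}}\otimes_k A$-modules, and $X\boxtimes Y=\mathrm{Hom}_k(X,k)\otimes_k Y$). Assume that $F(X,Y):=F(X\boxtimes Y)$ is projective for all projective $X,Y\in\mathcal C$. Then the coend $\int^{X\in\mathcal C}F(X,X)$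 over all objects of $\mathcal C$ exists, $\int_{\mathrm f\mathbb L}^{X\in\mathrm{Proj}\,\mathcal C}F(X,X)$ is degreewise projective, and the augmentation $$\int_{\mathrm f\mathbb L}^{X\in\mathrm{Proj}\,\mathcal C}F(X,X)\longrightarrow\int^{X\in\mathcal C}F(X,X)$$ is a quasi-isomorphism, i.e. a projective resolution. 2. Suppose that $\mathcal C$ is a finite tensor category: it carries a rigid monoidal structure with $k$-bilinear tensor product and simple unit $I$. Write $X^\vee$ for the dual of $X$ with coevaluation $I\to X\otimes X^\vee$ and evaluation $X^\vee\otimes X\to I$. Suppose moreover that the field $\mathrm{End}(I)$ is separable over $k$ (automatic if $\mathrm{End}(I)=k$ or if $k$ is perfect). Then, for every exact $k$-linear functor $G:\mathcal C\to\mathcal C$, the coend $\int^{X\in\mathcal C}X\otimes G(X)^\vee$ exists and the augmentation $$\int_{\mathrm f\mathbb L}^{X\in\mathrm{Proj}\,\mathcal C}X\otimes G(X)^\vee\longrightarrow\int^{X\in\mathcal C}X\otimes G(X)^\vee$$ is a projective resolution. In particular, $\int_{\mathrm f\mathbb L}^{X\in\mathrm{Proj}\,\mathcal C}X\otimes X^\vee$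 is a projective resolution of the canonical coend $\mathbb F=\int^{X\in\mathcal C}X\otimes X^\vee$. 3. For every finite tensor category $\mathcal C$ (without the separability assumption) there is a quasi-isomorphism $$\mathcal C\Big(I,\int_{\mathrm f\mathbb L}^{X\in\mathrm{Proj}\,\mathcal C}X\otimes X^\vee\Big)\;\simeq\;\int_{\mathbb L}^{X\in\mathrm{Proj}\,\mathcal C}\mathcal C(X,X)$$ to the Hochschild complex of $\mathcal C$, namely the map that is induced by the inclusion of the chosen family into all projective objects and the duality isomorphisms $\mathcal C(I,Y\otimes X^\vee)\cong\mathcal C(X,Y)$. -/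

import Mathlib

open CategoryTheory Limits Opposite MonoidalCategory
open scoped TensorProduct Simplicial

universe u v w v' w' t

noncomputable section

namespace DerivedCoend

section Copower

variable (k : Type u) [Field k] {D : Type w'} [Category.{v'} D] [Preadditive D] [Linear k D]
  (V : Type t) [AddCommGroup V] [Module k V]

/-- The copower (tensoring) `V • Y` of an object `Y` of a `k`-linear category by a vector space `V`:
a coproduct of copies of `Y` indexed by a basis of `V`. The universal property, which does not refer
to the basis, is `copowerι`, `copowerDesc`, `copower_hom_ext`. -/
def copower (Y : D) [HasColimitsOfShape (Discrete (Module.Basis.ofVectorSpaceIndex k V)) D] : D :=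
  ∐ fun _ : Module.Basis.ofVectorSpaceIndex k V => Y

variable (Y : D) [HasColimitsOfShape (Discrete (Module.Basis.ofVectorSpaceIndex k V)) D]

/-- The universal linear map `V → Hom(Y, V • Y)`. -/
def copowerι : V →ₗ[k] (Y ⟶ copower k V Y) :=
  (Module.Basis.ofVectorSpace k V).constr k
    (fun b => Sigma.ι (fun _ : Module.Basis.ofVectorSpaceIndex k V => Y) b)

lemma copowerι_basis (b : Module.Basis.ofVectorSpaceIndex k V) :
    copowerι k V Y (Module.Basis.ofVectorSpace k V b) =
      Sigma.ι (fun _ : Module.Basis.ofVectorSpaceIndex k V => Y) b :=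
  (Module.Basis.ofVectorSpace k V).constr_basis k _ b

variable {V Y}

/-- The morphism `V • Y ⟶ Z` induced by a linear map `V → Hom(Y, Z)`. -/
def copowerDesc {Z : D} (φ : V →ₗ[k] (Y ⟶ Z)) : copower k V Y ⟶ Z :=
  Sigma.desc fun b => φ (Module.Basis.ofVectorSpace k V b)

lemma copowerι_desc {Z : D} (φ : V →ₗ[k] (Y ⟶ Z)) (x : V) :
    copowerι k V Y x ≫ copowerDesc k φ = φ x := by
  have : (Linear.rightComp k Y (copowerDesc k φ)) ∘ₗ copowerι k V Y = φ := by
    refine (Module.Basis.ofVectorSpace k V).ext fun b => ?_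
    change copowerι k V Y (Module.Basis.ofVectorSpace k V b) ≫ copowerDesc k φ = _
    rw [copowerι_basis]
    exact Sigma.ι_desc _ b
  exact LinearMap.congr_fun this x

lemma copower_hom_ext {Z : D} {g h : copower k V Y ⟶ Z}
    (H : ∀ x : V, copowerι k V Y x ≫ g = copowerι k V Y x ≫ h) : g = h := by
  refine Sigma.hom_ext _ _ fun b => ?_
  have := H (Module.Basis.ofVectorSpace k V b)
  rwa [copowerι_basis] at this

end Copower

section Bilinear

variable (k : Type u) [Field k] {C : Type w} [Category.{v} C] [Preadditive C] [Linear k C]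
  {D : Type w'} [Category.{v'} D] [Preadditive D] [Linear k D]

/-- A functor `Cᵒᵖ × C ⥤ D`, written in curried form, is `k`-bilinear on morphisms, i.e. it is a
`k`-linear functor `Cᵒᵖ ⊗ C ⥤ D`. -/
class IsBilinear (F : Cᵒᵖ ⥤ C ⥤ D) : Prop where
  map_add_left : ∀ {X X' : C} (f g : X ⟶ X') (Y : C),
    (F.map (f + g).op).app Y = (F.map f.op).app Y + (F.map g.op).app Y
  map_smul_left : ∀ {X X' : C} (r : k) (f : X ⟶ X') (Y : C),
    (F.map (r • f).op).app Y = r • (F.map f.op).app Y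
  map_add_right : ∀ (X : Cᵒᵖ) {Y Y' : C} (f g : Y ⟶ Y'),
    (F.obj X).map (f + g) = (F.obj X).map f + (F.obj X).map g
  map_smul_right : ∀ (X : Cᵒᵖ) {Y Y' : C} (r : k) (f : Y ⟶ Y'),
    (F.obj X).map (r • f) = r • (F.obj X).map f

end Bilinear

section Strings

variable {C : Type w} [Category.{v} C] {ι : Type t} (P : ι → C)

/-- Strings of `n` morphisms `P (X n) ⟶ ... ⟶ P (X 1) ⟶ P (X 0)`. -/
abbrev Strings {n : ℕ} (X : Fin (n + 1) → ι) (i : Fin n) : Type v := P (X i.succ) ⟶ P (X i.castSucc)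

variable {P} {n : ℕ} {X : Fin (n + 1) → ι}

/-- The composite `P (X b) ⟶ P (X a)`, for `a ≤ b`, of the morphisms in a string. -/
def strComp (f : ∀ i, Strings P X i) (a b : Fin (n + 1)) (h : a ≤ b) : P (X b) ⟶ P (X a) :=
  Fin.induction (motive := fun b => a ≤ b → (P (X b) ⟶ P (X a)))
    (fun h => eqToHom (by rw [Fin.le_zero_iff.mp h]))
    (fun i ih h =>
      if h' : a ≤ i.castSucc then f i ≫ ih h'
      else eqToHom (by rw [le_antisymm h (Fin.castSucc_lt_iff_succ_le.mp (not_le.mp h'))]))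
    b h

lemma strComp_succ (f : ∀ i, Strings P X i) (a : Fin (n + 1)) (i : Fin n) (h : a ≤ i.castSucc)
    (h' : a ≤ i.succ) : strComp f a i.succ h' = f i ≫ strComp f a i.castSucc h := by
  simp [strComp, h]

lemma strComp_self (f : ∀ i, Strings P X i) (a : Fin (n + 1)) (h : a ≤ a) :
    strComp f a a h = 𝟙 _ := by
  induction a using Fin.cases with
  | zero => simp [strComp]
  | succ i => simp [strComp]

lemma strComp_comp (f : ∀ i, Strings P X i) (a b c : Fin (n + 1)) (hab : a ≤ b) (hbc : b ≤ c)
    (hac : a ≤ c) : strComp f b c hbc ≫ strComp f a b hab = strComp f a c hac := by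
  induction c using Fin.induction with
  | zero =>
    obtain rfl : b = 0 := Fin.le_zero_iff.mp hbc
    obtain rfl : a = 0 := Fin.le_zero_iff.mp hac
    simp [strComp_self]
  | succ i ih =>
    by_cases hb : b ≤ i.castSucc
    · rw [strComp_succ f b i hb, strComp_succ f a i (hab.trans hb), Category.assoc, ih]
    · obtain rfl : b = i.succ := le_antisymm hbc (Fin.castSucc_lt_iff_succ_le.mp (not_le.mp hb))
      rw [strComp_self, Category.id_comp]

lemma strComp_congr {f g : ∀ i, Strings P X i} (a b : Fin (n + 1)) (h : a ≤ b)
    (H : ∀ i : Fin n, a ≤ i.castSucc → i.succ ≤ b → f i = g i) :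
    strComp f a b h = strComp g a b h := by
  induction b using Fin.induction with
  | zero => simp [strComp]
  | succ i ih =>
    by_cases ha : a ≤ i.castSucc
    · rw [strComp_succ f a i ha, strComp_succ g a i ha, H i ha le_rfl,
        ih ha fun j h1 h2 => H j h1 (h2.trans i.castSucc_lt_succ.le)]
    · obtain rfl : a = i.succ := le_antisymm h (Fin.castSucc_lt_iff_succ_le.mp (not_le.mp ha))
      rw [strComp_self, strComp_self]

lemma strComp_update_of_not {f : ∀ i, Strings P X i} (a b : Fin (n + 1)) (h : a ≤ b) (j : Fin n)
    (x : Strings P X j) (hj : ¬ (a ≤ j.castSucc ∧ j.succ ≤ b)) :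
    strComp (Function.update f j x) a b h = strComp f a b h := by
  refine strComp_congr a b h fun i h1 h2 => ?_
  rw [Function.update_of_ne]
  rintro rfl
  exact hj ⟨h1, h2⟩

lemma strComp_update_eq {f : ∀ i, Strings P X i} (a b : Fin (n + 1)) (h : a ≤ b) (j : Fin n)
    (x : Strings P X j) (h1 : a ≤ j.castSucc) (h2 : j.succ ≤ b) :
    strComp (Function.update f j x) a b h =
      strComp f j.succ b h2 ≫ x ≫ strComp f a j.castSucc h1 := by
  rw [← strComp_comp _ a j.succ b (h1.trans j.castSucc_lt_succ.le) h2 h, strComp_succ _ a j h1,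
    Function.update_self, strComp_update_of_not j.succ b, strComp_update_of_not a j.castSucc]
  · rintro ⟨-, h⟩
    exact absurd (lt_of_le_of_lt h j.castSucc_lt_succ) (lt_irrefl _)
  · rintro ⟨h, -⟩
    exact absurd (lt_of_le_of_lt h j.castSucc_lt_succ) (lt_irrefl _)

/-- Restriction of a string along a monotone map: one composes the morphisms in between. -/
def strRes {m : ℕ} (α : Fin (m + 1) →o Fin (n + 1)) (f : ∀ i, Strings P X i) (i : Fin m) :
    Strings P (X ∘ α) i :=
  strComp f (α i.castSucc) (α i.succ) (α.monotone i.castSucc_lt_succ.le)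

lemma strComp_strRes {m : ℕ} (α : Fin (m + 1) →o Fin (n + 1)) (f : ∀ i, Strings P X i)
    (a b : Fin (m + 1)) (h : a ≤ b) :
    strComp (strRes α f) a b h = strComp f (α a) (α b) (α.monotone h) := by
  induction b using Fin.induction with
  | zero =>
    obtain rfl : a = 0 := Fin.le_zero_iff.mp h
    rw [strComp_self, strComp_self]
    rfl
  | succ i ih =>
    by_cases ha : a ≤ i.castSucc
    · rw [strComp_succ _ a i ha, ih ha, strRes,
        strComp_comp f _ _ _ (α.monotone ha) (α.monotone i.castSucc_lt_succ.le) (α.monotone h)]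
    · obtain rfl : a = i.succ := le_antisymm h (Fin.castSucc_lt_iff_succ_le.mp (not_le.mp ha))
      rw [strComp_self, strComp_self]
      rfl

lemma strRes_id (f : ∀ i, Strings P X i) : strRes OrderHom.id f = f := by
  funext i
  change strComp f i.castSucc i.succ i.castSucc_lt_succ.le = f i
  rw [strComp_succ f _ i le_rfl, strComp_self, Category.comp_id]

lemma strRes_comp {m l : ℕ} (α : Fin (m + 1) →o Fin (n + 1)) (β : Fin (l + 1) →o Fin (m + 1))
    (f : ∀ i, Strings P X i) : strRes β (strRes α f) = strRes (α.comp β) f := by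
  funext i
  exact strComp_strRes α f _ _ _

lemma strRes_update_of_not {m : ℕ} (α : Fin (m + 1) →o Fin (n + 1)) (f : ∀ i, Strings P X i)
    (j : Fin n) (x : Strings P X j) (hj : ¬ (α 0 ≤ j.castSucc ∧ j.succ ≤ α (Fin.last m))) :
    strRes α (Function.update f j x) = strRes α f := by
  funext i
  refine strComp_update_of_not _ _ _ j x fun h => hj ⟨?_, ?_⟩
  · exact (α.monotone (Fin.zero_le _)).trans h.1
  · exact h.2.trans (α.monotone (Fin.le_last _))

lemma exists_interval {m : ℕ} (α : Fin (m + 1) →o Fin (n + 1)) (j : Fin n)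
    (h0 : α 0 ≤ j.castSucc) (b : Fin (m + 1)) (hb : j.succ ≤ α b) :
    ∃ i : Fin m, α i.castSucc ≤ j.castSucc ∧ j.succ ≤ α i.succ := by
  induction b using Fin.induction with
  | zero => exact absurd (hb.trans h0) (not_le.mpr j.castSucc_lt_succ)
  | succ i ih =>
    by_cases hi : α i.castSucc ≤ j.castSucc
    · exact ⟨i, hi, hb⟩
    · exact ih (Fin.castSucc_lt_iff_succ_le.mp (not_le.mp hi))

lemma strCases {m : ℕ} (α : Fin (m + 1) →o Fin (n + 1)) (j : Fin n) :
    (j.succ ≤ α 0 ∧ ¬ (α (Fin.last m) ≤ j.castSucc ∧ j.succ ≤ Fin.last n) ∧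
      ¬ (α 0 ≤ j.castSucc ∧ j.succ ≤ α (Fin.last m))) ∨
    (α (Fin.last m) ≤ j.castSucc ∧ ¬ (0 ≤ j.castSucc ∧ j.succ ≤ α 0) ∧
      ¬ (α 0 ≤ j.castSucc ∧ j.succ ≤ α (Fin.last m))) ∨
    (¬ (0 ≤ j.castSucc ∧ j.succ ≤ α 0) ∧
      ¬ (α (Fin.last m) ≤ j.castSucc ∧ j.succ ≤ Fin.last n) ∧
      ∃ i : Fin m, α i.castSucc ≤ j.castSucc ∧ j.succ ≤ α i.succ) := by
  have hle : α 0 ≤ α (Fin.last m) := α.monotone (Fin.zero_le _)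
  have key : ∀ b : Fin (n + 1), ¬ (b ≤ j.castSucc ∧ j.succ ≤ b) := fun b h =>
    absurd (h.2.trans h.1) (not_le.mpr j.castSucc_lt_succ)
  by_cases h0 : α 0 ≤ j.castSucc
  · by_cases hm : j.succ ≤ α (Fin.last m)
    · exact Or.inr (Or.inr ⟨fun h => key _ ⟨h0, h.2⟩, fun h => key _ ⟨h.1, hm⟩,
        exists_interval α j h0 _ hm⟩)
    · exact Or.inr (Or.inl ⟨not_lt.mp fun h => hm (Fin.castSucc_lt_iff_succ_le.mp h),
        fun h => key _ ⟨h0, h.2⟩, fun h => hm h.2⟩)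
  · have h0' : j.succ ≤ α 0 := Fin.castSucc_lt_iff_succ_le.mp (not_le.mp h0)
    exact Or.inl ⟨h0', fun h => h0 (hle.trans h.1), fun h => h0 h.1⟩

lemma strRes_update_eq {m : ℕ} (α : Fin (m + 1) →o Fin (n + 1)) (f : ∀ i, Strings P X i)
    (j : Fin n) (i : Fin m) (h1 : α i.castSucc ≤ j.castSucc) (h2 : j.succ ≤ α i.succ)
    (x : Strings P X j) :
    strRes α (Function.update f j x) = Function.update (strRes α f) i
      (strComp f j.succ (α i.succ) h2 ≫ x ≫ strComp f (α i.castSucc) j.castSucc h1) := by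
  funext l
  by_cases hl : l = i
  · subst hl
    rw [Function.update_self, strRes, strComp_update_eq _ _ _ _ _ h1 h2]
  · rw [Function.update_of_ne hl]
    refine strComp_update_of_not _ _ _ j x fun h => hl ?_
    rcases lt_trichotomy l i with hli | hli | hli
    · have : α l.succ ≤ α i.castSucc := α.monotone (Fin.succ_le_castSucc_iff.mpr hli)
      exact absurd ((h.2.trans this).trans h1) (not_le.mpr j.castSucc_lt_succ)
    · exact hli
    · have : α i.succ ≤ α l.castSucc := α.monotone (Fin.succ_le_castSucc_iff.mpr hli)
      exact absurd ((h2.trans this).trans h.1) (not_le.mpr j.castSucc_lt_succ)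

end Strings


section Bar

variable (k : Type u) [Field k] {C : Type w} [Category.{v} C] [Preadditive C] [Linear k C]
  {D : Type w'} [Category.{v'} D] [Preadditive D] [Linear k D]
  {ι : Type t} (P : ι → C)

/-- The coproducts in `D` that are needed to form the bar construction over the family `P`. -/
class HasBarCoproducts (D : Type w') [Category.{v'} D] : Prop where
  sum : ∀ n : ℕ, HasColimitsOfShape (Discrete (Fin (n + 1) → ι)) D
  copower : ∀ (n : ℕ) (X : Fin (n + 1) → ι), HasColimitsOfShape
    (Discrete (Module.Basis.ofVectorSpaceIndex k (⨂[k] i, Strings P X i))) D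

attribute [instance] HasBarCoproducts.sum HasBarCoproducts.copower

variable (F : Cᵒᵖ ⥤ C ⥤ D) [HasBarCoproducts k P D]

/-- The summand `(C(X₁, X₀) ⊗ ⋯ ⊗ C(Xₙ, Xₙ₋₁)) • F(X₀, Xₙ)` of the bar construction. -/
abbrev barSummand (n : ℕ) (X : Fin (n + 1) → ι) : D :=
  copower k (⨂[k] i, Strings P X i) ((F.obj (op (P (X 0)))).obj (P (X (Fin.last n))))

/-- The object of `n`-simplices of the bar construction, the coproduct over all `X₀, …, Xₙ` of
`(C(X₁, X₀) ⊗ ⋯ ⊗ C(Xₙ, Xₙ₋₁)) • F(X₀, Xₙ)`. -/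
def barObj (n : ℕ) : D := ∐ fun X : Fin (n + 1) → ι => barSummand k P F n X

/-- The inclusion of a summand of the bar construction. -/
def barIncl (n : ℕ) (X : Fin (n + 1) → ι) : barSummand k P F n X ⟶ barObj k P F n :=
  Sigma.ι (fun X : Fin (n + 1) → ι => barSummand k P F n X) X

/-- The universal multilinear family `C(X₁, X₀) × ⋯ × C(Xₙ, Xₙ₋₁) → Hom(F(X₀, Xₙ), Bₙ F)`. -/
def barι (n : ℕ) (X : Fin (n + 1) → ι) :
    MultilinearMap k (Strings P X)
      ((F.obj (op (P (X 0)))).obj (P (X (Fin.last n))) ⟶ barObj k P F n) :=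
  ((Linear.rightComp k _ (barIncl k P F n X)) ∘ₗ
    copowerι k (⨂[k] i, Strings P X i) _).compMultilinearMap (PiTensorProduct.tprod k)

variable {P F}

/-- The morphism out of the `n`-simplices determined by a multilinear family. -/
def barDesc {n : ℕ} {Z : D}
    (φ : ∀ X : Fin (n + 1) → ι, MultilinearMap k (Strings P X)
      ((F.obj (op (P (X 0)))).obj (P (X (Fin.last n))) ⟶ Z)) : barObj k P F n ⟶ Z :=
  Sigma.desc fun X => copowerDesc k (PiTensorProduct.lift (φ X))

lemma barι_desc {n : ℕ} {Z : D}
    (φ : ∀ X : Fin (n + 1) → ι, MultilinearMap k (Strings P X)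
      ((F.obj (op (P (X 0)))).obj (P (X (Fin.last n))) ⟶ Z))
    (X : Fin (n + 1) → ι) (f : ∀ i, Strings P X i) :
    barι k P F n X f ≫ barDesc k φ = φ X f := by
  have h : barIncl k P F n X ≫ barDesc k φ = copowerDesc k (PiTensorProduct.lift (φ X)) :=
    Sigma.ι_desc _ X
  change (copowerι k _ _ (PiTensorProduct.tprod k f) ≫ barIncl k P F n X) ≫ barDesc k φ = _
  rw [Category.assoc, h, copowerι_desc, PiTensorProduct.lift.tprod]

lemma bar_hom_ext {n : ℕ} {Z : D} {g h : barObj k P F n ⟶ Z}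
    (H : ∀ (X : Fin (n + 1) → ι) (f : ∀ i, Strings P X i),
      barι k P F n X f ≫ g = barι k P F n X f ≫ h) : g = h := by
  refine Sigma.hom_ext _ _ fun X => copower_hom_ext k fun x => ?_
  have : Linear.rightComp k _ (barIncl k P F n X ≫ g) ∘ₗ
      copowerι k (⨂[k] i, Strings P X i) _ =
      Linear.rightComp k _ (barIncl k P F n X ≫ h) ∘ₗ
      copowerι k (⨂[k] i, Strings P X i) _ := by
    refine PiTensorProduct.ext (MultilinearMap.ext fun f => ?_)
    have := H X f
    change (copowerι k _ _ (PiTensorProduct.tprod k f) ≫ barIncl k P F n X) ≫ g =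
      (copowerι k _ _ (PiTensorProduct.tprod k f) ≫ barIncl k P F n X) ≫ h at this
    rw [Category.assoc, Category.assoc] at this
    exact this
  exact LinearMap.congr_fun this x

variable [IsBilinear k F]

/-- The effect of a monotone map `α : [m] → [n]` on multilinear families: the morphisms of a string
before `α 0` act on the first argument of `F`, those after `α m` act on the second one, and those in
between are composed. -/
def strPull {m n : ℕ} (α : Fin (m + 1) →o Fin (n + 1)) (X : Fin (n + 1) → ι) {Z : D}
    (β : MultilinearMap k (Strings P (X ∘ α))
      ((F.obj (op (P (X (α 0))))).obj (P (X (α (Fin.last m)))) ⟶ Z)) :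
    MultilinearMap k (Strings P X)
      ((F.obj (op (P (X 0)))).obj (P (X (Fin.last n))) ⟶ Z) where
  toFun f :=
    (F.map (strComp f 0 (α 0) (Fin.zero_le _)).op).app _ ≫
      (F.obj _).map (strComp f (α (Fin.last m)) (Fin.last n) (Fin.le_last _)) ≫
        β (strRes α f)
  map_update_add' {inst} f j x y := by
    obtain rfl : inst = instDecidableEqFin n := Subsingleton.elim _ _
    rcases strCases α j with ⟨h1, h2, h3⟩ | ⟨h1, h2, h3⟩ | ⟨h1, h2, h3⟩
    · simp only [strComp_update_eq 0 _ _ j _ (Fin.zero_le _) h1, strComp_update_of_not _ _ _ j _ h2,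
        strRes_update_of_not α f j _ h3, Preadditive.add_comp, Preadditive.comp_add,
        IsBilinear.map_add_left k]
    · simp only [strComp_update_eq _ _ _ j _ h1 (Fin.le_last _), strComp_update_of_not _ _ _ j _ h2,
        strRes_update_of_not α f j _ h3, Preadditive.add_comp, Preadditive.comp_add,
        IsBilinear.map_add_right k]
    · obtain ⟨i, hi, hi'⟩ := h3
      simp only [strComp_update_of_not _ _ _ j _ h1, strComp_update_of_not _ _ _ j _ h2,
        strRes_update_eq α f j i hi hi', Preadditive.add_comp, Preadditive.comp_add,
        MultilinearMap.map_update_add]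
  map_update_smul' {inst} f j c x := by
    obtain rfl : inst = instDecidableEqFin n := Subsingleton.elim _ _
    rcases strCases α j with ⟨h1, h2, h3⟩ | ⟨h1, h2, h3⟩ | ⟨h1, h2, h3⟩
    · simp only [strComp_update_eq 0 _ _ j _ (Fin.zero_le _) h1, strComp_update_of_not _ _ _ j _ h2,
        strRes_update_of_not α f j _ h3, Linear.smul_comp, Linear.comp_smul,
        IsBilinear.map_smul_left]
    · simp only [strComp_update_eq _ _ _ j _ h1 (Fin.le_last _), strComp_update_of_not _ _ _ j _ h2,
        strRes_update_of_not α f j _ h3, Linear.smul_comp, Linear.comp_smul,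
        IsBilinear.map_smul_right]
    · obtain ⟨i, hi, hi'⟩ := h3
      simp only [strComp_update_of_not _ _ _ j _ h1, strComp_update_of_not _ _ _ j _ h2,
        strRes_update_eq α f j i hi hi', Linear.smul_comp, Linear.comp_smul,
        MultilinearMap.map_update_smul]

variable (P F) in
/-- The simplicial bar construction `B_* F` over the family `P`. -/
def barSimplicial : SimplicialObject D where
  obj n := barObj k P F n.unop.len
  map α := barDesc k fun X =>
    strPull k α.unop.toOrderHom X (barι k P F _ (X ∘ α.unop.toOrderHom))
  map_id n := by
    refine bar_hom_ext k fun X f => ?_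
    rw [barι_desc]
    change (F.map (strComp f 0 0 le_rfl).op).app _ ≫
      (F.obj _).map (strComp f (Fin.last _) (Fin.last _) le_rfl) ≫
        barι k P F _ X (strRes OrderHom.id f) = _ ≫ 𝟙 _
    rw [strRes_id, strComp_self, strComp_self]
    simp
  map_comp {n m l} α β := by
    refine bar_hom_ext k fun X f => ?_
    rw [barι_desc, ← Category.assoc, barι_desc]
    generalize hα : α.unop.toOrderHom = a
    generalize hβ : β.unop.toOrderHom = b
    have hab : (α ≫ β).unop.toOrderHom = a.comp b := by rw [← hα, ← hβ]; rfl
    rw [hab]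
    change (F.map (strComp f 0 (a (b 0)) (Fin.zero_le _)).op).app _ ≫
      (F.obj _).map (strComp f (a (b (Fin.last _))) (Fin.last _) (Fin.le_last _)) ≫
        barι k P F _ ((X ∘ a) ∘ b) (strRes (a.comp b) f) =
      ((F.map (strComp f 0 (a 0) (Fin.zero_le _)).op).app _ ≫
        (F.obj _).map (strComp f (a (Fin.last _)) (Fin.last _) (Fin.le_last _)) ≫
          barι k P F _ (X ∘ a) (strRes a f)) ≫ _
    rw [Category.assoc, Category.assoc, barι_desc]
    change _ = (F.map (strComp f 0 (a 0) (Fin.zero_le _)).op).app _ ≫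
        (F.obj _).map (strComp f (a (Fin.last _)) (Fin.last _) (Fin.le_last _)) ≫
          (F.map (strComp (strRes a f) 0 (b 0) (Fin.zero_le _)).op).app _ ≫
      (F.obj _).map (strComp (strRes a f) (b (Fin.last _)) (Fin.last _) (Fin.le_last _)) ≫
        barι k P F _ ((X ∘ a) ∘ b) (strRes b (strRes a f))
    rw [strRes_comp, strComp_strRes, strComp_strRes,
      ← strComp_comp f 0 (a 0) (a (b 0)) (Fin.zero_le _) (a.monotone (Fin.zero_le _)),
      ← strComp_comp f (a (b (Fin.last _))) (a (Fin.last _)) (Fin.last _)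
        (a.monotone (Fin.le_last _)) (Fin.le_last _)]
    simp

variable (P F) in
/-- The derived coend of `F` over the family `P`: the chain complex associated with the simplicial
bar construction, i.e. the totalization of this construction seen as a double complex. (When `F` takes
values in projective objects, as in all cases of interest here, no replacement of `F` is needed.) For
a finite family `P` this is the finite version of the derived coend. -/
def barComplex : ChainComplex D ℕ :=
  (AlgebraicTopology.alternatingFaceMapComplex D).obj (barSimplicial k P F)

variable (P F) in
/-- The inclusion of the part of the `n`-chains given by a string of `n` morphisms. -/
def chainι (n : ℕ) (X : Fin (n + 1) → ι) :
    MultilinearMap k (Strings P X)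
      ((F.obj (op (P (X 0)))).obj (P (X (Fin.last n))) ⟶ (barComplex k P F).X n) :=
  barι k P F n X

/-- The augmentation of the derived coend to a cowedge, on `0`-chains. -/
def barAugmentationZero (W : Cowedge F) : (barComplex k P F).X 0 ⟶ W.pt :=
  barDesc k fun X => MultilinearMap.constOfIsEmpty k _ (W.π (P (X 0)))

lemma chainι_augmentationZero (W : Cowedge F) (X : Fin 1 → ι) (f : ∀ i, Strings P X i) :
    chainι k P F 0 X f ≫ barAugmentationZero k W = W.π (P (X 0)) :=
  barι_desc k _ X f

/-- The composite of a face of a `1`-chain with the augmentation, where `p` is the vertex that the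
face keeps. -/
def edgeTerm (W : Cowedge F) (X : Fin 2 → ι) (f : ∀ i, Strings P X i) (p : Fin 2) :
    (F.obj (op (P (X 0)))).obj (P (X (Fin.last 1))) ⟶ W.pt :=
  (F.map (strComp f 0 p (Fin.zero_le _)).op).app _ ≫
    (F.obj _).map (strComp f p (Fin.last 1) (Fin.le_last _)) ≫ W.π (P (X p))

lemma map_augmentationZero (W : Cowedge F) (X : Fin 2 → ι) (f : ∀ i, Strings P X i) (i : Fin 2) :
    barι k P F 1 X f ≫ (barSimplicial k P F).δ i ≫ barAugmentationZero k W =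
      edgeTerm W X f (i.succAbove 0) := by
  have h : ∀ a : Fin 1 →o Fin 2,
      strPull k a X (barι k P F 0 (X ∘ a)) f ≫ barAugmentationZero k W =
        edgeTerm W X f (a 0) := fun a =>
    (Category.assoc _ _ _).trans (congrArg _ ((Category.assoc _ _ _).trans
      (congrArg _ (chainι_augmentationZero k W (X ∘ a) (strRes a f)))))
  refine (Category.assoc _ _ _).symm.trans ?_
  refine (congrArg (fun h => h ≫ barAugmentationZero k W) (barι_desc k _ X f)).trans ?_
  exact h (SimplexCategory.δ (n := 0) i).toOrderHom

lemma d_augmentationZero (W : Cowedge F) :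
    (barComplex k P F).d 1 0 ≫ barAugmentationZero k W = 0 := by
  have hd : (barComplex k P F).d 1 0 =
      (barSimplicial k P F).δ 0 - (barSimplicial k P F).δ 1 := by
    change ((AlgebraicTopology.alternatingFaceMapComplex D).obj (barSimplicial k P F)).d 1 0 = _
    rw [AlgebraicTopology.alternatingFaceMapComplex_obj_d]
    simp [AlgebraicTopology.AlternatingFaceMapComplex.objD, Fin.sum_univ_two, ← sub_eq_add_neg]
    rfl
  have hd' : (barComplex k P F).d 1 0 ≫ barAugmentationZero k W =
      (barSimplicial k P F).δ 0 ≫ barAugmentationZero k W -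
        (barSimplicial k P F).δ 1 ≫ barAugmentationZero k W :=
    (congrArg (fun h => h ≫ barAugmentationZero k W) hd).trans (Preadditive.sub_comp _ _ _)
  have h1 : ∀ (X : Fin 2 → ι) (f : ∀ i, Strings P X i), edgeTerm W X f 1 =
      (F.map (strComp f 0 1 (Fin.zero_le _)).op).app _ ≫ W.π (P (X 1)) := fun X f => by
    change _ ≫ (F.obj _).map (strComp f 1 1 le_rfl) ≫ _ = _
    rw [strComp_self, (F.obj _).map_id]
    exact congrArg _ (Category.id_comp _)
  have h0 : ∀ (X : Fin 2 → ι) (f : ∀ i, Strings P X i), edgeTerm W X f 0 =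
      (F.obj _).map (strComp f 0 1 (Fin.zero_le _)) ≫ W.π (P (X 0)) := fun X f => by
    change (F.map (strComp f 0 0 le_rfl).op).app _ ≫ _ = _
    rw [strComp_self, op_id, F.map_id, NatTrans.id_app, Category.id_comp]
    rfl
  refine hd'.trans (sub_eq_zero.mpr (bar_hom_ext k fun X f => ?_))
  exact (map_augmentationZero k W X f 0).trans ((h1 X f).trans
    ((W.condition (strComp f 0 1 (Fin.zero_le _))).trans
      ((h0 X f).symm.trans (map_augmentationZero k W X f 1).symm)))

/-- The augmentation of the derived coend to a cowedge of `F`, induced by the structure maps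
`F(P i, P i) ⟶ W` of the cowedge. -/
def barAugmentation [HasZeroObject D] (W : Cowedge F) :
    barComplex k P F ⟶ (ChainComplex.single₀ D).obj W.pt :=
  (ChainComplex.toSingle₀Equiv _ _).symm ⟨barAugmentationZero k W, d_augmentationZero k W⟩

end Bar

section Coproducts

/-- Finite families of objects in a category with finite-dimensional morphism spaces. -/
instance hasBarCoproducts_of_finite (k : Type u) [Field k] {C : Type w} [Category.{v} C]
    [Preadditive C] [Linear k C] [∀ X Y : C, Module.Finite k (X ⟶ Y)] {ι : Type t} [Finite ι]
    (P : ι → C) (D : Type w') [Category.{v'} D] [HasFiniteCoproducts D] :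
    HasBarCoproducts k P D where
  sum n := inferInstance
  copower n X := by
    have : Module.Finite k (⨂[k] i, Strings P X i) := inferInstance
    have : Finite (Module.Basis.ofVectorSpaceIndex k (⨂[k] i, Strings P X i)) :=
      Module.Finite.finite_basis (Module.Basis.ofVectorSpace k _)
    infer_instance

/-- Arbitrary families of objects, with values in large enough vector spaces. -/
instance hasBarCoproducts_moduleCat (k : Type u) [Field k] {C : Type w} [Category.{v} C]
    [Preadditive C] [Linear k C] {ι : Type w} (P : ι → C) :
    HasBarCoproducts k P (ModuleCat.{max u v w} k) where
  sum _ := (inferInstance : HasCoproducts.{w} (ModuleCat.{max u v w} k)) _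
  copower _ _ := (inferInstance : HasCoproducts.{max u v} (ModuleCat.{max u v w} k)) _

end Coproducts

section Finite

variable (k : Type u) [Field k]

/-- A `k`-linear category is finite if it is equivalent, as a `k`-linear category, to the category
of finite-dimensional modules over some finite-dimensional `k`-algebra. (Over such an algebra the
finite-dimensional modules are the finitely generated ones.) -/
class IsFiniteLinear (C : Type w) [Category.{v} C] [Preadditive C] [Linear k C] : Prop where
  exists_equivalence : ∃ (A : Type u) (_ : Ring A) (_ : Algebra k A) (_ : Module.Finite k A)
    (e : C ≌ FGModuleCat.{u} A), e.functor.Additive ∧ e.functor.Linear k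

open scoped ModuleCat in
lemma finite_of_fgModule {A : Type u} [Ring A] [Algebra k A] [Module.Finite k A]
    (M : FGModuleCat.{u} A) : Module.Finite k M.obj :=
  Module.Finite.trans A M.obj

open scoped ModuleCat in
lemma finite_hom_fgModule {A : Type u} [Ring A] [Algebra k A] [Module.Finite k A]
    (M N : FGModuleCat.{u} A) : Module.Finite k (M ⟶ N) := by
  have := finite_of_fgModule k M
  have := finite_of_fgModule k N
  let φ : (M ⟶ N) →ₗ[k] (M.obj →ₗ[k] N.obj) :=
    { toFun := fun f => f.hom.hom.restrictScalars k
      map_add' := fun _ _ => rfl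
      map_smul' := fun _ _ => rfl }
  refine Module.Finite.of_injective φ fun f g h => ?_
  ext x
  exact LinearMap.congr_fun h x

instance finite_hom {C : Type w} [Category.{v} C] [Preadditive C] [Linear k C]
    [h : IsFiniteLinear k C] (X Y : C) : Module.Finite k (X ⟶ Y) := by
  obtain ⟨A, _, _, _, e, _, _⟩ := h.exists_equivalence
  have := finite_hom_fgModule k (e.functor.obj X) (e.functor.obj Y)
  exact Module.Finite.of_injective (e.functor.mapLinearMap k) e.functor.map_injective

end Finite

section Deligne

open scoped ModuleCat

variable (k : Type u) [Field k] {A : Type u} [Ring A] [Algebra k A]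

/-- The right `A`-module structure on the dual space of a left `A`-module. -/
def dualAction (M : Type u) [AddCommGroup M] [Module k M] [Module A M] [IsScalarTower k A M] :
    Aᵐᵒᵖ →ₐ[k] Module.End k (Module.Dual k M) where
  toFun a := (Algebra.lsmul k k M a.unop).dualMap
  map_one' := by ext; simp
  map_mul' a b := by ext; simp
  map_zero' := by ext; simp
  map_add' a b := by ext; simp
  commutes' r := by ext; simp

/-- The action of `Aᵐᵒᵖ ⊗ A` on `M^* ⊗ N`. -/
def boxAction (M N : Type u) [AddCommGroup M] [Module k M] [Module A M] [IsScalarTower k A M]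
    [AddCommGroup N] [Module k N] [Module A N] [IsScalarTower k A N] :
    Aᵐᵒᵖ ⊗[k] A →ₐ[k] Module.End k (Module.Dual k M ⊗[k] N) :=
  (Module.endTensorEndAlgHom (R := k) (S := k) (A := k)).comp
    (Algebra.TensorProduct.map (dualAction k M) (Algebra.lsmul k k N))

/-- The underlying space `M^* ⊗ N` of the object `M ⊠ N`. -/
def BoxCarrier (M N : FGModuleCat.{u} A) : Type u := Module.Dual k M.obj ⊗[k] N.obj

instance (M N : FGModuleCat.{u} A) : AddCommGroup (BoxCarrier k M N) :=
  inferInstanceAs (AddCommGroup (Module.Dual k M.obj ⊗[k] N.obj))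

instance (M N : FGModuleCat.{u} A) : Module k (BoxCarrier k M N) :=
  inferInstanceAs (Module k (Module.Dual k M.obj ⊗[k] N.obj))

instance (M N : FGModuleCat.{u} A) : Module (Aᵐᵒᵖ ⊗[k] A) (BoxCarrier k M N) :=
  Module.compHom (Module.Dual k M.obj ⊗[k] N.obj) (boxAction k M.obj N.obj).toRingHom

lemma box_smul_def (M N : FGModuleCat.{u} A) (r : Aᵐᵒᵖ ⊗[k] A) (x : BoxCarrier k M N) :
    r • x = (boxAction k M.obj N.obj r x : Module.Dual k M.obj ⊗[k] N.obj) := rfl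

instance (M N : FGModuleCat.{u} A) : IsScalarTower k (Aᵐᵒᵖ ⊗[k] A) (BoxCarrier k M N) where
  smul_assoc r s x := by
    rw [box_smul_def, map_smul]; rfl

instance [Module.Finite k A] (M N : FGModuleCat.{u} A) :
    Module.Finite (Aᵐᵒᵖ ⊗[k] A) (BoxCarrier k M N) := by
  have := finite_of_fgModule k M
  have := finite_of_fgModule k N
  have : Module.Finite k (BoxCarrier k M N) :=
    inferInstanceAs (Module.Finite k (Module.Dual k M.obj ⊗[k] N.obj))
  exact Module.Finite.of_restrictScalars_finite k _ _

lemma boxAction_tmul (M N : Type u) [AddCommGroup M] [Module k M] [Module A M]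
    [IsScalarTower k A M] [AddCommGroup N] [Module k N] [Module A N] [IsScalarTower k A N]
    (a : Aᵐᵒᵖ) (b : A) (φ : Module.Dual k M) (n : N) :
    boxAction k M N (a ⊗ₜ b) (φ ⊗ₜ n) = (φ ∘ₗ Algebra.lsmul k k M a.unop) ⊗ₜ (b • n) := rfl

/-- The `k`-linear map `M^* ⊗ N → M'^* ⊗ N'` induced by `M' ⟶ M` and `N ⟶ N'`. -/
def boxMapLinear {M M' N N' : FGModuleCat.{u} A} (f : M' ⟶ M) (g : N ⟶ N') :
    Module.Dual k M.obj ⊗[k] N.obj →ₗ[k] Module.Dual k M'.obj ⊗[k] N'.obj :=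
  TensorProduct.map (f.hom.hom.restrictScalars k).dualMap (g.hom.hom.restrictScalars k)

lemma boxMapLinear_boxAction {M M' N N' : FGModuleCat.{u} A} (f : M' ⟶ M) (g : N ⟶ N')
    (r : Aᵐᵒᵖ ⊗[k] A) : boxMapLinear k f g ∘ₗ boxAction k M.obj N.obj r =
      boxAction k M'.obj N'.obj r ∘ₗ boxMapLinear k f g := by
  induction r using TensorProduct.induction_on with
  | zero => simp
  | add r s hr hs => rw [map_add, map_add, LinearMap.comp_add, LinearMap.add_comp, hr, hs]
  | tmul a b =>
    refine TensorProduct.ext' fun φ n => ?_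
    change boxMapLinear k f g (boxAction k M.obj N.obj (a ⊗ₜ b) (φ ⊗ₜ n)) =
      boxAction k M'.obj N'.obj (a ⊗ₜ b) ((φ ∘ₗ f.hom.hom.restrictScalars k) ⊗ₜ g.hom.hom n)
    rw [boxAction_tmul, boxAction_tmul]
    change ((φ ∘ₗ Algebra.lsmul k k M.obj a.unop) ∘ₗ f.hom.hom.restrictScalars k) ⊗ₜ[k]
      (g.hom.hom (b • n)) = _
    rw [map_smul]
    congr 1
    ext x
    exact congrArg φ (map_smul f.hom.hom a.unop x).symm

/-- The morphism `M ⊠ N ⟶ M' ⊠ N'` induced by `M' ⟶ M` and `N ⟶ N'`. -/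
def boxMap {M M' N N' : FGModuleCat.{u} A} (f : M' ⟶ M) (g : N ⟶ N') :
    BoxCarrier k M N →ₗ[Aᵐᵒᵖ ⊗[k] A] BoxCarrier k M' N' where
  toFun := boxMapLinear k f g
  map_add' := map_add (boxMapLinear k f g)
  map_smul' r x := LinearMap.congr_fun (boxMapLinear_boxAction k f g r) x

lemma boxMap_ext {M N : FGModuleCat.{u} A} {Z : Type u} [AddCommGroup Z] [Module (Aᵐᵒᵖ ⊗[k] A) Z]
    {f g : BoxCarrier k M N →ₗ[Aᵐᵒᵖ ⊗[k] A] Z}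
    (h : ∀ (φ : Module.Dual k M.obj) (n : N.obj),
      f (show Module.Dual k M.obj ⊗[k] N.obj from φ ⊗ₜ n) =
      g (show Module.Dual k M.obj ⊗[k] N.obj from φ ⊗ₜ n)) : f = g := by
  ext x
  change Module.Dual k M.obj ⊗[k] N.obj at x
  induction x using TensorProduct.induction_on with
  | zero => exact (map_zero f).trans (map_zero g).symm
  | add x y hx hy => exact (map_add f _ _).trans ((congrArg₂ _ hx hy).trans (map_add g _ _).symm)
  | tmul φ n => exact h φ n

lemma boxMap_id (M N : FGModuleCat.{u} A) : boxMap k (𝟙 M) (𝟙 N) = LinearMap.id :=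
  boxMap_ext k fun _ _ => rfl

lemma boxMap_comp {M M' M'' N N' N'' : FGModuleCat.{u} A} (f : M' ⟶ M) (f' : M'' ⟶ M')
    (g : N ⟶ N') (g' : N' ⟶ N'') :
    boxMap k (f' ≫ f) (g ≫ g') = boxMap k f' g' ∘ₗ boxMap k f g :=
  boxMap_ext k fun _ _ => rfl

lemma boxCarrier_smul (r : k) (M N : FGModuleCat.{u} A) (x : BoxCarrier k M N) :
    algebraMap k (Aᵐᵒᵖ ⊗[k] A) r • x = r • x := by
  rw [Algebra.algebraMap_eq_smul_one, smul_assoc, one_smul]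

variable [Module.Finite k A]

/-- The Deligne product `Cᵒᵖ ⊠ C` for the category `C` of finite-dimensional modules over the
finite-dimensional algebra `A`. Since `Cᵒᵖ` is the category of finite-dimensional right `A`-modules
via `M ↦ M^* = Hom_k(M, k)`, it is the category of finite-dimensional modules over `Aᵐᵒᵖ ⊗ A`. -/
abbrev DeligneProduct (k A : Type u) [Field k] [Ring A] [Algebra k A] : Type (u + 1) :=
  FGModuleCat.{u} (Aᵐᵒᵖ ⊗[k] A)

/-- The canonical functor `⊠ : Cᵒᵖ × C ⥤ Cᵒᵖ ⊠ C`, which sends `(M, N)` to `M^* ⊗ N`. -/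
def box : (FGModuleCat.{u} A)ᵒᵖ ⥤ FGModuleCat.{u} A ⥤ DeligneProduct k A where
  obj M :=
    { obj := fun N => FGModuleCat.of _ (BoxCarrier k M.unop N)
      map := fun g => FGModuleCat.ofHom (boxMap k (𝟙 _) g)
      map_id := fun N => congrArg FGModuleCat.ofHom (boxMap_id k M.unop N)
      map_comp := fun g g' => congrArg FGModuleCat.ofHom (boxMap_comp k (𝟙 _) (𝟙 _) g g') }
  map f :=
    { app := fun N => FGModuleCat.ofHom (boxMap k f.unop (𝟙 N))
      naturality := fun N N' g => congrArg FGModuleCat.ofHom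
        ((boxMap_comp k (𝟙 _) f.unop g (𝟙 N')).symm.trans
          (boxMap_comp k f.unop (𝟙 _) (𝟙 N) g)) }
  map_id M := by
    ext N : 2
    exact congrArg FGModuleCat.ofHom (boxMap_id k M.unop N)
  map_comp f f' := by
    ext N : 2
    exact congrArg FGModuleCat.ofHom (boxMap_comp k f.unop f'.unop (𝟙 N) (𝟙 N))

/-- The functor `Cᵒᵖ × C ⥤ D` that underlies a functor `F : Cᵒᵖ ⊠ C ⥤ D`, for a category `C` that
is identified with the finite-dimensional `A`-modules. -/
def ofDeligne {C : Type w} [Category.{v} C] {D : Type w'} [Category.{v'} D]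
    (e : C ≌ FGModuleCat.{u} A) (F : DeligneProduct k A ⥤ D) : Cᵒᵖ ⥤ C ⥤ D :=
  e.functor.op ⋙ box k ⋙ (Functor.whiskeringLeft _ _ _).obj e.functor ⋙
    (Functor.whiskeringRight _ _ _).obj F

lemma boxMap_add_left {M M' N N' : FGModuleCat.{u} A} (f f' : M' ⟶ M) (g : N ⟶ N') :
    FGModuleCat.ofHom (boxMap k (f + f') g) =
      FGModuleCat.ofHom (boxMap k f g) + FGModuleCat.ofHom (boxMap k f' g) := by
  refine FGModuleCat.hom_ext (boxMap_ext k fun φ n => ?_)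
  change (φ ∘ₗ (f.hom.hom.restrictScalars k + f'.hom.hom.restrictScalars k)) ⊗ₜ[k] g.hom.hom n = _
  rw [LinearMap.comp_add, TensorProduct.add_tmul]
  rfl

lemma boxMap_add_right {M M' N N' : FGModuleCat.{u} A} (f : M' ⟶ M) (g g' : N ⟶ N') :
    FGModuleCat.ofHom (boxMap k f (g + g')) =
      FGModuleCat.ofHom (boxMap k f g) + FGModuleCat.ofHom (boxMap k f g') :=
  FGModuleCat.hom_ext (boxMap_ext k fun _ n => TensorProduct.tmul_add _ (g.hom.hom n) _)

lemma boxMap_smul_left (r : k) {M M' N N' : FGModuleCat.{u} A} (f : M' ⟶ M) (g : N ⟶ N') :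
    FGModuleCat.ofHom (boxMap k (r • f) g) = r • FGModuleCat.ofHom (boxMap k f g) := by
  refine FGModuleCat.hom_ext (boxMap_ext k fun φ n => ?_)
  refine Eq.trans ?_ (boxCarrier_smul k r M' N' (boxMapLinear k f g (φ ⊗ₜ n))).symm
  change (φ ∘ₗ (r • f.hom.hom.restrictScalars k)) ⊗ₜ[k] g.hom.hom n = _
  rw [LinearMap.comp_smul]
  rfl

lemma boxMap_smul_right (r : k) {M M' N N' : FGModuleCat.{u} A} (f : M' ⟶ M) (g : N ⟶ N') :
    FGModuleCat.ofHom (boxMap k f (r • g)) = r • FGModuleCat.ofHom (boxMap k f g) := by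
  refine FGModuleCat.hom_ext (boxMap_ext k fun φ n => ?_)
  refine Eq.trans ?_ (boxCarrier_smul k r M' N' (boxMapLinear k f g (φ ⊗ₜ n))).symm
  exact TensorProduct.tmul_smul r _ (g.hom.hom n)

instance ofDeligne_isBilinear {C : Type w} [Category.{v} C] [Preadditive C] [Linear k C]
    {D : Type w'} [Category.{v'} D] [Preadditive D] [Linear k D] (e : C ≌ FGModuleCat.{u} A)
    [e.functor.Additive] [e.functor.Linear k] (F : DeligneProduct k A ⥤ D) [F.Additive]
    [F.Linear k] : IsBilinear k (ofDeligne k e F) where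
  map_add_left f g Y := by
    change F.map (FGModuleCat.ofHom (boxMap k (e.functor.map (f + g)) (𝟙 _))) = _
    rw [e.functor.map_add, boxMap_add_left, F.map_add]
    rfl
  map_smul_left r f Y := by
    change F.map (FGModuleCat.ofHom (boxMap k (e.functor.map (r • f)) (𝟙 _))) = _
    rw [e.functor.map_smul, boxMap_smul_left, F.map_smul]
    rfl
  map_add_right X _ _ f g := by
    change F.map (FGModuleCat.ofHom (boxMap k (𝟙 _) (e.functor.map (f + g)))) = _
    rw [e.functor.map_add, boxMap_add_right, F.map_add]
    rfl
  map_smul_right X _ _ r f := by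
    change F.map (FGModuleCat.ofHom (boxMap k (𝟙 _) (e.functor.map (r • f)))) = _
    rw [e.functor.map_smul, boxMap_smul_right, F.map_smul]
    rfl

end Deligne

section Tensor

variable {C : Type w} [Category.{v} C] [MonoidalCategory C] [RigidCategory C]

variable (C) in
/-- The duality functor `X ↦ X^∨`, where `X^∨` is the dual of `X` that comes with a coevaluation
`𝟙_ C ⟶ X ⊗ X^∨` and an evaluation `X^∨ ⊗ X ⟶ 𝟙_ C`. -/
def dualFunctor : Cᵒᵖ ⥤ C where
  obj X := X.unopᘁ
  map f := f.unopᘁ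
  map_comp f g := comp_rightAdjointMate

/-- The functor `(X, Y) ↦ Y ⊗ G(X)^∨`. -/
def tensorDual (G : C ⥤ C) : Cᵒᵖ ⥤ C ⥤ C := G.op ⋙ dualFunctor C ⋙ tensoringRight C

instance tensorDual_isBilinear (k : Type u) [Field k] [Preadditive C] [Linear k C]
    [MonoidalPreadditive C] [MonoidalLinear k C] (G : C ⥤ C) [G.Additive] [G.Linear k] :
    IsBilinear k (tensorDual G) where
  map_add_left f g Y := by
    simp [tensorDual, dualFunctor, rightAdjointMate]
    rfl
  map_smul_left r f Y := by
    simp [tensorDual, dualFunctor, rightAdjointMate]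
    rfl
  map_add_right X _ _ f g := by
    simp [tensorDual]
    rfl
  map_smul_right X _ _ r f := by
    simp [tensorDual]
    rfl

end Tensor

section Hochschild

variable (k : Type u) [Field k] (C : Type w) [Category.{v} C] [Preadditive C] [Linear k C]

/-- The functor `(X, Y) ↦ C(X, Y)` with values in vector spaces. (The universe of the vector spaces
is raised, so that direct sums over all objects of `C` make sense.) -/
def homBifunctor : Cᵒᵖ ⥤ C ⥤ ModuleCat.{max u v w} k :=
  linearCoyoneda k C ⋙ (Functor.whiskeringRight _ _ _).obj (ModuleCat.uliftFunctor.{max u w, v} k)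

instance homBifunctor_isBilinear : IsBilinear k (homBifunctor.{u, v, w} k C) where
  map_add_left f g Y := by
    ext x
    exact ULift.ext _ _ (Preadditive.add_comp _ _ _ f g x.down)
  map_smul_left r f Y := by
    ext x
    exact ULift.ext _ _ (Linear.smul_comp _ _ _ r f x.down)
  map_add_right X _ _ f g := by
    ext x
    exact ULift.ext _ _ (Preadditive.comp_add _ _ _ x.down f g)
  map_smul_right X _ _ r f := by
    ext x
    exact ULift.ext _ _ (Linear.comp_smul _ _ _ x.down r f)

/-- The objects of `Proj C`, the full subcategory of projective objects. -/
def projFamily : {X : C // Projective X} → C := Subtype.val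

/-- The Hochschild complex of a `k`-linear category `C`: the derived coend of `C(X, X)` over all
projective objects `X` of `C`. -/
def hochschildComplex : ChainComplex (ModuleCat.{max u v w} k) ℕ :=
  barComplex k (projFamily C) (homBifunctor.{u, v, w} k C)

variable {C}

/-- The functor `C(I, -)` with values in vector spaces. -/
def homFrom (I : C) : C ⥤ ModuleCat.{max u v w} k :=
  (linearCoyoneda k C).obj (op I) ⋙ ModuleCat.uliftFunctor.{max u w, v} k

instance (I : C) : (homFrom.{u, v, w} k I).Additive :=
  inferInstanceAs ((linearCoyoneda k C).obj (op I) ⋙ ModuleCat.uliftFunctor.{max u w, v} k).Additive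

end Hochschild

section Resolution

/-- The family `P` of projective objects generates `Proj C`: the objects of the family are
projective, and every object is a quotient of a finite direct sum of objects of the family.
(Equivalently, the projective objects are the direct summands of such sums.) -/
structure IsProjectiveGenerating {C : Type w} [Category.{v} C] [HasFiniteCoproducts C]
    {ι : Type t} (P : ι → C) : Prop where
  projective : ∀ i, Projective (P i)
  generating : ∀ X : C, ∃ (n : ℕ) (j : Fin n → ι) (p : (∐ fun i => P (j i)) ⟶ X), Epi p

variable (k : Type u) [Field k] {C : Type w} [Category.{v} C] [Preadditive C] [Linear k C]
  {D : Type w'} [Category.{v'} D] [Abelian D] [Linear k D] {ι : Type t} (P : ι → C)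
  (F : Cᵒᵖ ⥤ C ⥤ D) [HasBarCoproducts k P D] [IsBilinear k F]

/-- The coend `∫^{X ∈ C} F(X, X)` over all objects of `C` exists, and the derived coend of `F` over
the family `P` is, with its augmentation, a projective resolution of it. -/
structure ResolvesCoend : Prop where
  hasCoend : HasCoend F
  projective : ∀ n, Projective ((barComplex k P F).X n)
  quasiIso : ∀ W : Cowedge F, IsColimit W → QuasiIso (barAugmentation k (P := P) W)

end Resolution

end DerivedCoend

end

open DerivedCoend

noncomputable section

namespace DerivedCoend

/-! ### Functoriality of the bar construction in the functor, the family and the target category. -/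

section BarFunctoriality

variable (k : Type u) [Field k] {C : Type w} [Category.{v} C] [Preadditive C] [Linear k C]
  {D : Type w'} [Category.{v'} D] [Preadditive D] [Linear k D]
  {ι : Type t} {P : ι → C} {F F' F'' : Cᵒᵖ ⥤ C ⥤ D} [HasBarCoproducts k P D]

/-! All three parts rest on dimension shifting in the contravariant variable. Let `U` be the direct
sum of the finite generating family. For a bifunctor `C(X, U) ⊗ H(Y)` the bar complex is acyclic in
positive degrees: a morphism to `U` can be used as a new first morphism of a string, which is an
extra degeneracy (`CopowerBifunctor.exactAt_succ`). For a bifunctor `Ψ(V(X))(Y)`, exact in the value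
of `V`, the canonical map from `C(-, U) ⊗ V(U)` to `V` is epi on projective objects; let `V''` be
its kernel. The long exact sequence embeds `H_{n+1}` for `V` into the kernel of the map from `H_n`
for `V''` to `H_n` for `C(-, U) ⊗ V(U)`. By induction only `n = 0` needs an argument, and there the
question is whether the coend of `V''` embeds into that of `C(-, U) ⊗ V(U)`
(`exactAt_succ_of_mono`). In degree zero the homology is the coend over the family. If `F` is right
exact in its second variable, dinatural families on the generators extend uniquely to all objects,
so this is also the coend over `C` (`resolvesCoend_of_exactAt`).

For the Deligne product, an exact functor commutes with the finite bar construction, so it is enough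
to treat `⊠` itself, and this after forgetting to vector spaces. There `X ⊠ Y` becomes `V(X) ⊗ C(L,
Y)` with `L` the free module of rank one, and by the co-Yoneda lemma the coend is governed by
`V(L)`, which is exact in `V` (`exactAt_succ_boxFunctor`).

For tensor categories, one has to show that the coend of `X ⊗ V(X)` preserves the monomorphisms in
question. This is done by counting dimensions. Perron–Frobenius theory supplies an additive positive
function `dim` with `dim(X ⊗ Q) = eig * dim X` for `Q = U^∨ ⊗ U` (`nonempty_perronData`). Let `bound
V` be the weighted sum of the numbers `dim V(R_b)` over finitely many projectives `R_b`, and let `κ`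
be the dimension of `End(𝟙)`. The key inequality `dim(𝟙) * dim(∫ X ⊗ V(X)) ≤ κ * bound V`
(`PerronData.dim_tensorCoend_le`) starts from a crude constant, which is improved by a fixed factor
again and again: tensor `V` with `Q`, and split off the many copies of the unit that appear. A
separability idempotent cuts out the summand of `V` on which the two actions of `End(𝟙)` agree. Its
coend still maps onto that of `V`, while for `C(-, U) ⊗ Z` its bound is at most `dim U * dim Z / κ`.
Hence `dim(𝟙) * dim(U ⊗ Z) ≤ dim U * dim Z`; equality holds for `Z = Q`, and then for every `Z`,
because the defect is additive. For a short exact sequence ending in `V`, the inequalities for the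
two outer terms together with this equality for the middle one leave no room for a kernel
(`mono_tensorCoendMap`).

For the Hochschild complex, the same dimension shifting compares the long exact sequences of two
families with the same additive closure (`quasiIso_barReindex`). The functor `C(𝟙, -)` preserves
finite direct sums, hence commutes with the finite bar construction, and duality identifies `C(𝟙, Y
⊗ X^∨)` with `C(X, Y)`. -/

variable (P) in
/-- The map of `n`-simplices induced by a natural transformation. -/
def barObjMap (η : F ⟶ F') (n : ℕ) : barObj k P F n ⟶ barObj k P F' n :=
  barDesc k fun X =>
    (Linear.leftComp k (barObj k P F' n)
      ((η.app (op (P (X 0)))).app (P (X (Fin.last _))))).compMultilinearMap (barι k P F' n X)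

lemma barι_objMap (η : F ⟶ F') (n : ℕ) (X : Fin (n + 1) → ι) (f : ∀ i, Strings P X i) :
    barι k P F n X f ≫ barObjMap k P η n =
      (η.app (op (P (X 0)))).app (P (X (Fin.last _))) ≫ barι k P F' n X f :=
  barι_desc k _ X f

lemma barι_objMap_assoc (η : F ⟶ F') (n : ℕ) (X : Fin (n + 1) → ι) (f : ∀ i, Strings P X i) {Z : D}
    (h : barObj k P F' n ⟶ Z) : barι k P F n X f ≫ barObjMap k P η n ≫ h =
      (η.app (op (P (X 0)))).app (P (X (Fin.last _))) ≫ barι k P F' n X f ≫ h :=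
  (reassoc_of% (barι_objMap k η n X f)) h

lemma barObjMap_id (n : ℕ) : barObjMap k P (𝟙 F) n = 𝟙 _ :=
  bar_hom_ext k fun X f => by rw [barι_objMap]; simp

lemma barObjMap_comp (η : F ⟶ F') (η' : F' ⟶ F'') (n : ℕ) :
    barObjMap k P (η ≫ η') n = barObjMap k P η n ≫ barObjMap k P η' n :=
  bar_hom_ext k fun X f => by rw [barι_objMap, barι_objMap_assoc, barι_objMap]; simp

variable {ι' : Type*} {Q : ι' → C} (r : ι → ι') [HasBarCoproducts k Q D]

variable (Q F) in
/-- The map of `n`-simplices induced by the inclusion of a subfamily. -/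
def barObjReindex [HasBarCoproducts k (fun i => Q (r i)) D] (n : ℕ) :
    barObj k (fun i => Q (r i)) F n ⟶ barObj k Q F n :=
  barDesc k fun X => barι k Q F n (fun i => r (X i))

lemma barι_objReindex [HasBarCoproducts k (fun i => Q (r i)) D] (n : ℕ) (X : Fin (n + 1) → ι)
    (f : ∀ i, Strings (fun i => Q (r i)) X i) :
    barι k (fun i => Q (r i)) F n X f ≫ barObjReindex k F Q r n =
      barι k Q F n (fun i => r (X i)) f :=
  barι_desc k _ X f

lemma barι_objReindex_assoc [HasBarCoproducts k (fun i => Q (r i)) D] (n : ℕ)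
    (X : Fin (n + 1) → ι) (f : ∀ i, Strings (fun i => Q (r i)) X i) {Z : D}
    (h : barObj k Q F n ⟶ Z) :
    barι k (fun i => Q (r i)) F n X f ≫ barObjReindex k F Q r n ≫ h =
      barι k Q F n (fun i => r (X i)) f ≫ h :=
  (reassoc_of% (barι_objReindex k r n X f)) h

section

variable {D' : Type*} [Category* D'] [Preadditive D'] [Linear k D'] (H : D ⥤ D') [H.Additive]
  [H.Linear k] [HasBarCoproducts k P D']

variable (P F) in
/-- The comparison between the bar construction of `F ⋙ H` and the image of that of `F`. -/
def barObjComparison (n : ℕ) :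
    barObj k P (F ⋙ (Functor.whiskeringRight _ _ _).obj H) n ⟶ H.obj (barObj k P F n) :=
  barDesc k fun X => (H.mapLinearMap k).compMultilinearMap (barι k P F n X)

lemma barι_objComparison (n : ℕ) (X : Fin (n + 1) → ι) (f : ∀ i, Strings P X i) :
    barι k P (F ⋙ (Functor.whiskeringRight _ _ _).obj H) n X f ≫ barObjComparison k P F H n =
      H.map (barι k P F n X f) :=
  barι_desc k _ X f

lemma barι_objComparison_assoc (n : ℕ) (X : Fin (n + 1) → ι) (f : ∀ i, Strings P X i) {Z : D'}
    (h : H.obj (barObj k P F n) ⟶ Z) :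
    barι k P (F ⋙ (Functor.whiskeringRight _ _ _).obj H) n X f ≫ barObjComparison k P F H n ≫ h =
      H.map (barι k P F n X f) ≫ h :=
  (reassoc_of% (barι_objComparison k H n X f)) h

end

variable [IsBilinear k F] [IsBilinear k F'] [IsBilinear k F'']

variable (P F) in
/-- The operator on the bar construction induced by a monotone map. -/
def barOp {m n : ℕ} (a : Fin (m + 1) →o Fin (n + 1)) : barObj k P F n ⟶ barObj k P F m :=
  barDesc k fun X => strPull k a X (barι k P F m (X ∘ a))

lemma barι_op {m n : ℕ} (a : Fin (m + 1) →o Fin (n + 1)) (X : Fin (n + 1) → ι)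
    (f : ∀ i, Strings P X i) :
    barι k P F n X f ≫ barOp k P F a =
      (F.map (strComp f 0 (a 0) (Fin.zero_le _)).op).app _ ≫
        (F.obj _).map (strComp f (a (Fin.last _)) (Fin.last _) (Fin.le_last _)) ≫
          barι k P F _ (X ∘ a) (strRes a f) :=
  barι_desc k _ X f

lemma barι_op_assoc {m n : ℕ} (a : Fin (m + 1) →o Fin (n + 1)) (X : Fin (n + 1) → ι)
    (f : ∀ i, Strings P X i) {Z : D} (h : barObj k P F m ⟶ Z) :
    barι k P F n X f ≫ barOp k P F a ≫ h =
      (F.map (strComp f 0 (a 0) (Fin.zero_le _)).op).app _ ≫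
        (F.obj _).map (strComp f (a (Fin.last _)) (Fin.last _) (Fin.le_last _)) ≫
          barι k P F _ (X ∘ a) (strRes a f) ≫ h :=
  (reassoc_of% (barι_op k a X f)) h

variable (P F) in
/-- The differential of the derived coend. -/
def barD (n : ℕ) : barObj k P F (n + 1) ⟶ barObj k P F n :=
  ∑ i : Fin (n + 2), (-1 : ℤ) ^ (i : ℕ) • barOp k P F (SimplexCategory.δ i).toOrderHom

lemma barComplex_d (n : ℕ) : (barComplex k P F).d (n + 1) n = barD k P F n :=
  AlgebraicTopology.alternatingFaceMapComplex_obj_d _ _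

lemma barOp_objMap (η : F ⟶ F') {m n : ℕ} (a : Fin (m + 1) →o Fin (n + 1)) :
    barOp k P F a ≫ barObjMap k P η m = barObjMap k P η n ≫ barOp k P F' a := by
  refine bar_hom_ext k fun X f => ?_
  rw [barι_op_assoc, barι_objMap_assoc, barι_op]
  have h := barι_objMap k (P := P) η m (X ∘ a) (strRes a f)
  erw [h]
  have h1 : ∀ {Y Y' : C} (g : Y ⟶ Y') (X : Cᵒᵖ),
      (F.obj X).map g ≫ (η.app X).app Y' = (η.app X).app Y ≫ (F'.obj X).map g :=
    fun g X => (η.app X).naturality g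
  have h2 : ∀ {X X' : Cᵒᵖ} (g : X ⟶ X') (Y : C),
      (F.map g).app Y ≫ (η.app X').app Y = (η.app X).app Y ≫ (F'.map g).app Y :=
    fun g Y => NatTrans.congr_app (η.naturality g) Y
  have e1 := h1 (strComp f (a (Fin.last m)) (Fin.last n) (Fin.le_last _)) (op (P (X (a 0))))
  have e2 := h2 (strComp f 0 (a 0) (Fin.zero_le _)).op (P (X (Fin.last n)))
  refine (congrArg _ ((Category.assoc _ _ _).symm.trans ((congrArg (· ≫ _) e1).trans
    (Category.assoc _ _ _)))).trans ?_
  exact (Category.assoc _ _ _).symm.trans ((congrArg (· ≫ _) e2).trans (Category.assoc _ _ _))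

lemma barOp_objReindex [HasBarCoproducts k (fun i => Q (r i)) D] {m n : ℕ}
    (a : Fin (m + 1) →o Fin (n + 1)) :
    barOp k (fun i => Q (r i)) F a ≫ barObjReindex k F Q r m =
      barObjReindex k F Q r n ≫ barOp k Q F a := by
  refine bar_hom_ext k fun X f => ?_
  rw [barι_op_assoc, barι_objReindex_assoc, barι_op]
  have h := barι_objReindex k (F := F) (Q := Q) r m (X ∘ a) (strRes a f)
  erw [h]
  rfl

variable (P) in
/-- The map of derived coends induced by a natural transformation. -/
def barMap (η : F ⟶ F') : barComplex k P F ⟶ barComplex k P F' :=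
  (AlgebraicTopology.alternatingFaceMapComplex D).map
    { app := fun n => barObjMap k P η n.unop.len
      naturality := fun _ _ α => barOp_objMap k η α.unop.toOrderHom }

variable (Q F) in
/-- The map of derived coends induced by the inclusion of a subfamily. -/
def barReindex [HasBarCoproducts k (fun i => Q (r i)) D] :
    barComplex k (fun i => Q (r i)) F ⟶ barComplex k Q F :=
  (AlgebraicTopology.alternatingFaceMapComplex D).map
    { app := fun n => barObjReindex k F Q r n.unop.len
      naturality := fun _ _ α => barOp_objReindex k r α.unop.toOrderHom }

lemma barMap_id : barMap k P (𝟙 F) = 𝟙 _ :=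
  HomologicalComplex.hom_ext _ _ fun n => barObjMap_id k n

lemma barMap_comp (η : F ⟶ F') (η' : F' ⟶ F'') :
    barMap k P (η ≫ η') = barMap k P η ≫ barMap k P η' :=
  HomologicalComplex.hom_ext _ _ fun n => barObjMap_comp k η η' n

lemma barMap_reindex [HasBarCoproducts k (fun i => Q (r i)) D] (η : F ⟶ F') :
    barMap k (fun i => Q (r i)) η ≫ barReindex k F' Q r =
      barReindex k F Q r ≫ barMap k Q η := by
  refine HomologicalComplex.hom_ext _ _ fun n => ?_
  change barObjMap k _ η n ≫ barObjReindex k F' Q r n =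
    barObjReindex k F Q r n ≫ barObjMap k Q η n
  refine bar_hom_ext k fun X f => ?_
  rw [barι_objMap_assoc, barι_objReindex_assoc, barι_objReindex]
  exact (barι_objMap k (P := Q) η n (fun i => r (X i)) f).symm

variable (P) in
/-- Isomorphic functors have isomorphic derived coends. -/
def barIso (η : F ≅ F') : barComplex k P F ≅ barComplex k P F' where
  hom := barMap k P η.hom
  inv := barMap k P η.inv
  hom_inv_id := by rw [← barMap_comp, η.hom_inv_id, barMap_id]
  inv_hom_id := by rw [← barMap_comp, η.inv_hom_id, barMap_id]

section

variable {D' : Type*} [Category* D'] [Preadditive D'] [Linear k D'] (H : D ⥤ D') [H.Additive]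
  [H.Linear k] [HasBarCoproducts k P D']

instance isBilinear_comp : IsBilinear k (F ⋙ (Functor.whiskeringRight _ _ _).obj H) where
  map_add_left f g Y := (congrArg H.map (IsBilinear.map_add_left k f g Y)).trans H.map_add
  map_smul_left r f Y := (congrArg H.map (IsBilinear.map_smul_left r f Y)).trans (H.map_smul _ _)
  map_add_right X _ _ f g := (congrArg H.map (IsBilinear.map_add_right k X f g)).trans H.map_add
  map_smul_right X _ _ r f :=
    (congrArg H.map (IsBilinear.map_smul_right X r f)).trans (H.map_smul _ _)

lemma barOp_objComparison {m n : ℕ} (a : Fin (m + 1) →o Fin (n + 1)) :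
    barOp k P (F ⋙ (Functor.whiskeringRight _ _ _).obj H) a ≫ barObjComparison k P F H m =
      barObjComparison k P F H n ≫ H.map (barOp k P F a) := by
  refine bar_hom_ext k fun X f => ?_
  rw [barι_op_assoc, barι_objComparison_assoc, ← H.map_comp, barι_op, H.map_comp, H.map_comp]
  have h := barι_objComparison k (F := F) H m (X ∘ a) (strRes a f)
  erw [h]
  rfl

variable (P F) in
/-- The comparison between the derived coend of `F ⋙ H` and the image of that of `F`. -/
def barComparison : barComplex k P (F ⋙ (Functor.whiskeringRight _ _ _).obj H) ⟶
    (H.mapHomologicalComplex _).obj (barComplex k P F) where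
  f n := barObjComparison k P F H n
  comm' i j hij := by
    obtain rfl : j + 1 = i := hij
    change barObjComparison k P F H (j + 1) ≫ H.map ((barComplex k P F).d (j + 1) j) =
      (barComplex k P _).d (j + 1) j ≫ barObjComparison k P F H j
    rw [barComplex_d, barComplex_d]
    change barObjComparison k P F H (j + 1) ≫ H.map (barD k P F j) =
      barD k P _ j ≫ barObjComparison k P F H j
    rw [barD, barD, H.map_sum, Preadditive.comp_sum, Preadditive.sum_comp]
    refine Finset.sum_congr rfl fun i _ => ?_
    rw [H.map_zsmul, Preadditive.comp_zsmul, Preadditive.zsmul_comp]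
    refine congrArg _ ?_
    exact (barOp_objComparison k H (SimplexCategory.δ i).toOrderHom).symm

end

end BarFunctoriality

end DerivedCoend

end

noncomputable section

namespace DerivedCoend

/-! ### Exactness of the bar construction in the functor. -/

section Exactness

variable {D : Type w'} [Category.{v'} D] [Abelian D]

/-- Coproducts of shape `J` of monomorphisms are monomorphisms. -/
def SigmaMono (J : Type t) (D : Type w') [Category.{v'} D] [HasColimitsOfShape (Discrete J) D] :
    Prop :=
  ∀ (X Y : J → D) (f : ∀ j, X j ⟶ Y j), (∀ j, Mono (f j)) → Mono (Limits.Sigma.map f)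

/-- Finite coproducts are biproducts, hence also limits, and so the coproduct functor is left exact.
-/
lemma sigmaMono_of_finite (J : Type t) [Finite J] (D : Type w') [Category.{v'} D] [Abelian D]
    [HasColimitsOfShape (Discrete J) D] : SigmaMono J D := by
  intro X Y f hm
  have := Abelian.hasFiniteBiproducts (C := D)
  have := HasExactColimitsOfShape.preservesFiniteLimits (J := Discrete J) (C := D)
  have : Mono (Discrete.natTrans fun j : Discrete J => f j.as :
      Discrete.functor X ⟶ Discrete.functor Y) :=
    @NatTrans.mono_of_mono_app _ _ _ _ _ _ _ (fun j => hm j.as)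
  exact inferInstanceAs (Mono (colim.map (Discrete.natTrans fun j : Discrete J => f j.as :
      Discrete.functor X ⟶ Discrete.functor Y)))

/-- Retractions can be summed. This covers infinite sums of vector spaces, as in the Hochschild
complex. -/
lemma sigmaMono_of_split (J : Type t) (D : Type w') [Category.{v'} D]
    [HasColimitsOfShape (Discrete J) D]
    (h : ∀ {X Y : D} (f : X ⟶ Y), Mono f → ∃ r : Y ⟶ X, f ≫ r = 𝟙 X) : SigmaMono J D := by
  intro X Y f hm
  choose r hr using fun j => h (f j) (hm j)
  have : Limits.Sigma.map f ≫ Limits.Sigma.map r = 𝟙 _ := by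
    refine Limits.Sigma.hom_ext _ _ fun j => ?_
    rw [Sigma.ι_map_assoc, Sigma.ι_map, ← Category.assoc, hr, Category.comp_id, Category.id_comp]
  exact mono_of_mono_fac this

/-- A coproduct of short exact sequences is short exact, if coproducts of this shape are exact. -/
lemma shortExact_sigmaMap {J : Type t} [HasColimitsOfShape (Discrete J) D]
    (hJ : SigmaMono J D) {X Y Z : J → D} (f : ∀ j, X j ⟶ Y j)
    (g : ∀ j, Y j ⟶ Z j) (w : ∀ j, f j ≫ g j = 0)
    (h : ∀ j, (ShortComplex.mk (f j) (g j) (w j)).ShortExact)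
    (w' : Limits.Sigma.map f ≫ Limits.Sigma.map g = 0) :
    (ShortComplex.mk (Limits.Sigma.map f) (Limits.Sigma.map g) w').ShortExact := by
  have he : ∀ j, Epi (g j) := fun j => (h j).epi_g
  have : Mono (Limits.Sigma.map f) := hJ _ _ f fun j => (h j).mono_f
  -- Coproducts commute with cokernels, so only the monomorphism on the left depends on `hJ`.
  refine { exact := ShortComplex.exact_of_g_is_cokernel _ ?_, mono_f := this, epi_g := ?_ }
  · refine CokernelCofork.IsColimit.ofπ _ _ (fun {W} φ hφ => Limits.Sigma.desc fun j =>
      (h j).gIsCokernel.desc (CokernelCofork.ofπ (Sigma.ι Y j ≫ φ) ?_)) ?_ ?_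
    · have := Sigma.ι X j ≫= hφ
      rw [comp_zero, Sigma.ι_map_assoc] at this
      exact this
    · intro W φ hφ
      refine Limits.Sigma.hom_ext _ _ fun j => ?_
      rw [Sigma.ι_map_assoc, Sigma.ι_desc]
      exact (h j).gIsCokernel.fac (CokernelCofork.ofπ (Sigma.ι Y j ≫ φ) _) WalkingParallelPair.one
    · intro W φ hφ m hm
      refine Limits.Sigma.hom_ext _ _ fun j => ?_
      rw [Sigma.ι_desc, ← cancel_epi (g j)]
      refine Eq.trans ?_ ((h j).gIsCokernel.fac (CokernelCofork.ofπ (Sigma.ι Y j ≫ φ) _)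
        WalkingParallelPair.one).symm
      have := Sigma.ι Y j ≫= hm
      rw [Sigma.ι_map_assoc] at this
      exact this
  · infer_instance

variable (k : Type u) [Field k] {C : Type w} [Category.{v} C] [Preadditive C] [Linear k C]
  [Linear k D] {ι : Type t} (P : ι → C)

lemma copowerι_map {V : Type t} [AddCommGroup V] [Module k V] {Y Y' : D}
    [HasColimitsOfShape (Discrete (Module.Basis.ofVectorSpaceIndex k V)) D] (g : Y ⟶ Y') (x : V) :
    copowerι k V Y x ≫ Limits.Sigma.map (fun _ : Module.Basis.ofVectorSpaceIndex k V => g) =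
      g ≫ copowerι k V Y' x := by
  have : (Linear.rightComp k Y (Limits.Sigma.map
      (fun _ : Module.Basis.ofVectorSpaceIndex k V => g))) ∘ₗ copowerι k V Y =
      (Linear.leftComp k _ g) ∘ₗ copowerι k V Y' := by
    refine (Module.Basis.ofVectorSpace k V).ext fun b => ?_
    change copowerι k V Y (Module.Basis.ofVectorSpace k V b) ≫ _ =
      g ≫ copowerι k V Y' (Module.Basis.ofVectorSpace k V b)
    rw [copowerι_basis, copowerι_basis]
    exact Sigma.ι_map _ b
  exact LinearMap.congr_fun this x

/-- The coproducts that are needed to form the bar construction over the family `P` are exact. -/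
class HasExactBarCoproducts (D : Type w') [Category.{v'} D] [HasBarCoproducts k P D] : Prop where
  sum : ∀ n : ℕ, SigmaMono (Fin (n + 1) → ι) D
  copower : ∀ (n : ℕ) (X : Fin (n + 1) → ι),
    SigmaMono (Module.Basis.ofVectorSpaceIndex k (⨂[k] i, Strings P X i)) D

instance hasExactBarCoproducts_of_finite [∀ X Y : C, Module.Finite k (X ⟶ Y)] [Finite ι]
    [HasBarCoproducts k P D] : HasExactBarCoproducts k P D where
  sum n := sigmaMono_of_finite (Fin (n + 1) → ι) D
  copower n X := by
    have : Finite (Module.Basis.ofVectorSpaceIndex k (⨂[k] i, Strings P X i)) :=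
      Module.Finite.finite_basis (Module.Basis.ofVectorSpace k _)
    exact sigmaMono_of_finite (Module.Basis.ofVectorSpaceIndex k (⨂[k] i, Strings P X i)) D

lemma exists_retraction_moduleCat {X Y : ModuleCat.{t} k} (f : X ⟶ Y) (hf : Mono f) :
    ∃ r : Y ⟶ X, f ≫ r = 𝟙 X := by
  obtain ⟨r, hr⟩ := f.hom.exists_leftInverse_of_injective
    (LinearMap.ker_eq_bot.mpr ((ModuleCat.mono_iff_injective f).mp hf))
  exact ⟨ModuleCat.ofHom r, ModuleCat.hom_ext hr⟩

instance hasExactBarCoproducts_moduleCat [HasBarCoproducts k P (ModuleCat.{v'} k)] :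
    HasExactBarCoproducts k P (ModuleCat.{v'} k) where
  sum _ := sigmaMono_of_split _ _ (exists_retraction_moduleCat k)
  copower _ _ := sigmaMono_of_split _ _ (exists_retraction_moduleCat k)

variable {P} {F F' F'' : Cᵒᵖ ⥤ C ⥤ D} [HasBarCoproducts k P D]

/-- In each degree the bar construction is an iterated coproduct of values of the functor; this form
lets the exactness of coproducts be applied twice. -/
lemma barObjMap_eq_map (η : F ⟶ F') (n : ℕ) : barObjMap k P η n =
    Limits.Sigma.map fun X : Fin (n + 1) → ι => Limits.Sigma.map
      fun _ : Module.Basis.ofVectorSpaceIndex k (⨂[k] i, Strings P X i) =>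
        (η.app (op (P (X 0)))).app (P (X (Fin.last n))) := by
  refine bar_hom_ext k fun X f => ?_
  rw [barι_objMap]
  change _ ≫ copowerι k _ _ (PiTensorProduct.tprod k f) ≫ barIncl k P F' n X =
    (copowerι k _ _ (PiTensorProduct.tprod k f) ≫ barIncl k P F n X) ≫ _
  have h := Sigma.ι_map (fun X : Fin (n + 1) → ι => Limits.Sigma.map
      fun _ : Module.Basis.ofVectorSpaceIndex k (⨂[k] i, Strings P X i) =>
        (η.app (op (P (X 0)))).app (P (X (Fin.last n)))) X
  refine Eq.trans ?_ ((Category.assoc _ _ _).trans (congrArg _ h)).symm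
  exact (Category.assoc _ _ _).symm.trans ((congrArg (· ≫ _) (copowerι_map k _ _).symm).trans
    (Category.assoc _ _ _))

variable [IsBilinear k F] [IsBilinear k F'] [IsBilinear k F''] [HasExactBarCoproducts k P D]

omit [HasExactBarCoproducts k P D] in
lemma barMap_comp_eq_zero (η : F ⟶ F') (η' : F' ⟶ F'') (w : η ≫ η' = 0) :
    barMap k P η ≫ barMap k P η' = 0 := by
  rw [← barMap_comp, w]
  refine HomologicalComplex.hom_ext _ _ fun m => bar_hom_ext k fun X f => ?_
  refine (barι_objMap k (P := P) (0 : F ⟶ F'') m X f).trans ?_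
  exact zero_comp.trans comp_zero.symm

/-- A sequence of functors that is short exact on the family `P` induces a short exact sequence of
derived coends. -/
lemma shortExact_barMap (η : F ⟶ F') (η' : F' ⟶ F'') (w : η ≫ η' = 0)
    (h : ∀ i j, (ShortComplex.mk ((η.app (op (P i))).app (P j)) ((η'.app (op (P i))).app (P j))
      (NatTrans.congr_app (NatTrans.congr_app w (op (P i))) (P j))).ShortExact)
    (w' : barMap k P η ≫ barMap k P η' = 0) :
    (ShortComplex.mk (barMap k P η) (barMap k P η') w').ShortExact := by
  refine HomologicalComplex.shortExact_of_degreewise_shortExact _ fun n => ?_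
  have w'' : barObjMap k P η n ≫ barObjMap k P η' n = 0 := HomologicalComplex.congr_hom w' n
  suffices (ShortComplex.mk (barObjMap k P η n) (barObjMap k P η' n) w'').ShortExact from this
  have e1 := barObjMap_eq_map k (P := P) η n
  have e2 := barObjMap_eq_map k (P := P) η' n
  generalize barObjMap k P η n = x at *
  generalize barObjMap k P η' n = y at *
  subst e1 e2
  refine shortExact_sigmaMap (HasExactBarCoproducts.sum (k := k) (P := P) n) _ _
    (fun X => ?_) (fun X => ?_) _
  · refine Limits.Sigma.hom_ext _ _ fun b => ?_
    rw [Sigma.ι_map_assoc, Sigma.ι_map, ← Category.assoc]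
    have := NatTrans.congr_app (NatTrans.congr_app w (op (P (X 0)))) (P (X (Fin.last n)))
    refine (congrArg (· ≫ _) this).trans ?_
    exact zero_comp.trans comp_zero.symm
  · exact shortExact_sigmaMap (HasExactBarCoproducts.copower n X) _ _
      (fun _ => NatTrans.congr_app (NatTrans.congr_app w (op (P (X 0)))) (P (X (Fin.last n))))
      (fun b => h (X 0) (X (Fin.last n))) _

end Exactness

end DerivedCoend

end

noncomputable section

namespace DerivedCoend

/-! ### Strings with an additional first vertex. -/

section Cone

variable {C : Type w} [Category.{v} C] {ι : Type t} {P : ι → C}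

/-- The string that is obtained by adding a vertex in front. -/
def consStr {n : ℕ} {X : Fin (n + 1) → ι} {j : ι} (x : P (X 0) ⟶ P j) (f : ∀ i, Strings P X i) :
    ∀ i, Strings P (Fin.cons j X : Fin (n + 2) → ι) i :=
  Fin.cons (α := fun i => Strings P (Fin.cons j X : Fin (n + 2) → ι) i) x f

lemma strComp_consStr_succ {n : ℕ} {X : Fin (n + 1) → ι} {j : ι} (x : P (X 0) ⟶ P j)
    (f : ∀ i, Strings P X i) (p q : Fin (n + 1)) (h : p ≤ q) (h' : p.succ ≤ q.succ) :
    strComp (consStr x f) p.succ q.succ h' = strComp f p q h := by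
  induction q using Fin.induction with
  | zero =>
    obtain rfl : p = 0 := Fin.le_zero_iff.mp h
    rw [strComp_self, strComp_self]
    rfl
  | succ i ih =>
    by_cases hp : p ≤ i.castSucc
    · rw [strComp_succ f p i hp]
      have hp' : p.succ ≤ i.succ.castSucc := Fin.succ_le_succ_iff.mpr hp
      have := strComp_succ (consStr x f) p.succ i.succ hp' h'
      exact this.trans (congrArg (f i ≫ ·) (ih hp hp'))
    · obtain rfl : p = i.succ := le_antisymm h (Fin.castSucc_lt_iff_succ_le.mp (not_le.mp hp))
      rw [strComp_self, strComp_self]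
      rfl

lemma strComp_consStr_zero {n : ℕ} {X : Fin (n + 1) → ι} {j : ι} (x : P (X 0) ⟶ P j)
    (f : ∀ i, Strings P X i) (q : Fin (n + 1)) (h : 0 ≤ q.succ) :
    strComp (consStr x f) 0 q.succ h = strComp f 0 q (Fin.zero_le _) ≫ x := by
  rw [← strComp_comp (consStr x f) 0 (Fin.succ 0) q.succ (Fin.zero_le _)
    (Fin.succ_le_succ_iff.mpr (Fin.zero_le _)) h, strComp_consStr_succ x f 0 q (Fin.zero_le _)]
  refine congrArg _ ?_
  have := strComp_succ (consStr x f) 0 0 le_rfl (Fin.zero_le _)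
  refine this.trans ?_
  refine (congrArg _ (strComp_self _ _ _)).trans ?_
  exact Category.comp_id x

/-- The monotone map `Fin.succ`. -/
def succHom (n : ℕ) : Fin (n + 1) →o Fin (n + 2) := ⟨Fin.succ, fun _ _ h => Fin.succ_le_succ_iff.mpr h⟩

/-- The extension of a monotone map by a new smallest element. -/
def coneHom {m n : ℕ} (a : Fin (m + 1) →o Fin (n + 1)) : Fin (m + 2) →o Fin (n + 2) where
  toFun := Fin.cases 0 fun i => (a i).succ
  monotone' x y h := by
    induction x using Fin.cases with
    | zero => exact Fin.zero_le _
    | succ x =>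
      induction y using Fin.cases with
      | zero => exact absurd h (not_le.mpr (Fin.succ_pos _))
      | succ y => exact Fin.succ_le_succ_iff.mpr (a.monotone (Fin.succ_le_succ_iff.mp h))

lemma delta_zero_toOrderHom (n : ℕ) :
    (SimplexCategory.δ (0 : Fin (n + 2))).toOrderHom = succHom n := by
  ext i : 2
  exact Fin.succAbove_zero_apply i

/-- Together with `delta_zero_toOrderHom`, this is the combinatorics of an extra degeneracy: the
zeroth face removes the new vertex, and every other face is the cone on a face of the old simplex.
-/
lemma delta_succ_toOrderHom (n : ℕ) (i : Fin (n + 2)) :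
    (SimplexCategory.δ i.succ).toOrderHom = coneHom (SimplexCategory.δ i).toOrderHom := by
  ext j : 2
  induction j using Fin.cases with
  | zero => exact Fin.succ_succAbove_zero i
  | succ j => exact Fin.succ_succAbove_succ _ _

end Cone

/-! ### The contracting homotopy for bifunctors `C(X, U) ⊗ H(Y)`. -/

section Contraction

variable {k : Type u} [Field k] {C : Type w} [Category.{v} C] [Preadditive C] [Linear k C]
  {D : Type w'} [Category.{v'} D] [Preadditive D] [Linear k D]

/-- A linear map `V → Hom(Y, W)` exhibits `W` as the copower of `Y` by `V`. -/
structure IsCopower {V : Type t} [AddCommGroup V] [Module k V] {Y W : D} (θ : V →ₗ[k] (Y ⟶ W)) :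
    Prop where
  exists_desc : ∀ {Z : D} (φ : V →ₗ[k] (Y ⟶ Z)), ∃ g : W ⟶ Z, ∀ x, θ x ≫ g = φ x
  hom_ext : ∀ {Z : D} {g h : W ⟶ Z}, (∀ x, θ x ≫ g = θ x ≫ h) → g = h

namespace IsCopower

variable {V : Type t} [AddCommGroup V] [Module k V] {Y W : D} {θ : V →ₗ[k] (Y ⟶ W)}
  (hθ : IsCopower θ)

include hθ in
lemma bijective (Z : D) : Function.Bijective
    (fun g : W ⟶ Z => (Linear.rightComp k Y g) ∘ₗ θ) :=
  ⟨fun _ _ h => hθ.hom_ext fun x => LinearMap.congr_fun h x, fun φ =>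
    (hθ.exists_desc φ).imp fun _ h => LinearMap.ext h⟩

/-- The morphism out of a copower induced by a linear map. -/
def desc (Z : D) : (V →ₗ[k] (Y ⟶ Z)) →ₗ[k] (W ⟶ Z) where
  toFun φ := (hθ.exists_desc φ).choose
  map_add' φ ψ := hθ.hom_ext fun x => by
    rw [Preadditive.comp_add, (hθ.exists_desc _).choose_spec, (hθ.exists_desc _).choose_spec,
      (hθ.exists_desc _).choose_spec, LinearMap.add_apply]
  map_smul' r φ := hθ.hom_ext fun x => by
    rw [Linear.comp_smul, (hθ.exists_desc _).choose_spec, (hθ.exists_desc _).choose_spec]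
    rfl

lemma fac {Z : D} (φ : V →ₗ[k] (Y ⟶ Z)) (x : V) : θ x ≫ hθ.desc Z φ = φ x :=
  (hθ.exists_desc φ).choose_spec x

end IsCopower

/-- The object `X` is a direct summand of a finite direct sum of objects of the family `P`. -/
def InAdd {ι : Type t} (P : ι → C) (X : C) : Prop :=
  ∃ (n : ℕ) (j : Fin n → ι) (a : ∀ s, X ⟶ P (j s)) (b : ∀ s, P (j s) ⟶ X), ∑ s, a s ≫ b s = 𝟙 X

/-- A bifunctor of the form `(X, Y) ↦ C(X, U) ⊗ H(Y)`. -/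
structure CopowerBifunctor (F : Cᵒᵖ ⥤ C ⥤ D) (U : C) (H : C ⥤ D) where
  /-- the universal map -/
  θ : ∀ X Y : C, (X ⟶ U) →ₗ[k] (H.obj Y ⟶ (F.obj (op X)).obj Y)
  isCopower : ∀ X Y, IsCopower (θ X Y)
  map_left : ∀ {X X' : C} (f : X ⟶ X') (g : X' ⟶ U) (Y : C),
    θ X' Y g ≫ (F.map f.op).app Y = θ X Y (f ≫ g)
  map_right : ∀ {Y Y' : C} (h : Y ⟶ Y') (X : C) (g : X ⟶ U),
    θ X Y g ≫ (F.obj (op X)).map h = H.map h ≫ θ X Y' g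

variable {ι : Type t} {P : ι → C} {F : Cᵒᵖ ⥤ C ⥤ D} [HasBarCoproducts k P D]
  {U : C} {H : C ⥤ D}

/-- Vertex sequences built with `Fin.cons` agree after a case distinction but not by definition, so
the inclusions of their summands have to be compared heterogeneously. -/
lemma barι_heq {n : ℕ} {X X' : Fin (n + 1) → ι} (h : X = X') {f : ∀ i, Strings P X i}
    {f' : ∀ i, Strings P X' i} (hf : ∀ i, HEq (f i) (f' i)) :
    HEq (barι k P F n X f) (barι k P F n X' f') := by
  subst h
  obtain rfl : f = f' := funext fun i => eq_of_heq (hf i)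
  rfl

variable (k P F) in
/-- The inclusion of a summand of `Bₙ₊₁`, for a string with a marked first morphism. -/
def barιCons {n : ℕ} (j : ι) (X : Fin (n + 1) → ι) : (P (X 0) ⟶ P j) →ₗ[k]
    MultilinearMap k (Strings P X)
      ((F.obj (op (P j))).obj (P (X (Fin.last n))) ⟶ barObj k P F (n + 1)) :=
  MultilinearMap.curryLeft (barι k P F (n + 1) (Fin.cons j X))

section

variable (T : CopowerBifunctor (k := k) F U H) {m : ℕ} {j : Fin m → ι} (a : ∀ s, U ⟶ P (j s))
  (b : ∀ s, P (j s) ⟶ U)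

variable (P) in
/-- The multilinear family that defines the contracting homotopy. -/
def coneMultilinear {n : ℕ} (X : Fin (n + 1) → ι) :
    MultilinearMap k (Strings P X) ((P (X 0) ⟶ U) →ₗ[k]
      (H.obj (P (X (Fin.last n))) ⟶ barObj k P F (n + 1))) where
  toFun f :=
    -- The object `U` need not belong to the family. Its identity is therefore replaced by the sum
    -- of the `a s ≫ b s`: the morphism `g ≫ a s` becomes the first morphism of the string, and `b
    -- s` becomes the element of `C(P (j s), U)`.
    { toFun := fun g => ∑ s, T.θ (P (j s)) (P (X (Fin.last n))) (b s) ≫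
        barιCons k P F (j s) X (g ≫ a s) f
      map_add' := fun g g' => by
        simp only [Preadditive.add_comp, map_add, add_apply, Preadditive.comp_add,
          Finset.sum_add_distrib]
      map_smul' := fun r g => by
        simp only [Linear.smul_comp, map_smul, smul_apply, Linear.comp_smul,
          Finset.smul_sum, RingHom.id_apply] }
  map_update_add' f i x y := by
    ext g
    simp only [LinearMap.coe_mk, AddHom.coe_mk, LinearMap.add_apply, MultilinearMap.map_update_add,
      Preadditive.comp_add, Finset.sum_add_distrib]
  map_update_smul' f i c x := by
    ext g
    simp only [LinearMap.coe_mk, AddHom.coe_mk, LinearMap.smul_apply,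
      MultilinearMap.map_update_smul, Linear.comp_smul, Finset.smul_sum]

/-- The contracting homotopy of the derived coend of `C(X, U) ⊗ H(Y)`. -/
def coneHomotopy (n : ℕ) : barObj k P F n ⟶ barObj k P F (n + 1) :=
  barDesc k fun X => ((T.isCopower (P (X 0)) (P (X (Fin.last n)))).desc _).compMultilinearMap
    (coneMultilinear P T a b X)

lemma barι_coneHomotopy (n : ℕ) (X : Fin (n + 1) → ι) (f : ∀ i, Strings P X i)
    (g : P (X 0) ⟶ U) :
    T.θ (P (X 0)) (P (X (Fin.last n))) g ≫ barι k P F n X f ≫ coneHomotopy T a b n =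
      ∑ s, T.θ (P (j s)) (P (X (Fin.last n))) (b s) ≫
        barιCons k P F (j s) X (g ≫ a s) f :=
  (congrArg _ (barι_desc k _ X f)).trans ((T.isCopower _ _).fac _ g)

lemma barι_coneHomotopy_assoc (n : ℕ) (X : Fin (n + 1) → ι) (f : ∀ i, Strings P X i)
    (g : P (X 0) ⟶ U) {Z : D} (h : barObj k P F (n + 1) ⟶ Z) :
    T.θ (P (X 0)) (P (X (Fin.last n))) g ≫ barι k P F n X f ≫ coneHomotopy T a b n ≫ h =
      (∑ s, T.θ (P (j s)) (P (X (Fin.last n))) (b s) ≫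
        barιCons k P F (j s) X (g ≫ a s) f) ≫ h := by
  rw [← barι_coneHomotopy, Category.assoc, Category.assoc]

variable [IsBilinear k F]

/-- Dropping the first vertex makes the marked morphism act on the contravariant argument. -/
lemma barιCons_op_succ {n : ℕ} (j : ι) (X : Fin (n + 1) → ι)
    (x : P (X 0) ⟶ P j) (f : ∀ i, Strings P X i) :
    barιCons k P F j X x f ≫ barOp k P F (succHom n) =
      (F.map x.op).app (P (X (Fin.last n))) ≫ barι k P F n X f := by
  have h1 : strComp (consStr x f) 0 (succHom n 0) (Fin.zero_le _) = x :=
    (strComp_consStr_zero x f 0 (Fin.zero_le _)).trans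
      ((congrArg (· ≫ _) (strComp_self _ _ _)).trans (Category.id_comp _))
  have h2 : strComp (consStr x f) (succHom n (Fin.last n)) (Fin.last (n + 1))
      (Fin.le_last _) = 𝟙 _ := strComp_self _ _ _
  have h3 : strRes (succHom n) (consStr x f) = f := by
    funext i
    refine (strComp_consStr_succ x f i.castSucc i.succ i.castSucc_lt_succ.le _).trans ?_
    exact congrFun (strRes_id f) i
  refine (barι_op k (succHom n) (Fin.cons j X) (consStr x f)).trans ?_
  refine (congrArg (fun z => _ ≫ z ≫ _) ((congrArg _ h2).trans ((F.obj _).map_id _))).trans ?_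
  refine (congrArg (fun z => _ ≫ z) (Category.id_comp _)).trans ?_
  exact congrArg₂ (fun y z => (F.map y.op).app _ ≫ z) h1 (congrArg (barι k P F n X) h3)

/-- The first vertex is kept, so morphisms skipped at the front of the old string are absorbed by
the marked morphism instead of acting on `F`. -/
lemma barιCons_op_cone {n n' : ℕ} (j : ι) (X : Fin (n + 1) → ι) (x : P (X 0) ⟶ P j)
    (f : ∀ i, Strings P X i) (α : Fin (n' + 1) →o Fin (n + 1)) :
    barιCons k P F j X x f ≫ barOp k P F (coneHom α) =
      (F.obj (op (P j))).map (strComp f (α (Fin.last n')) (Fin.last n) (Fin.le_last _)) ≫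
        barιCons k P F j (X ∘ α) (strComp f 0 (α 0) (Fin.zero_le _) ≫ x) (strRes α f) := by
  have h1 : strComp (consStr x f) 0 (coneHom α 0) (Fin.zero_le _) = 𝟙 _ :=
    strComp_self _ _ _
  have h2 : strComp (consStr x f) (coneHom α (Fin.last (n' + 1))) (Fin.last (n + 1))
      (Fin.le_last _) = strComp f (α (Fin.last n')) (Fin.last n) (Fin.le_last _) :=
    strComp_consStr_succ x f (α (Fin.last n')) (Fin.last n) (Fin.le_last _)
      (Fin.succ_le_succ_iff.mpr (Fin.le_last _))
  have h3 : HEq (barι k P F (n' + 1) ((Fin.cons j X : Fin (n + 2) → ι) ∘ coneHom α)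
        (strRes (coneHom α) (consStr x f)))
      (barι k P F (n' + 1) (Fin.cons j (X ∘ α)) (consStr
        (strComp f 0 (α 0) (Fin.zero_le _) ≫ x) (strRes α f))) := by
    refine barι_heq ?_ fun i => ?_
    · funext i
      induction i using Fin.cases <;> rfl
    · induction i using Fin.cases with
      | zero => exact heq_of_eq (strComp_consStr_zero x f (α 0) (Fin.zero_le _))
      | succ i => exact heq_of_eq (strComp_consStr_succ x f _ _ _ _)
  refine (barι_op k (coneHom α) (Fin.cons j X) (consStr x f)).trans ?_
  refine (congrArg (fun z => (F.map (Quiver.Hom.op z)).app _ ≫ _) h1).trans ?_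
  refine (congrArg (fun z => NatTrans.app z _ ≫ _) (F.map_id _)).trans
    ((Category.id_comp _).trans ?_)
  exact congrArg₂ (fun y z => (F.obj _).map y ≫ z) h2 (eq_of_heq h3)

/-- After the zeroth face, `g ≫ a s` acts on `b s`, and the terms add up to `g` because the `a s ≫ b
s` sum to the identity of `U`. -/
lemma coneHomotopy_op_succ (hab : ∑ s, a s ≫ b s = 𝟙 U) (n : ℕ) :
    coneHomotopy T a b n ≫ barOp k P F (succHom n) = 𝟙 _ := by
  refine bar_hom_ext k fun X f => (T.isCopower _ _).hom_ext fun g => ?_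
  rw [Category.comp_id, barι_coneHomotopy_assoc, Preadditive.sum_comp]
  have h : ∀ s, (T.θ (P (j s)) (P (X (Fin.last n))) (b s) ≫
      barιCons k P F (j s) X (g ≫ a s) f) ≫ barOp k P F (succHom n) =
      T.θ (P (X 0)) (P (X (Fin.last n))) (g ≫ a s ≫ b s) ≫ barι k P F n X f := by
    intro s
    rw [Category.assoc, barιCons_op_succ, ← Category.assoc, T.map_left, Category.assoc]
  rw [Finset.sum_congr rfl fun s _ => h s, ← Preadditive.sum_comp, ← map_sum,
    ← Preadditive.comp_sum, hab, Category.comp_id]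

lemma coneHomotopy_op_cone {n n' : ℕ} (α : Fin (n' + 1) →o Fin (n + 1)) :
    coneHomotopy T a b n ≫ barOp k P F (coneHom α) = barOp k P F α ≫ coneHomotopy T a b n' := by
  refine bar_hom_ext k fun X f => (T.isCopower _ _).hom_ext fun g => ?_
  rw [barι_coneHomotopy_assoc, Preadditive.sum_comp, barι_op_assoc]
  have hr := barι_coneHomotopy T a b n' (X ∘ α) (strRes α f)
    (strComp f 0 (α 0) (Fin.zero_le _) ≫ g)
  have e1 := T.map_left (strComp f 0 (α 0) (Fin.zero_le _)) g (P (X (Fin.last n)))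
  have e2 := T.map_right (strComp f (α (Fin.last n')) (Fin.last n) (Fin.le_last _)) (P (X (α 0)))
    (strComp f 0 (α 0) (Fin.zero_le _) ≫ g)
  refine Eq.symm ((Category.assoc _ _ _).symm.trans ((congrArg (· ≫ _) e1).trans
    ((Category.assoc _ _ _).symm.trans ((congrArg (· ≫ _) e2).trans ((Category.assoc _ _ _).trans
      ((congrArg (_ ≫ ·) hr).trans ?_))))))
  rw [Preadditive.comp_sum]
  refine Finset.sum_congr rfl fun s _ => ?_
  refine Eq.symm ((Category.assoc _ _ _).trans ((congrArg (_ ≫ ·)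
    (barιCons_op_cone (j s) X (g ≫ a s) f α)).trans ?_))
  refine (Category.assoc _ _ _).symm.trans ((congrArg (· ≫ _) (T.map_right _ _ _)).trans ?_)
  refine (Category.assoc _ _ _).trans ?_
  exact congrArg (fun z => _ ≫ _ ≫ barιCons k P F (j s) (X ∘ α) z (strRes α f))
    (Category.assoc _ _ _).symm

/-- The zeroth face contributes the identity. The homotopy carries face `i + 1` to face `i`, and the
shift by one in the sign cancels these terms against `d` followed by the homotopy. -/
lemma coneHomotopy_d_zero (hab : ∑ s, a s ≫ b s = 𝟙 U) (n : ℕ) :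
    coneHomotopy T a b (n + 1) ≫ barD k P F (n + 1) + barD k P F n ≫ coneHomotopy T a b n =
      𝟙 _ := by
  rw [barD, Fin.sum_univ_succ, Preadditive.comp_add, delta_zero_toOrderHom]
  simp only [Fin.val_zero, pow_zero, one_smul]
  rw [coneHomotopy_op_succ T a b hab, add_assoc, add_eq_left, barD, Preadditive.comp_sum,
    Preadditive.sum_comp, ← Finset.sum_add_distrib]
  refine Finset.sum_eq_zero fun i _ => ?_
  rw [delta_succ_toOrderHom, Preadditive.comp_zsmul, coneHomotopy_op_cone, Preadditive.zsmul_comp,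
    Fin.val_succ, pow_succ, mul_neg_one, neg_smul, neg_add_cancel]

end

end Contraction

section

variable {k : Type u} [Field k] {C : Type w} [Category.{v} C] [Preadditive C] [Linear k C]
  {D : Type w'} [Category.{v'} D] [Abelian D] [Linear k D]
  {ι : Type t} {P : ι → C} {F : Cᵒᵖ ⥤ C ⥤ D} [HasBarCoproducts k P D] [IsBilinear k F]

variable (k P F) in
lemma barD_comp_barD (n : ℕ) : barD k P F (n + 1) ≫ barD k P F n = 0 := by
  have h := (barComplex k P F).d_comp_d (n + 2) (n + 1) n
  exact (congrArg₂ (fun (x : barObj k P F (n + 2) ⟶ barObj k P F (n + 1))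
    (y : barObj k P F (n + 1) ⟶ barObj k P F n) => x ≫ y) (barComplex_d k (n + 1))
      (barComplex_d k n)).symm.trans h

lemma exactAt_succ_iff (n : ℕ) : (barComplex k P F).ExactAt (n + 1) ↔
    (ShortComplex.mk (barD k P F (n + 1)) (barD k P F n) (barD_comp_barD k P F n)).Exact := by
  rw [HomologicalComplex.exactAt_iff' _ (n + 2) (n + 1) n (by simp) (by simp)]
  have h : ∀ (x : barObj k P F (n + 2) ⟶ barObj k P F (n + 1))
      (y : barObj k P F (n + 1) ⟶ barObj k P F n) (w : x ≫ y = 0)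
      (x' : barObj k P F (n + 2) ⟶ barObj k P F (n + 1))
      (y' : barObj k P F (n + 1) ⟶ barObj k P F n) (w' : x' ≫ y' = 0),
      x = x' → y = y' → ((ShortComplex.mk x y w).Exact ↔ (ShortComplex.mk x' y' w').Exact) := by
    rintro x y w x' y' w' rfl rfl
    rfl
  exact h _ _ ((barComplex k P F).d_comp_d (n + 2) (n + 1) n) _ _ (barD_comp_barD k P F n)
    (barComplex_d k (n + 1)) (barComplex_d k n)

/-- The derived coend of `C(X, U) ⊗ H(Y)` is acyclic in positive degrees, if `U` is a direct summand
of a direct sum of objects of the family. -/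
lemma CopowerBifunctor.exactAt_succ {U : C} {H : C ⥤ D} (T : CopowerBifunctor (k := k) F U H)
    (hU : InAdd P U) (n : ℕ) : (barComplex k P F).ExactAt (n + 1) := by
  obtain ⟨m, j, a, b, hab⟩ := hU
  rw [exactAt_succ_iff, ShortComplex.exact_iff_exact_up_to_refinements]
  intro A x hx
  -- No refinement of `A` is needed: the homotopy provides a preimage of every generalized cycle.
  refine ⟨A, 𝟙 A, inferInstance, x ≫ coneHomotopy T a b (n + 1), ?_⟩
  have h := x ≫= coneHomotopy_d_zero T a b hab n
  change x ≫ barD k P F n = 0 at hx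
  rw [Preadditive.comp_add, reassoc_of% hx, zero_comp, add_zero, Category.comp_id] at h
  exact (Category.id_comp x).trans (h.symm.trans (Category.assoc _ _ _).symm)

end

end DerivedCoend

end

noncomputable section

namespace DerivedCoend

/-! ### Extension of dinatural families from the family `P` to other objects. -/

section Legs

variable {C : Type w} [Category.{v} C] {D : Type w'} [Category.{v'} D] {ι : Type t} {P : ι → C} {F : Cᵒᵖ ⥤ C ⥤ D} {Z : D}

lemma map_app_comm {X X' Y Y' : C} (F : Cᵒᵖ ⥤ C ⥤ D) (f : X' ⟶ X) (g : Y ⟶ Y') :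
    (F.map f.op).app Y ≫ (F.obj (op X')).map g = (F.obj (op X)).map g ≫ (F.map f.op).app Y' :=
  ((F.map f.op).naturality g).symm

lemma map_app_comm_assoc {X X' Y Y' : C} (F : Cᵒᵖ ⥤ C ⥤ D) (f : X' ⟶ X) (g : Y ⟶ Y') {Z : D}
    (h : (F.obj (op X')).obj Y' ⟶ Z) :
    (F.map f.op).app Y ≫ (F.obj (op X')).map g ≫ h =
      (F.obj (op X)).map g ≫ (F.map f.op).app Y' ≫ h := by
  rw [← Category.assoc, map_app_comm, Category.assoc]

lemma map_comp_op_app {X X' X'' : C} (F : Cᵒᵖ ⥤ C ⥤ D) (f : X ⟶ X') (g : X' ⟶ X'') (Y : C) :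
    (F.map (f ≫ g).op).app Y = (F.map g.op).app Y ≫ (F.map f.op).app Y := by
  rw [op_comp, F.map_comp, NatTrans.comp_app]

variable (P F) in
/-- A family of morphisms `F(P i, P i) ⟶ Z` that coequalizes the action of the morphisms between the
objects of the family `P`. -/
def IsDinatural (τ : ∀ i, (F.obj (op (P i))).obj (P i) ⟶ Z) : Prop :=
  ∀ ⦃i j : ι⦄ (f : P i ⟶ P j),
    (F.map f.op).app (P i) ≫ τ i = (F.obj (op (P j))).map f ≫ τ j

/-- A morphism `F(X, X) ⟶ Z` that extends a dinatural family. -/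
def IsLeg (τ : ∀ i, (F.obj (op (P i))).obj (P i) ⟶ Z) (X : C) (ω : (F.obj (op X)).obj X ⟶ Z) :
    Prop :=
  ∀ ⦃i : ι⦄ (g : P i ⟶ X), (F.obj (op X)).map g ≫ ω = (F.map g.op).app (P i) ≫ τ i

variable (P F) in
/-- The object `F(X, Y)` is covered by the objects `F(X, P i)`. -/
def JointlyEpi (X Y : C) : Prop :=
  ∀ ⦃Z : D⦄ (g h : (F.obj (op X)).obj Y ⟶ Z),
    (∀ ⦃i : ι⦄ (a : P i ⟶ Y), (F.obj (op X)).map a ≫ g = (F.obj (op X)).map a ≫ h) → g = h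

lemma JointlyEpi.leg_eq {X : C} (hX : JointlyEpi P F X X)
    {τ : ∀ i, (F.obj (op (P i))).obj (P i) ⟶ Z} {ω ω' : (F.obj (op X)).obj X ⟶ Z}
    (h : IsLeg τ X ω) (h' : IsLeg τ X ω') : ω = ω' :=
  hX _ _ fun _ a => (h a).trans (h' a).symm

lemma IsDinatural.isLeg {τ : ∀ i, (F.obj (op (P i))).obj (P i) ⟶ Z} (hτ : IsDinatural P F τ)
    (i : ι) : IsLeg τ (P i) (τ i) :=
  fun _ g => (hτ g).symm

/-- Compatibility of legs costs nothing: since the objects `F(X', P i)` cover `F(X', X)`, it can be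
tested there, and both sides become the member of the given family at `P i`. -/
lemma IsLeg.dinatural {τ : ∀ i, (F.obj (op (P i))).obj (P i) ⟶ Z} {X X' : C}
    {ω : (F.obj (op X)).obj X ⟶ Z} {ω' : (F.obj (op X')).obj X' ⟶ Z} (h : IsLeg τ X ω)
    (h' : IsLeg τ X' ω') (hX : JointlyEpi P F X' X) (f : X ⟶ X') :
    (F.map f.op).app X ≫ ω = (F.obj (op X')).map f ≫ ω' := by
  refine hX _ _ fun i a => ?_
  rw [← map_app_comm_assoc, h a, ← Category.assoc, ← map_comp_op_app, ← h' (a ≫ f),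
    Functor.map_comp, Category.assoc]

variable {k : Type u} [Field k] [Preadditive C] [Linear k C] [Preadditive D] [Linear k D]
  [IsBilinear k F]

include k in
lemma map_sum_right {β : Type*} (s : Finset β) (X : Cᵒᵖ) {Y Y' : C} (f : β → (Y ⟶ Y')) :
    (F.obj X).map (∑ b ∈ s, f b) = ∑ b ∈ s, (F.obj X).map (f b) :=
  map_sum (AddMonoidHom.mk' (fun g : Y ⟶ Y' => (F.obj X).map g)
    (IsBilinear.map_add_right k X)) f s

include k in
lemma map_sum_left {β : Type*} (s : Finset β) {X X' : C} (Y : C) (f : β → (X ⟶ X')) :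
    (F.map (∑ b ∈ s, f b).op).app Y = ∑ b ∈ s, (F.map (f b).op).app Y :=
  map_sum (AddMonoidHom.mk' (fun g : X ⟶ X' => (F.map g.op).app Y)
    (fun f g => IsBilinear.map_add_left k f g Y)) f s

include k in
lemma map_zero_left {X X' : C} (Y : C) : (F.map (0 : X ⟶ X').op).app Y = 0 := by
  simpa using map_sum_left (k := k) (F := F) (∅ : Finset ℕ) Y (fun _ => (0 : X ⟶ X'))

include k in
lemma InAdd.jointlyEpi {Y : C} (hY : InAdd P Y) (X : C) : JointlyEpi P F X Y := by
  obtain ⟨m, j, a, b, hab⟩ := hY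
  intro Z g h H
  rw [← Category.id_comp g, ← Category.id_comp h, ← (F.obj (op X)).map_id, ← hab,
    map_sum_right (k := k), Preadditive.sum_comp, Preadditive.sum_comp]
  refine Finset.sum_congr rfl fun s _ => ?_
  rw [Functor.map_comp, Category.assoc, Category.assoc, H]

include k in
lemma InAdd.exists_leg {X : C} (hX : InAdd P X) {τ : ∀ i, (F.obj (op (P i))).obj (P i) ⟶ Z}
    (hτ : IsDinatural P F τ) : ∃ ω, IsLeg τ X ω := by
  obtain ⟨m, j, a, b, hab⟩ := hX
  -- The formula is forced: insert the decomposition of the identity of `X` in the covariant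
  -- argument, then move each `b s` to the contravariant one.
  refine ⟨∑ s, (F.obj (op X)).map (a s) ≫ (F.map (b s).op).app (P (j s)) ≫ τ (j s),
    fun i g => ?_⟩
  rw [Preadditive.comp_sum]
  have h : ∀ s, (F.obj (op X)).map g ≫ (F.obj (op X)).map (a s) ≫
      (F.map (b s).op).app (P (j s)) ≫ τ (j s) = (F.map (g ≫ a s ≫ b s).op).app (P i) ≫ τ i := by
    intro s
    rw [← Functor.map_comp_assoc, ← map_app_comm_assoc, ← hτ (g ≫ a s), ← Category.assoc,
      ← map_comp_op_app, Category.assoc]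
  rw [Finset.sum_congr rfl fun s _ => h s, ← Preadditive.sum_comp, ← map_sum_left (k := k),
    ← Preadditive.comp_sum, hab, Category.comp_id]

end Legs

/-! ### The additive closure of a family. -/

section InAdd

variable {C : Type w} [Category.{v} C] [Preadditive C] {ι : Type t} {P : ι → C}

lemma InAdd.of_retract {X Y : C} (hY : InAdd P Y) (i : X ⟶ Y) (r : Y ⟶ X) (h : i ≫ r = 𝟙 X) :
    InAdd P X := by
  obtain ⟨m, j, a, b, hab⟩ := hY
  refine ⟨m, j, fun s => i ≫ a s, fun s => b s ≫ r, ?_⟩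
  have : ∀ s, (i ≫ a s) ≫ b s ≫ r = i ≫ (a s ≫ b s) ≫ r := by simp
  rw [Finset.sum_congr rfl fun s _ => this s, ← Preadditive.comp_sum, ← Preadditive.sum_comp, hab,
    Category.id_comp, h]

lemma InAdd.of_fintype {β : Type*} [Fintype β] {X : C} (j : β → ι) (a : ∀ s, X ⟶ P (j s))
    (b : ∀ s, P (j s) ⟶ X) (hab : ∑ s, a s ≫ b s = 𝟙 X) : InAdd P X := by
  let e := (Fintype.equivFin β).symm
  refine ⟨Fintype.card β, fun s => j (e s), fun s => a (e s), fun s => b (e s), ?_⟩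
  rw [← hab]
  exact e.sum_comp fun s => a s ≫ b s

variable (P) in
lemma InAdd.single (i : ι) : InAdd P (P i) :=
  InAdd.of_fintype (β := Unit) (fun _ => i) (fun _ => 𝟙 _) (fun _ => 𝟙 _) (by simp)

lemma InAdd.trans {ι' : Type*} {Q : ι' → C} {X : C} (hX : InAdd P X)
    (hP : ∀ i, InAdd Q (P i)) : InAdd Q X := by
  obtain ⟨m, j, a, b, hab⟩ := hX
  choose m' j' a' b' hab' using hP
  refine InAdd.of_fintype (β := Σ s : Fin m, Fin (m' (j s))) (fun s => j' (j s.1) s.2)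
    (fun s => a s.1 ≫ a' (j s.1) s.2) (fun s => b' (j s.1) s.2 ≫ b s.1) ?_
  rw [Fintype.sum_sigma, ← hab]
  refine Finset.sum_congr rfl fun s _ => ?_
  have : ∀ x, (a s ≫ a' (j s) x) ≫ b' (j s) x ≫ b s =
      a s ≫ (a' (j s) x ≫ b' (j s) x) ≫ b s := fun x => by simp
  rw [Finset.sum_congr rfl fun x _ => this x, ← Preadditive.comp_sum, ← Preadditive.sum_comp,
    hab', Category.id_comp]

end InAdd

/-! ### Generating families and right exact functors. -/

section Generating

attribute [local instance] Abelian.hasFiniteBiproducts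

variable {C : Type w} [Category.{v} C] [Abelian C] {ι : Type t} {P : ι → C}

lemma IsProjectiveGenerating.exists_epi (hP : IsProjectiveGenerating P) (X : C) :
    ∃ (n : ℕ) (j : Fin n → ι) (g : ∀ s, P (j s) ⟶ X), Epi (biproduct.desc g) := by
  obtain ⟨n, j, p, hp⟩ := hP.generating X
  refine ⟨n, j, fun s => Sigma.ι (fun s => P (j s)) s ≫ p, ?_⟩
  have : Sigma.desc (biproduct.ι (fun s => P (j s))) ≫
      biproduct.desc (fun s => Sigma.ι (fun s => P (j s)) s ≫ p) = p := by
    refine Sigma.hom_ext _ _ fun s => ?_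
    simp
  exact epi_of_epi_fac this

lemma IsProjectiveGenerating.projective_biproduct (hP : IsProjectiveGenerating P) {n : ℕ}
    (j : Fin n → ι) : Projective (⨁ fun s => P (j s)) := by
  have : ∀ s, Projective (P (j s)) := fun s => hP.projective (j s)
  refine ⟨fun f e _ => ⟨biproduct.desc fun s =>
    Projective.factorThru (biproduct.ι (fun s => P (j s)) s ≫ f) e, ?_⟩⟩
  refine biproduct.hom_ext' _ _ fun s => ?_
  rw [biproduct.ι_desc_assoc, Projective.factorThru_comp]

lemma InAdd.biproduct {n : ℕ} (j : Fin n → ι) : InAdd P (⨁ fun s => P (j s)) :=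
  ⟨n, j, fun s => biproduct.π (fun s => P (j s)) s, fun s => biproduct.ι (fun s => P (j s)) s,
    biproduct.total⟩

/-- Projective objects are direct summands of finite direct sums of objects of a generating
family. -/
lemma IsProjectiveGenerating.inAdd (hP : IsProjectiveGenerating P) (X : C) [Projective X] :
    InAdd P X := by
  obtain ⟨n, j, g, hg⟩ := hP.exists_epi X
  exact (InAdd.biproduct j).of_retract (Projective.factorThru (𝟙 X) (biproduct.desc g))
    (biproduct.desc g) (Projective.factorThru_comp _ _)

/-- A finite generating family has a projective generator as its direct sum. -/
lemma IsProjectiveGenerating.exists_generator [Finite ι] (hP : IsProjectiveGenerating P) :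
    ∃ U : C, InAdd P U ∧ Projective U ∧ ∀ i, InAdd (fun _ : Unit => U) (P i) := by
  obtain ⟨m, ⟨e⟩⟩ := Finite.exists_equiv_fin ι
  refine ⟨⨁ fun s => P (e.symm s), InAdd.biproduct e.symm, hP.projective_biproduct e.symm,
    fun i => ?_⟩
  obtain ⟨s, rfl⟩ := e.symm.surjective i
  exact (InAdd.single (P := fun _ : Unit => ⨁ fun s => P (e.symm s)) ()).of_retract
    (biproduct.ι (fun s => P (e.symm s)) s) (biproduct.π (fun s => P (e.symm s)) s)
    (biproduct.ι_π_self _ _)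

variable {k : Type u} [Field k] [Linear k C] {D : Type w'} [Category.{v'} D] [Abelian D]
  [Linear k D] {F : Cᵒᵖ ⥤ C ⥤ D} [IsBilinear k F] [∀ X, PreservesFiniteColimits (F.obj X)]

include k in
-- Right exactness of `F(X, -)` preserves the epimorphism onto `Y` from a sum of members of the
-- family.
lemma IsProjectiveGenerating.jointlyEpi (hP : IsProjectiveGenerating P) (X Y : C) :
    JointlyEpi P F X Y := by
  intro Z g h H
  obtain ⟨n, j, a, ha⟩ := hP.exists_epi Y
  have : Epi ((F.obj (op X)).map (biproduct.desc a)) := inferInstance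
  rw [← cancel_epi ((F.obj (op X)).map (biproduct.desc a))]
  refine InAdd.jointlyEpi (k := k) (InAdd.biproduct j) X _ _ fun i b => ?_
  rw [← Functor.map_comp_assoc, ← Functor.map_comp_assoc, H]

include k in
-- The would-be leg is first defined on `F(X, B)` for a sum `B` of generators that covers `X`. It
-- vanishes on the kernel of the cover and descends to `F(X, X)` because `F(X, -)` is right exact.
lemma IsProjectiveGenerating.exists_leg (hP : IsProjectiveGenerating P) (X : C) {Z : D}
    {τ : ∀ i, (F.obj (op (P i))).obj (P i) ⟶ Z} (hτ : IsDinatural P F τ) :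
    ∃ ω, IsLeg τ X ω := by
  obtain ⟨n, j, g, hg⟩ := hP.exists_epi X
  let B := ⨁ fun s => P (j s)
  let u : (F.obj (op X)).obj B ⟶ Z :=
    ∑ s, (F.obj (op X)).map (biproduct.π _ s) ≫ (F.map (g s).op).app (P (j s)) ≫ τ (j s)
  -- The morphism `u` sees `c` only through its composite with the cover. This gives both the
  -- vanishing on the kernel and the final formula for the leg.
  have hu : ∀ ⦃i : ι⦄ (c : P i ⟶ B), (F.obj (op X)).map c ≫ u =
      (F.map (c ≫ biproduct.desc g).op).app (P i) ≫ τ i := by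
    intro i c
    have h : ∀ s, (F.obj (op X)).map c ≫ (F.obj (op X)).map (biproduct.π _ s) ≫
        (F.map (g s).op).app (P (j s)) ≫ τ (j s) =
        (F.map (c ≫ biproduct.π _ s ≫ g s).op).app (P i) ≫ τ i := by
      intro s
      rw [← Functor.map_comp_assoc, ← map_app_comm_assoc, ← hτ (c ≫ biproduct.π _ s),
        ← Category.assoc, ← map_comp_op_app, Category.assoc]
    rw [Preadditive.comp_sum, Finset.sum_congr rfl fun s _ => h s, ← Preadditive.sum_comp,
      ← map_sum_left (k := k), ← Preadditive.comp_sum]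
    congr 5
    exact biproduct.desc_eq.symm
  have hex : (ShortComplex.mk (kernel.ι (biproduct.desc g)) (biproduct.desc g)
      (kernel.condition _)).Exact := ShortComplex.exact_kernel _
  have : (F.obj (op X)).PreservesZeroMorphisms :=
    ⟨fun Y Y' => by
      have h := IsBilinear.map_smul_right (F := F) (op X) (0 : k) (0 : Y ⟶ Y')
      rwa [zero_smul, zero_smul] at h⟩
  have hex' := hex.map_of_epi_of_preservesCokernel (F.obj (op X)) hg inferInstance
  have hepi : Epi ((F.obj (op X)).map (biproduct.desc g)) := inferInstance
  have hz : (F.obj (op X)).map (kernel.ι (biproduct.desc g)) ≫ u = 0 := by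
    refine hP.jointlyEpi (k := k) X _ _ _ fun i a => ?_
    rw [← Functor.map_comp_assoc, hu, Category.assoc, kernel.condition, comp_zero, comp_zero,
      map_zero_left (k := k), zero_comp]
  let ω : (F.obj (op X)).obj X ⟶ Z :=
    @ShortComplex.Exact.desc _ _ _ _ _ hex' _ u hz hepi
  have hω : (F.obj (op X)).map (biproduct.desc g) ≫ ω = u :=
    @ShortComplex.Exact.g_desc _ _ _ _ _ hex' _ u hz hepi
  refine ⟨ω, fun i a => ?_⟩
  have := hP.projective i
  -- Morphisms from the projective object `P i` lift along the cover, where the formula `hu`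
  -- applies.
  have ha : a = Projective.factorThru a (biproduct.desc g) ≫ biproduct.desc g :=
    (Projective.factorThru_comp _ _).symm
  rw [ha, Functor.map_comp, Category.assoc, hω, hu]

end Generating

/-! ### Low degrees of the bar construction and the coend over the family. -/

section Coend

variable (k : Type u) [Field k] {C : Type w} [Category.{v} C] [Preadditive C] [Linear k C]
  {D : Type w'} [Category.{v'} D] [Preadditive D] [Linear k D]
  {ι : Type t} (P : ι → C) (F : Cᵒᵖ ⥤ C ⥤ D) [HasBarCoproducts k P D]

/-- The inclusion of a summand of the `0`-simplices. -/
def barVertex (i : ι) : (F.obj (op (P i))).obj (P i) ⟶ barObj k P F 0 :=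
  barι k P F 0 (fun _ => i) (fun s => s.elim0)

variable {P F} in
lemma barι_zero (X : Fin 1 → ι) (f : ∀ i, Strings P X i) :
    barι k P F 0 X f = barVertex k P F (X 0) := by
  refine eq_of_heq (barι_heq (funext fun s => ?_) fun s => s.elim0)
  exact congrArg X (Subsingleton.elim (α := Fin 1) s 0)

variable {P F} in
lemma barObj_zero_hom_ext {Z : D} {g h : barObj k P F 0 ⟶ Z}
    (H : ∀ i, barVertex k P F i ≫ g = barVertex k P F i ≫ h) : g = h := by
  refine bar_hom_ext k fun X f => ?_
  rw [barι_zero]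
  exact H (X 0)

/-- The inclusion of the part of the `1`-simplices given by a morphism. -/
def barEdge {i j : ι} (h : P i ⟶ P j) : (F.obj (op (P j))).obj (P i) ⟶ barObj k P F 1 :=
  barιCons k P F j (fun _ : Fin 1 => i) h (fun s => s.elim0)

variable {P F} in
lemma barObj_one_hom_ext {Z : D} {g h : barObj k P F 1 ⟶ Z}
    (H : ∀ {i j} (f : P i ⟶ P j), barEdge k P F f ≫ g = barEdge k P F f ≫ h) : g = h := by
  refine bar_hom_ext k fun X f => ?_
  have hX : Fin.cons (X 0) (fun _ : Fin 1 => X 1) = X := by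
    funext s
    induction s using Fin.cases with
    | zero => rfl
    | succ s => rw [Subsingleton.elim s 0]; rfl
  have e : barι k P F 1 X f = barEdge k P F (f 0 : P (X 1) ⟶ P (X 0)) := by
    refine eq_of_heq (barι_heq hX.symm fun s => ?_)
    rw [Subsingleton.elim s 0]
    rfl
  rw [e]
  exact H (f 0 : P (X 1) ⟶ P (X 0))

/-- The morphism out of the `0`-simplices given by a family of morphisms. -/
def barDescZero {Z : D} (τ : ∀ i, (F.obj (op (P i))).obj (P i) ⟶ Z) : barObj k P F 0 ⟶ Z :=
  barDesc k fun X => MultilinearMap.constOfIsEmpty k _ (τ (X 0))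

variable {P F} in
lemma barVertex_descZero {Z : D} (τ : ∀ i, (F.obj (op (P i))).obj (P i) ⟶ Z) (i : ι) :
    barVertex k P F i ≫ barDescZero k P F τ = τ i :=
  barι_desc k _ _ _

variable [IsBilinear k F]

variable {P} in
lemma barEdge_D {i j : ι} (h : P i ⟶ P j) : barEdge k P F h ≫ barD k P F 0 =
    (F.map h.op).app (P i) ≫ barVertex k P F i -
      (F.obj (op (P j))).map h ≫ barVertex k P F j := by
  have e0 := barιCons_op_succ (k := k) (F := F) j (fun _ : Fin 1 => i) h (fun s => s.elim0)
  have e1 : barEdge k P F h ≫ barOp k P F (SimplexCategory.δ (1 : Fin 2)).toOrderHom =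
      (F.obj (op (P j))).map h ≫ barVertex k P F j := by
    refine (barι_op k _ _ _).trans ?_
    have e2 : ∀ a : Fin 1 →o Fin 2, a = ⟨fun _ => 0, fun _ _ _ => le_rfl⟩ →
      (F.map (strComp (consStr h (fun s => s.elim0) :
          ∀ s, Strings P (Fin.cons j (fun _ : Fin 1 => i) : Fin 2 → ι) s) 0 (a 0)
          (Fin.zero_le _)).op).app (P i) ≫
        (F.obj _).map (strComp (consStr h (fun s => s.elim0) :
          ∀ s, Strings P (Fin.cons j (fun _ : Fin 1 => i) : Fin 2 → ι) s) (a (Fin.last _))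
            (Fin.last _) (Fin.le_last _)) ≫
          barι k P F _ ((Fin.cons j (fun _ : Fin 1 => i) : Fin 2 → ι) ∘ a)
            (strRes a (consStr h (fun s => s.elim0))) =
      (F.obj (op (P j))).map h ≫ barVertex k P F j := by
      rintro _ rfl
      rw [barι_zero]
      have e3 : strComp (consStr h (fun s => s.elim0) :
          ∀ s, Strings P (Fin.cons j (fun _ : Fin 1 => i) : Fin 2 → ι) s) 0 (Fin.last 1)
          (Fin.zero_le _) = h :=
        (strComp_consStr_zero (X := fun _ : Fin 1 => i) h (fun s => s.elim0) 0
          (Fin.zero_le _)).trans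
          ((congrArg (· ≫ h) (strComp_self _ _ _)).trans (Category.id_comp h))
      refine (congrArg (fun z => (F.map (Quiver.Hom.op z)).app _ ≫ _) (strComp_self _ _ _)).trans ?_
      refine (congrArg (fun z => NatTrans.app z _ ≫ _) (F.map_id _)).trans
        ((Category.id_comp _).trans ?_)
      exact congrArg (fun z => (F.obj (op (P j))).map z ≫ barVertex k P F j) e3
    refine e2 _ ?_
    ext s : 2
    rw [Subsingleton.elim (α := Fin 1) s 0]
    rfl
  rw [barD, Fin.sum_univ_two, Preadditive.comp_add, delta_zero_toOrderHom]
  simp only [Fin.val_zero, pow_zero, one_smul, Fin.val_one, pow_one, neg_smul,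
    Preadditive.comp_neg]
  rw [e1, sub_eq_add_neg]
  refine congrArg (· + _) (e0.trans (congrArg _ ?_))
  exact barι_zero k _ _

/-- The boundary of an edge is the difference of the two actions of its morphism. So the cokernel of
the differential corepresents dinatural families, that is, zeroth homology is the coend over `P`. -/
lemma barD_comp_eq_zero_iff {Z : D} (g : barObj k P F 0 ⟶ Z) :
    barD k P F 0 ≫ g = 0 ↔ IsDinatural P F fun i => barVertex k P F i ≫ g := by
  constructor
  · intro h i j f
    have := barEdge k P F f ≫= h
    rw [← Category.assoc, barEdge_D, Preadditive.sub_comp, comp_zero, sub_eq_zero] at this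
    simpa using this
  · intro h
    refine barObj_one_hom_ext k fun {i j} f => ?_
    rw [← Category.assoc, barEdge_D, Preadditive.sub_comp, comp_zero, sub_eq_zero]
    simpa using h f

end Coend

section CoendObj

variable (k : Type u) [Field k] {C : Type w} [Category.{v} C] [Preadditive C] [Linear k C]
  {D : Type w'} [Category.{v'} D] [Abelian D] [Linear k D]
  {ι : Type t} (P : ι → C) (F : Cᵒᵖ ⥤ C ⥤ D) [HasBarCoproducts k P D] [IsBilinear k F]

/-- The coend of `F` over the family `P`. -/
def coendObj : D := (barComplex k P F).opcycles 0

/-- The structure maps of the coend over the family `P`. -/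
def coendι (i : ι) : (F.obj (op (P i))).obj (P i) ⟶ coendObj k P F :=
  barVertex k P F i ≫ (barComplex k P F).pOpcycles 0

variable {P F}

lemma coendObj_hom_ext {Z : D} {g h : coendObj k P F ⟶ Z}
    (H : ∀ i, coendι k P F i ≫ g = coendι k P F i ≫ h) : g = h := by
  refine (cancel_epi ((barComplex k P F).pOpcycles 0)).mp (barObj_zero_hom_ext k fun i => ?_)
  exact (Category.assoc _ _ _).symm.trans ((H i).trans (Category.assoc _ _ _))

variable (P F) in
lemma coendι_dinatural : IsDinatural P F (coendι k P F) := by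
  refine (barD_comp_eq_zero_iff k P F _).mp ?_
  exact (congrArg (· ≫ (barComplex k P F).pOpcycles 0) (barComplex_d k 0).symm).trans
    ((barComplex k P F).d_pOpcycles 1 0)

/-- The morphism out of the coend given by a dinatural family. -/
def coendDesc {Z : D} (τ : ∀ i, (F.obj (op (P i))).obj (P i) ⟶ Z) (hτ : IsDinatural P F τ) :
    coendObj k P F ⟶ Z :=
  (barComplex k P F).descOpcycles (barDescZero k P F τ) 1 (by simp) (by
    refine (congrArg (· ≫ barDescZero k P F τ) (barComplex_d k 0)).trans ?_
    refine (barD_comp_eq_zero_iff k P F _).mpr ?_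
    simpa only [barVertex_descZero] using hτ)

lemma coendι_desc {Z : D} (τ : ∀ i, (F.obj (op (P i))).obj (P i) ⟶ Z) (hτ : IsDinatural P F τ)
    (i : ι) : coendι k P F i ≫ coendDesc k τ hτ = τ i := by
  refine (Category.assoc _ _ _).trans ((congrArg (barVertex k P F i ≫ ·)
    ((barComplex k P F).p_descOpcycles _ 1 _ _)).trans (barVertex_descZero k τ i))

lemma coendι_desc_assoc {Z : D} (τ : ∀ i, (F.obj (op (P i))).obj (P i) ⟶ Z)
    (hτ : IsDinatural P F τ) (i : ι) {Z' : D} (h : Z ⟶ Z') :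
    coendι k P F i ≫ coendDesc k τ hτ ≫ h = τ i ≫ h :=
  (reassoc_of% (coendι_desc k τ hτ i)) h

variable {F' : Cᵒᵖ ⥤ C ⥤ D} [IsBilinear k F']

variable (P) in
/-- The functoriality of the coend. -/
def coendObjMap (η : F ⟶ F') : coendObj k P F ⟶ coendObj k P F' :=
  HomologicalComplex.opcyclesMap (barMap k P η) 0

lemma coendι_map (η : F ⟶ F') (i : ι) : coendι k P F i ≫ coendObjMap k P η =
    (η.app (op (P i))).app (P i) ≫ coendι k P F' i := by
  have h := HomologicalComplex.p_opcyclesMap (barMap k P η) 0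
  have h' := barι_objMap k (P := P) η 0 (fun _ => i) (fun s => s.elim0)
  refine (Category.assoc _ _ _).trans ((congrArg (barVertex k P F i ≫ ·) h).trans ?_)
  exact (Category.assoc _ _ _).symm.trans ((congrArg (· ≫ _) h').trans (Category.assoc _ _ _))

lemma coendι_map_assoc (η : F ⟶ F') (i : ι) {Z : D} (h : coendObj k P F' ⟶ Z) :
    coendι k P F i ≫ coendObjMap k P η ≫ h =
      (η.app (op (P i))).app (P i) ≫ coendι k P F' i ≫ h :=
  (reassoc_of% (coendι_map k η i)) h

/-- There are no chains in negative degrees, so zeroth homology is naturally the object of opcycles,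
which is the coend. -/
lemma mono_homologyMap_zero_iff (η : F ⟶ F') :
    Mono (HomologicalComplex.homologyMap (barMap k P η) 0) ↔ Mono (coendObjMap k P η) := by
  have h := ChainComplex.isoHomologyι₀_inv_naturality (barMap k P η)
  constructor
  · intro _
    have : Mono (HomologicalComplex.opcyclesMap (barMap k P η) 0 ≫
      (barComplex k P F').isoHomologyι₀.inv) := by rw [← h]; infer_instance
    exact mono_of_mono (HomologicalComplex.opcyclesMap (barMap k P η) 0)
      (barComplex k P F').isoHomologyι₀.inv
  · intro (_ : Mono (HomologicalComplex.opcyclesMap (barMap k P η) 0))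
    have : Mono ((barComplex k P F).isoHomologyι₀.inv ≫
      HomologicalComplex.homologyMap (barMap k P η) 0) := by rw [h]; infer_instance
    have h' : (barComplex k P F).isoHomologyι₀.hom ≫ (barComplex k P F).isoHomologyι₀.inv ≫
      HomologicalComplex.homologyMap (barMap k P η) 0 =
        HomologicalComplex.homologyMap (barMap k P η) 0 := Iso.hom_inv_id_assoc _ _
    rw [← h']
    infer_instance

/-- The quasi-isomorphism criterion for the augmentation of a derived coend. -/
lemma quasiIso_barAugmentation (W : Cowedge F)
    (hdesc : ∀ {Z : D} (τ : ∀ i, (F.obj (op (P i))).obj (P i) ⟶ Z), IsDinatural P F τ →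
      ∃ g : W.pt ⟶ Z, ∀ i, W.π (P i) ≫ g = τ i)
    (hext : ∀ {Z : D} (g h : W.pt ⟶ Z), (∀ i, W.π (P i) ≫ g = W.π (P i) ≫ h) → g = h)
    (hex : ∀ n, (barComplex k P F).ExactAt (n + 1)) :
    QuasiIso (barAugmentation k (P := P) W) := by
  refine ⟨fun n => ?_⟩
  cases n with
  | zero =>
    have hv : ∀ i, barVertex k P F i ≫ barAugmentationZero k W = W.π (P i) := fun i =>
      chainι_augmentationZero k W _ _
    -- In degree zero the assertion is that the augmentation is a cokernel of the first
    -- differential; uniqueness comes from `hext` and existence from `hdesc`.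
    have hepi : Epi (barAugmentationZero k (P := P) W) := ⟨fun g h e => hext g h fun i => by
      have := barVertex k P F i ≫= e
      rw [← hv]
      exact (Category.assoc _ _ _).trans (this.trans (Category.assoc _ _ _).symm)⟩
    have hexa : (ShortComplex.mk _ _ (d_augmentationZero k (P := P) W)).Exact := by
      refine ShortComplex.exact_of_g_is_cokernel _ ?_
      have hd : ∀ {Z : D} (g : (barComplex k P F).X 0 ⟶ Z), (barComplex k P F).d 1 0 ≫ g = 0 →
          ∃ l : W.pt ⟶ Z, barAugmentationZero k W ≫ l = g := by
        intro Z g hg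
        have hg' := (barD_comp_eq_zero_iff k P F (Z := Z) g).mp
          ((congrArg (· ≫ g) (barComplex_d k 0).symm).trans hg)
        obtain ⟨l, hl⟩ := hdesc _ hg'
        refine ⟨l, barObj_zero_hom_ext k fun i => ?_⟩
        exact (Category.assoc _ _ _).symm.trans ((congrArg (· ≫ l) (hv i)).trans (hl i))
      exact CokernelCofork.IsColimit.ofπ _ _ (fun g hg => (hd g hg).choose)
        (fun g hg => (hd g hg).choose_spec) (fun g hg m hm => by
          rw [← cancel_epi (barAugmentationZero k (P := P) W)]
          exact hm.trans (hd g hg).choose_spec.symm)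
    rw [ChainComplex.quasiIsoAt₀_iff, ShortComplex.quasiIso_iff_of_zeros']
    · have e : (barAugmentation k (P := P) W).f 0 = barAugmentationZero k W :=
        ChainComplex.toSingle₀Equiv_symm_apply_f_zero _ _
      have : ∀ (g : (barComplex k P F).X 0 ⟶ W.pt) (hg : (barComplex k P F).d 1 0 ≫ g = 0),
          g = barAugmentationZero k W → (ShortComplex.mk _ _ hg).Exact ∧ Epi g := by
        rintro g hg rfl
        exact ⟨hexa, hepi⟩
      exact this _ _ e
    all_goals rfl
  | succ n =>
    rw [quasiIsoAt_iff_exactAt']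
    · exact hex n
    · exact ChainComplex.exactAt_succ_single_obj _ _

end CoendObj

/-! ### From acyclicity to a resolution of the coend over all objects. -/

section Resolves

lemma projective_sigma {D : Type w'} [Category.{v'} D] {β : Type*}
    [HasColimitsOfShape (Discrete β) D] (g : β → D)
    (h : ∀ b, Projective (g b)) : Projective (∐ g) := by
  refine ⟨fun f e _ => ⟨Sigma.desc fun b => Projective.factorThru (Sigma.ι g b ≫ f) e, ?_⟩⟩
  refine Limits.Sigma.hom_ext _ _ fun b => ?_
  rw [Sigma.ι_desc_assoc, Projective.factorThru_comp]

lemma projective_barObj {k : Type u} [Field k] {C : Type w} [Category.{v} C] [Preadditive C]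
    [Linear k C] {D : Type w'} [Category.{v'} D] [Preadditive D] [Linear k D] {ι : Type t} {P : ι → C}
    {F : Cᵒᵖ ⥤ C ⥤ D} [HasBarCoproducts k P D]
    [∀ i j, Projective ((F.obj (op (P i))).obj (P j))] (n : ℕ) : Projective (barObj k P F n) :=
  projective_sigma _ fun _ => projective_sigma _ fun _ => inferInstance

variable {k : Type u} [Field k] {C : Type w} [Category.{v} C] [Abelian C] [Linear k C]
  {D : Type w'} [Category.{v'} D] [Abelian D] [Linear k D]
  {ι : Type t} {P : ι → C} {F : Cᵒᵖ ⥤ C ⥤ D} [HasBarCoproducts k P D] [IsBilinear k F]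

/-- The derived coend of a right exact functor is a resolution of the coend over all objects, if it
is acyclic in positive degrees. -/
theorem resolvesCoend_of_exactAt [∀ X, PreservesFiniteColimits (F.obj X)]
    [∀ i j, Projective ((F.obj (op (P i))).obj (P j))] (hP : IsProjectiveGenerating P)
    (hex : ∀ n, (barComplex k P F).ExactAt (n + 1)) : ResolvesCoend k P F where
  hasCoend := by
    -- The coend over the family already is the coend over all objects: its structure maps extend to
    -- legs at every object, and legs are unique.
    choose ω hω using fun X => hP.exists_leg (k := k) (F := F) X (coendι_dinatural k P F)
    have hdin : ∀ ⦃X Y : C⦄ (f : X ⟶ Y), (F.map f.op).app X ≫ ω X = (F.obj (op Y)).map f ≫ ω Y :=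
      fun X Y f => (hω X).dinatural (hω Y) (hP.jointlyEpi (k := k) Y X) f
    have hωi : ∀ i, ω (P i) = coendι k P F i := fun i =>
      (hP.jointlyEpi (k := k) _ _).leg_eq (hω (P i)) ((coendι_dinatural k P F).isLeg i)
    let W : Cowedge F := Cowedge.mk (coendObj k P F) ω hdin
    have hd : ∀ s : Cowedge F, IsDinatural P F fun i => s.π (P i) := fun s i j f => s.condition f
    refine ⟨⟨⟨W, Multicofork.IsColimit.mk _ (fun s => coendDesc k _ (hd s)) (fun s X => ?_)
      (fun s m hm => ?_)⟩⟩⟩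
    · change C at X
      change ω X ≫ coendDesc k _ (hd s) = s.π X
      refine (hP.jointlyEpi (k := k) _ _).leg_eq (τ := fun i => Multicofork.π s (P i))
        (fun i g => ?_) (fun i g => (Cowedge.condition s g).symm)
      rw [← Category.assoc, hω X g, Category.assoc]
      exact congrArg _ (coendι_desc k _ (hd s) i)
    · refine coendObj_hom_ext k fun i => ?_
      refine Eq.trans ?_ (coendι_desc k _ (hd s) i).symm
      rw [← hωi]
      exact hm (P i)
  projective n := projective_barObj (k := k) (P := P) (F := F) n
  quasiIso W hW := by
    refine quasiIso_barAugmentation k W (fun {Z} τ hτ => ?_) (fun {Z} g h H => ?_) hex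
    · choose ω hω using fun X => hP.exists_leg (k := k) (F := F) X hτ
      have hdin : ∀ ⦃X Y : C⦄ (f : X ⟶ Y),
          (F.map f.op).app X ≫ ω X = (F.obj (op Y)).map f ≫ ω Y :=
        fun X Y f => (hω X).dinatural (hω Y) (hP.jointlyEpi (k := k) Y X) f
      refine ⟨Cowedge.IsColimit.desc hW ω hdin, fun i => ?_⟩
      rw [Cowedge.IsColimit.π_desc]
      exact (hP.jointlyEpi (k := k) _ _).leg_eq (hω (P i)) (hτ.isLeg i)
    · refine Cowedge.IsColimit.hom_ext hW fun X => ?_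
      change C at X
      refine (hP.jointlyEpi (k := k) _ _).leg_eq (τ := fun i => W.π (P i) ≫ g)
        (fun i a => ?_) (fun i a => ?_)
      · exact (Category.assoc _ _ _).symm.trans ((congrArg (· ≫ g) (W.condition a).symm).trans
          (Category.assoc _ _ _))
      · exact (Category.assoc _ _ _).symm.trans ((congrArg (· ≫ h) (W.condition a).symm).trans
          ((Category.assoc _ _ _).trans (congrArg _ (H i).symm)))

end Resolves

end DerivedCoend

end

noncomputable section

namespace DerivedCoend

/-! ### Finite copowers and functors of the form `C(-, U) ⊗ Z`. -/

section Absolute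

variable {k : Type u} [Field k] {D : Type w'} [Category.{v'} D] [Preadditive D] [Linear k D]
  {V : Type t} [AddCommGroup V] [Module k V] {Y W : D} {θ : V →ₗ[k] (Y ⟶ W)}

lemma isCopower_copowerι (V : Type t) [AddCommGroup V] [Module k V] (Y : D)
    [HasColimitsOfShape (Discrete (Module.Basis.ofVectorSpaceIndex k V)) D] :
    IsCopower (copowerι k V Y) :=
  ⟨fun φ => ⟨copowerDesc k φ, copowerι_desc k φ⟩, copower_hom_ext k⟩

/-- For a finite-dimensional space the universal property follows from equations between morphisms.
Equations survive under every linear functor, whence `IsCopower.map`. -/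
lemma IsCopower.of_sum {β : Type*} [Fintype β] (e : β → V) (p : β → (W ⟶ Y)) (ε : β → V →ₗ[k] k)
    (h₁ : ∀ b x, θ x ≫ p b = ε b x • 𝟙 Y) (h₂ : ∑ b, p b ≫ θ (e b) = 𝟙 W)
    (h₃ : ∀ x, ∑ b, ε b x • e b = x) : IsCopower θ where
  exists_desc φ := ⟨∑ b, p b ≫ φ (e b), fun x => by
    rw [Preadditive.comp_sum]
    conv_rhs => rw [← h₃ x, map_sum]
    refine Finset.sum_congr rfl fun b _ => ?_
    rw [← Category.assoc, h₁, Linear.smul_comp, Category.id_comp, map_smul]⟩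
  hom_ext {Z g h} H := by
    rw [← Category.id_comp g, ← Category.id_comp h, ← h₂, Preadditive.sum_comp,
      Preadditive.sum_comp]
    simp only [Category.assoc, H]

lemma IsCopower.exists_sum [Module.Finite k V] (hθ : IsCopower θ) :
    ∃ p : Fin (Module.finrank k V) → (W ⟶ Y),
      (∀ b x, θ x ≫ p b = (Module.finBasis k V).coord b x • 𝟙 Y) ∧
        ∑ b, p b ≫ θ (Module.finBasis k V b) = 𝟙 W := by
  have hp := fun b => hθ.exists_desc (((Module.finBasis k V).coord b).smulRight (𝟙 Y))
  choose p hp using hp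
  refine ⟨p, hp, hθ.hom_ext fun x => ?_⟩
  rw [Preadditive.comp_sum, Category.comp_id]
  conv_rhs => rw [← (Module.finBasis k V).sum_repr x, map_sum]
  refine Finset.sum_congr rfl fun b _ => ?_
  rw [← Category.assoc, hp, LinearMap.smulRight_apply, Linear.smul_comp, Category.id_comp, map_smul]
  rfl

/-- Copowers by finite-dimensional vector spaces are preserved by linear functors. -/
lemma IsCopower.map [Module.Finite k V] (hθ : IsCopower θ) {D' : Type*} [Category* D']
    [Preadditive D'] [Linear k D'] (K : D ⥤ D') [K.Additive] [K.Linear k] :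
    IsCopower ((K.mapLinearMap k) ∘ₗ θ) := by
  obtain ⟨p, h₁, h₂⟩ := hθ.exists_sum
  refine IsCopower.of_sum (Module.finBasis k V) (fun b => K.map (p b))
    (Module.finBasis k V).coord (fun b x => ?_) ?_ (Module.finBasis k V).sum_repr
  · refine (K.map_comp _ _).symm.trans ?_
    rw [h₁, K.map_smul, K.map_id]
  · have := congrArg K.map h₂
    rw [K.map_sum, K.map_id] at this
    simpa using this

end Absolute

section RepCopower

variable (k : Type u) [Field k] {C : Type w} [Category.{v} C] [Preadditive C] [Linear k C]
  [∀ X Y : C, Module.Finite k (X ⟶ Y)]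
  {E : Type*} [Category* E] [Preadditive E] [Linear k E] [HasFiniteCoproducts E]

instance hasColimitsOfShape_basis (V : Type t) [AddCommGroup V] [Module k V] [Module.Finite k V] :
    HasColimitsOfShape (Discrete (Module.Basis.ofVectorSpaceIndex k V)) E := by
  have : Finite (Module.Basis.ofVectorSpaceIndex k V) :=
    Module.Finite.finite_basis (Module.Basis.ofVectorSpace k V)
  infer_instance

/-- The functor `X ↦ C(X, U) ⊗ Z`. -/
def repCopower (U : C) (Z : E) : Cᵒᵖ ⥤ E where
  obj X := copower k (X.unop ⟶ U) Z
  map f := copowerDesc k ((copowerι k _ Z) ∘ₗ Linear.leftComp k U f.unop)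
  map_id X := copower_hom_ext k fun g => by
    rw [copowerι_desc]
    simp
  map_comp f f' := copower_hom_ext k fun g => by
    rw [copowerι_desc, ← Category.assoc, copowerι_desc, LinearMap.comp_apply, LinearMap.comp_apply,
      copowerι_desc]
    simp

/-- The universal map `C(X, U) → Hom(Z, C(X, U) ⊗ Z)`. -/
def repCopowerι (U : C) (Z : E) (X : C) : (X ⟶ U) →ₗ[k] (Z ⟶ (repCopower k U Z).obj (op X)) :=
  copowerι k _ Z

variable {k} {U : C} {Z : E}

lemma repCopowerι_map {X X' : C} (f : X ⟶ X') (g : X' ⟶ U) :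
    repCopowerι k U Z X' g ≫ (repCopower k U Z).map f.op = repCopowerι k U Z X (f ≫ g) :=
  copowerι_desc k _ g

variable (k) in
/-- The natural transformation determined by the image of the identity of `U`. -/
def repCopowerDesc (N : Cᵒᵖ ⥤ E)
    (hN : ∀ X : C, ∃ φ : (X ⟶ U) →ₗ[k] (N.obj (op U) ⟶ N.obj (op X)), ∀ g, φ g = N.map g.op)
    (z : Z ⟶ N.obj (op U)) : repCopower k U Z ⟶ N where
  app X := copowerDesc k ((Linear.leftComp k _ z) ∘ₗ (hN X.unop).choose)
  naturality X X' f := copower_hom_ext k fun g => by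
    have h := fun X : C => (hN X).choose_spec
    change repCopowerι k U Z X.unop g ≫ (repCopower k U Z).map f.unop.op ≫ _ = _
    refine (Category.assoc _ _ _).symm.trans ((congrArg (· ≫ _) (repCopowerι_map f.unop g)).trans ?_)
    refine (copowerι_desc k _ _).trans ?_
    refine Eq.trans ?_ ((congrArg (· ≫ N.map f) (copowerι_desc k _ g)).symm.trans
      (Category.assoc _ _ _))
    rw [LinearMap.comp_apply, LinearMap.comp_apply, h, h]
    simp

lemma repCopowerι_desc (N : Cᵒᵖ ⥤ E)
    (hN : ∀ X : C, ∃ φ : (X ⟶ U) →ₗ[k] (N.obj (op U) ⟶ N.obj (op X)), ∀ g, φ g = N.map g.op)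
    (z : Z ⟶ N.obj (op U)) (X : C) (g : X ⟶ U) :
    repCopowerι k U Z X g ≫ (repCopowerDesc k N hN z).app (op X) = z ≫ N.map g.op := by
  refine (copowerι_desc k _ _).trans ?_
  rw [LinearMap.comp_apply, (hN X).choose_spec]
  rfl

lemma repCopowerι_desc_assoc (N : Cᵒᵖ ⥤ E)
    (hN : ∀ X : C, ∃ φ : (X ⟶ U) →ₗ[k] (N.obj (op U) ⟶ N.obj (op X)), ∀ g, φ g = N.map g.op)
    (z : Z ⟶ N.obj (op U)) (X : C) (g : X ⟶ U) {W : E} (h : N.obj (op X) ⟶ W) :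
    repCopowerι k U Z X g ≫ (repCopowerDesc k N hN z).app (op X) ≫ h = z ≫ N.map g.op ≫ h :=
  (reassoc_of% (repCopowerι_desc N hN z X g)) h

/-- If the identity of `X` factors through copies of `U`, then the images of `N(U)` under the
morphisms from `X` to `U` jointly cover `N(X)`. This is the surjectivity that starts the dimension
shifting. -/
lemma epi_repCopowerDesc (N : Cᵒᵖ ⥤ E)
    (hN : ∀ X : C, ∃ φ : (X ⟶ U) →ₗ[k] (N.obj (op U) ⟶ N.obj (op X)), ∀ g, φ g = N.map g.op)
    (hN' : ∀ X Y : C, ∃ φ : (X ⟶ Y) →+ (N.obj (op Y) ⟶ N.obj (op X)), ∀ g, φ g = N.map g.op)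
    (z : Z ⟶ N.obj (op U)) [Epi z] {X : C} (hX : InAdd (fun _ : Unit => U) X) :
    Epi ((repCopowerDesc k N hN z).app (op X)) := by
  obtain ⟨m, j, a, b, hab⟩ := hX
  refine ⟨fun {W} g h e => ?_⟩
  have ha : ∀ s, N.map (a s).op ≫ g = N.map (a s).op ≫ h := fun s => by
    rw [← cancel_epi z, ← repCopowerι_desc_assoc N hN, e, repCopowerι_desc_assoc N hN]
  obtain ⟨φ, hφ⟩ := hN' X X
  have h1 : ∑ s, N.map (b s).op ≫ N.map (a s).op = 𝟙 _ := by
    have := congrArg φ hab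
    rw [map_sum, hφ, op_id, N.map_id] at this
    rw [← this]
    exact Finset.sum_congr rfl fun s _ => by rw [hφ, op_comp, N.map_comp]
  rw [← Category.id_comp g, ← Category.id_comp h, ← h1, Preadditive.sum_comp, Preadditive.sum_comp]
  simp only [Category.assoc, ha]

end RepCopower

section KernelFunctor

variable {B : Type*} [Category* B] {E : Type*} [Category* E] [Abelian E] {N N' : B ⥤ E}

/-- The pointwise kernel of a natural transformation. -/
def kernelFunctor (η : N ⟶ N') : B ⥤ E where
  obj X := kernel (η.app X)
  map f := kernel.map _ _ (N.map f) (N'.map f) (η.naturality f).symm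
  map_id X := by simp
  map_comp f g := by simp [← cancel_mono (kernel.ι _)]

/-- The inclusion of the pointwise kernel. -/
def kernelFunctorι (η : N ⟶ N') : kernelFunctor η ⟶ N where
  app X := kernel.ι (η.app X)
  naturality X Y f := by simp [kernelFunctor]

instance (η : N ⟶ N') (X : B) : Mono ((kernelFunctorι η).app X) :=
  inferInstanceAs (Mono (kernel.ι (η.app X)))

lemma kernelFunctorι_comp (η : N ⟶ N') : kernelFunctorι η ≫ η = 0 := by
  ext X
  exact kernel.condition (η.app X)

lemma shortExact_kernelFunctor (η : N ⟶ N') (X : B) [Epi (η.app X)] :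
    (ShortComplex.mk ((kernelFunctorι η).app X) (η.app X)
      (NatTrans.congr_app (kernelFunctorι_comp η) X)).ShortExact where
  exact := ShortComplex.exact_kernel (η.app X)
  mono_f := inferInstanceAs (Mono (kernel.ι (η.app X)))
  epi_g := inferInstanceAs (Epi (η.app X))

end KernelFunctor

section Bilinear

variable {k : Type u} [Field k] {C : Type w} [Category.{v} C] [Preadditive C] [Linear k C]
  {D : Type w'} [Category.{v'} D] [Preadditive D] [Linear k D] {F F' : Cᵒᵖ ⥤ C ⥤ D}

/-- Bilinearity is a set of equations between morphisms, which may be checked after a monomorphism;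
the kernels in the dimension shifting inherit it in this way. -/
lemma IsBilinear.of_mono (η : F ⟶ F') [∀ X Y, Mono ((η.app X).app Y)] [IsBilinear k F'] :
    IsBilinear k F where
  map_add_left {X X'} f g Y := by
    have h : ∀ f : X ⟶ X', (F.map f.op).app Y ≫ (η.app (op X)).app Y =
      (η.app (op X')).app Y ≫ (F'.map f.op).app Y := fun f =>
        NatTrans.congr_app (η.naturality f.op) Y
    rw [← cancel_mono ((η.app (op X)).app Y), Preadditive.add_comp, h, h, h,
      IsBilinear.map_add_left k, Preadditive.comp_add]
  map_smul_left {X X'} r f Y := by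
    have h : ∀ f : X ⟶ X', (F.map f.op).app Y ≫ (η.app (op X)).app Y =
      (η.app (op X')).app Y ≫ (F'.map f.op).app Y := fun f =>
        NatTrans.congr_app (η.naturality f.op) Y
    rw [← cancel_mono ((η.app (op X)).app Y), Linear.smul_comp, h, h,
      IsBilinear.map_smul_left, Linear.comp_smul]
  map_add_right X Y Y' f g := by
    rw [← cancel_mono ((η.app X).app Y'), Preadditive.add_comp, (η.app X).naturality,
      (η.app X).naturality, (η.app X).naturality, IsBilinear.map_add_right k, Preadditive.comp_add]
  map_smul_right X Y Y' r f := by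
    rw [← cancel_mono ((η.app X).app Y'), Linear.smul_comp, (η.app X).naturality,
      (η.app X).naturality, IsBilinear.map_smul_right, Linear.comp_smul]

lemma CopowerBifunctor.isBilinear {U : C} {H : C ⥤ D} [H.Additive] [H.Linear k]
    (T : CopowerBifunctor (k := k) F U H) : IsBilinear k F where
  map_add_left f g Y := (T.isCopower _ _).hom_ext fun x => by
    rw [Preadditive.comp_add, T.map_left, T.map_left, T.map_left, Preadditive.add_comp, map_add]
  map_smul_left r f Y := (T.isCopower _ _).hom_ext fun x => by
    rw [Linear.comp_smul, T.map_left, T.map_left, Linear.smul_comp, map_smul]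
  map_add_right X _ _ f g := (T.isCopower X.unop _).hom_ext fun x => by
    rw [Preadditive.comp_add]
    refine (T.map_right _ _ _).trans (Eq.trans ?_ (congrArg₂ (· + ·) (T.map_right _ _ _)
      (T.map_right _ _ _)).symm)
    rw [H.map_add, Preadditive.add_comp]
  map_smul_right X _ _ r f := (T.isCopower X.unop _).hom_ext fun x => by
    rw [Linear.comp_smul]
    refine (T.map_right _ _ _).trans (Eq.trans ?_ (congrArg _ (T.map_right _ _ _)).symm)
    rw [H.map_smul, Linear.smul_comp]

lemma additive_obj (F : Cᵒᵖ ⥤ C ⥤ D) [IsBilinear k F] (X : Cᵒᵖ) : (F.obj X).Additive :=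
  ⟨fun {_ _ f g} => IsBilinear.map_add_right k X f g⟩

lemma linear_obj (F : Cᵒᵖ ⥤ C ⥤ D) [IsBilinear k F] (X : Cᵒᵖ) :
    haveI := additive_obj (k := k) F X
    (F.obj X).Linear k :=
  haveI := additive_obj (k := k) F X
  ⟨fun _ _ => IsBilinear.map_smul_right X _ _⟩

variable [∀ X Y : C, Module.Finite k (X ⟶ Y)]
  {E : Type*} [Category* E] [Preadditive E] [Linear k E] [HasFiniteCoproducts E]
  (Ψ : E ⥤ C ⥤ D) [∀ Y, (Ψ.flip.obj Y).Additive] [∀ Y, (Ψ.flip.obj Y).Linear k]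

/-- The functor `C(X, U) ⊗ Ψ(Z)(Y)`. -/
def repCopowerBifunctor (U : C) (Z : E) :
    CopowerBifunctor (k := k) (repCopower k U Z ⋙ Ψ) U (Ψ.obj Z) where
  θ X Y := ((Ψ.flip.obj Y).mapLinearMap k) ∘ₗ repCopowerι k U Z X
  isCopower X Y := (isCopower_copowerι (k := k) (X ⟶ U) Z).map (Ψ.flip.obj Y)
  map_left f g Y := by
    refine ((Ψ.flip.obj Y).map_comp _ _).symm.trans ?_
    rw [repCopowerι_map]
    rfl
  map_right h X g := (Ψ.map (repCopowerι k U Z X g)).naturality h |>.symm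

end Bilinear

/-! ### Dimension shifting. -/

section Shift

variable {k : Type u} [Field k] {C : Type w} [Category.{v} C] [Preadditive C] [Linear k C]
  {D : Type w'} [Category.{v'} D] [Abelian D] [Linear k D]
  {ι : Type t} {P : ι → C} [HasBarCoproducts k P D] [HasExactBarCoproducts k P D]

/-- In the long exact sequence, the homology of `F` in degree `n + 1` lies between the vanishing
group for `F'` in that degree and the kernel of the map in degree `n`. -/
lemma exactAt_succ_of_shortExact {F F' F'' : Cᵒᵖ ⥤ C ⥤ D} [IsBilinear k F] [IsBilinear k F']
    [IsBilinear k F''] (η : F'' ⟶ F') (η' : F' ⟶ F) (w : η ≫ η' = 0)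
    (h : ∀ i j, (ShortComplex.mk ((η.app (op (P i))).app (P j)) ((η'.app (op (P i))).app (P j))
      (NatTrans.congr_app (NatTrans.congr_app w (op (P i))) (P j))).ShortExact)
    (n : ℕ) (hF' : (barComplex k P F').ExactAt (n + 1))
    (hmono : Mono (HomologicalComplex.homologyMap (barMap k P η) n)) :
    (barComplex k P F).ExactAt (n + 1) := by
  have hS := shortExact_barMap k η η' w h (barMap_comp_eq_zero k η η' w)
  refine hS.exactAt_X₃ (n + 1) ?_ fun j hj => ?_
  · have : IsZero ((barComplex k P F').homology (n + 1)) :=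
      (HomologicalComplex.exactAt_iff_isZero_homology _ _).mp hF'
    exact ⟨fun _ _ _ => this.eq_of_src _ _⟩
  · obtain rfl : j = n := by simpa using! hj
    exact hmono

variable [∀ X Y : C, Module.Finite k (X ⟶ Y)]
  {E : Type*} [Category* E] [Abelian E] [Linear k E] (Ψ : E ⥤ C ⥤ D)
  [∀ Y, (Ψ.flip.obj Y).Additive] [∀ Y, (Ψ.flip.obj Y).Linear k]
  [∀ Y, PreservesFiniteLimits (Ψ.flip.obj Y)] [∀ Y, PreservesFiniteColimits (Ψ.flip.obj Y)]

/-- The functors `Ψ(V(X))(Y)` have acyclic derived coends, if the coends of subfunctors of functors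
of the form `C(X, U) ⊗ Z` inject. -/
theorem exactAt_succ_of_mono {U : C} (hU : InAdd P U) (hPU : ∀ i, InAdd (fun _ : Unit => U) (P i))
    (hadd : ∀ V : Cᵒᵖ ⥤ E, IsBilinear k (V ⋙ Ψ) → V.Additive)
    (hlin : ∀ V : Cᵒᵖ ⥤ E, IsBilinear k (V ⋙ Ψ) →
      ∀ {X Y : C} (r : k) (f : X ⟶ Y), V.map (r • f).op = r • V.map f.op)
    (hmono : ∀ (V V'' : Cᵒᵖ ⥤ E) (Z : E) (i : V'' ⟶ repCopower k U Z) (p : repCopower k U Z ⟶ V)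
      (w : i ≫ p = 0) (_ : ∀ X, InAdd P X → (ShortComplex.mk (i.app (op X)) (p.app (op X))
        (NatTrans.congr_app w _)).ShortExact) (_ : ∀ X, Mono (i.app X)) (_ : IsBilinear k (V ⋙ Ψ))
      (_ : IsBilinear k (V'' ⋙ Ψ)) (_ : IsBilinear k (repCopower k U Z ⋙ Ψ)),
      Mono (coendObjMap k P (Functor.whiskerRight i Ψ))) (V : Cᵒᵖ ⥤ E) [hV : IsBilinear k (V ⋙ Ψ)]
    (n : ℕ) : (barComplex k P (V ⋙ Ψ)).ExactAt (n + 1) := by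
  -- The functor `V` varies in the induction, since the step passes to the kernel of a presentation.
  induction n using Nat.strong_induction_on generalizing V with
  | _ n ih =>
    have := hadd V hV
    let Z := V.obj (op U)
    let T := repCopowerBifunctor (k := k) Ψ U Z
    have hadd' : (Ψ.obj Z).Additive := additive_obj (k := k) (V ⋙ Ψ) (op U)
    have hlin' : (Ψ.obj Z).Linear k := linear_obj (k := k) (V ⋙ Ψ) (op U)
    have hb : IsBilinear k (repCopower k U Z ⋙ Ψ) := T.isBilinear
    have hN : ∀ X : C, ∃ φ : (X ⟶ U) →ₗ[k] (V.obj (op U) ⟶ V.obj (op X)),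
      ∀ g, φ g = V.map g.op := fun X =>
        ⟨{ toFun := fun g => V.map g.op
           map_add' := fun f g => V.map_add (f := f.op) (g := g.op)
           map_smul' := fun r f => hlin V hV r f }, fun _ => rfl⟩
    have hN' : ∀ X Y : C, ∃ φ : (X ⟶ Y) →+ (V.obj (op Y) ⟶ V.obj (op X)),
      ∀ g, φ g = V.map g.op := fun X Y =>
        ⟨AddMonoidHom.mk' (fun g => V.map g.op)
          (fun f g => V.map_add (f := f.op) (g := g.op)), fun _ => rfl⟩
    -- The evaluation map from `C(-, U) ⊗ V(U)` to `V`. It is epi only on the additive closure of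
    -- `P`, which contains every object that enters the bar construction.
    let p : repCopower k U Z ⟶ V := repCopowerDesc k V hN (𝟙 _)
    have hs := fun (X : C) (hX : InAdd P X) =>
      have : Epi (p.app (op X)) := epi_repCopowerDesc V hN hN' (𝟙 _) (hX.trans hPU)
      shortExact_kernelFunctor p (op X)
    have hm : ∀ X Y, Mono (((Functor.whiskerRight (kernelFunctorι p) Ψ).app X).app Y) :=
      fun X Y => inferInstanceAs (Mono ((Ψ.flip.obj Y).map ((kernelFunctorι p).app X)))
    have hb' : IsBilinear k (kernelFunctor p ⋙ Ψ) :=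
      IsBilinear.of_mono (Functor.whiskerRight (kernelFunctorι p) Ψ)
    have w := kernelFunctorι_comp p
    have w' : Functor.whiskerRight (kernelFunctorι p) Ψ ≫ Functor.whiskerRight p Ψ = 0 := by
      ext X Y
      have h1 := NatTrans.congr_app w X
      have h2 := (Ψ.flip.obj Y).map_comp ((kernelFunctorι p).app X) (p.app X)
      refine h2.symm.trans ((congrArg _ h1).trans (Functor.map_zero _ _ _))
    refine exactAt_succ_of_shortExact (Functor.whiskerRight (kernelFunctorι p) Ψ)
      (Functor.whiskerRight p Ψ) w' (fun i j => ?_) n (T.exactAt_succ hU n) ?_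
    · exact (hs (P i) (InAdd.single P i)).map_of_exact (Ψ.flip.obj (P j))
    -- In degree zero injectivity is the hypothesis `hmono` on coends; in higher degrees the
    -- homology of the kernel vanishes by induction.
    · cases n with
      | zero =>
        rw [mono_homologyMap_zero_iff]
        exact hmono V _ Z _ p w hs inferInstance hV hb' hb
      | succ n =>
        have := ih n n.lt_succ_self (kernelFunctor p)
        have : IsZero ((barComplex k P (kernelFunctor p ⋙ Ψ)).homology (n + 1)) :=
          (HomologicalComplex.exactAt_iff_isZero_homology _ _).mp this
        exact ⟨fun _ _ _ => this.eq_of_tgt _ _⟩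

end Shift

end DerivedCoend

end

noncomputable section

namespace DerivedCoend

/-! ### Linear functors commute with the finite bar construction. -/

section Comparison

variable {k : Type u} [Field k] {D : Type w'} [Category.{v'} D] [Preadditive D] [Linear k D]
  {D' : Type*} [Category* D'] [Preadditive D'] [Linear k D'] (H : D ⥤ D') [H.Additive] [H.Linear k]

lemma copowerι_sigmaComparison (V : Type t) [AddCommGroup V] [Module k V] (Y : D)
    [HasColimitsOfShape (Discrete (Module.Basis.ofVectorSpaceIndex k V)) D]
    [HasColimitsOfShape (Discrete (Module.Basis.ofVectorSpaceIndex k V)) D'] (x : V) :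
    copowerι k V (H.obj Y) x ≫
      sigmaComparison H (fun _ : Module.Basis.ofVectorSpaceIndex k V => Y) =
        H.map (copowerι k V Y x) := by
  have : (Linear.rightComp k (H.obj Y) (sigmaComparison H
      (fun _ : Module.Basis.ofVectorSpaceIndex k V => Y))) ∘ₗ copowerι k V (H.obj Y) =
      (H.mapLinearMap k) ∘ₗ copowerι k V Y := by
    refine (Module.Basis.ofVectorSpace k V).ext fun b => ?_
    change copowerι k V (H.obj Y) (Module.Basis.ofVectorSpace k V b) ≫ _ =
      H.map (copowerι k V Y (Module.Basis.ofVectorSpace k V b))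
    rw [copowerι_basis, copowerι_basis]
    exact ι_comp_sigmaComparison H (fun _ : Module.Basis.ofVectorSpaceIndex k V => Y) b
  exact LinearMap.congr_fun this x

variable {C : Type w} [Category.{v} C] [Preadditive C] [Linear k C]
  [∀ X Y : C, Module.Finite k (X ⟶ Y)] {ι : Type t} [Finite ι] {P : ι → C}
  (F : Cᵒᵖ ⥤ C ⥤ D) [HasFiniteCoproducts D] [HasFiniteCoproducts D']

/-- Only finite coproducts occur, since both the family and the morphism spaces are finite.
Additivity of `H` therefore suffices, and the result also applies to the functor of morphisms out of
the unit. -/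
instance isIso_barObjComparison (n : ℕ) : IsIso (barObjComparison k P F H n) := by
  have i1 : HasColimitsOfShape (Discrete (Fin (n + 1) → ι)) D :=
    HasBarCoproducts.sum (k := k) (P := P) n
  have i2 : HasColimitsOfShape (Discrete (Fin (n + 1) → ι)) D' :=
    HasBarCoproducts.sum (k := k) (P := P) n
  have i3 : ∀ X : Fin (n + 1) → ι, HasColimitsOfShape
    (Discrete (Module.Basis.ofVectorSpaceIndex k (⨂[k] i, Strings P X i))) D :=
      HasBarCoproducts.copower n
  have i4 : ∀ X : Fin (n + 1) → ι, HasColimitsOfShape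
    (Discrete (Module.Basis.ofVectorSpaceIndex k (⨂[k] i, Strings P X i))) D' :=
      HasBarCoproducts.copower n
  have hc : ∀ X : Fin (n + 1) → ι, IsIso (sigmaComparison H
      (fun _ : Module.Basis.ofVectorSpaceIndex k (⨂[k] i, Strings P X i) =>
        (F.obj (op (P (X 0)))).obj (P (X (Fin.last n))))) := fun X => by
    have : Finite (Module.Basis.ofVectorSpaceIndex k (⨂[k] i, Strings P X i)) :=
      Module.Finite.finite_basis (Module.Basis.ofVectorSpace k _)
    infer_instance
  have e : barObjComparison k P F H n = Limits.Sigma.map (fun X => sigmaComparison H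
      (fun _ : Module.Basis.ofVectorSpaceIndex k (⨂[k] i, Strings P X i) =>
        (F.obj (op (P (X 0)))).obj (P (X (Fin.last n))))) ≫
      sigmaComparison H (fun X : Fin (n + 1) → ι => barSummand k P F n X) := by
    refine bar_hom_ext k fun X f => ?_
    rw [barι_objComparison]
    have h1 := Sigma.ι_map (fun X => sigmaComparison H
      (fun _ : Module.Basis.ofVectorSpaceIndex k (⨂[k] i, Strings P X i) =>
        (F.obj (op (P (X 0)))).obj (P (X (Fin.last n))))) X
    have h2 := ι_comp_sigmaComparison H (fun X : Fin (n + 1) → ι => barSummand k P F n X) X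
    have h3 := copowerι_sigmaComparison (k := k) H (⨂[k] i, Strings P X i)
      ((F.obj (op (P (X 0)))).obj (P (X (Fin.last n)))) (PiTensorProduct.tprod k f)
    refine Eq.symm ((Category.assoc _ _ _).trans ((congrArg (_ ≫ ·)
      ((Category.assoc _ _ _).symm.trans ((congrArg (· ≫ _) h1).trans
        ((Category.assoc _ _ _).trans (congrArg (_ ≫ ·) h2))))).trans ?_))
    exact (Category.assoc _ _ _).symm.trans ((congrArg (· ≫ _) h3).trans (H.map_comp _ _).symm)
  rw [e]
  have : IsIso (Limits.Sigma.map fun X => sigmaComparison H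
      (fun _ : Module.Basis.ofVectorSpaceIndex k (⨂[k] i, Strings P X i) =>
        (F.obj (op (P (X 0)))).obj (P (X (Fin.last n))))) :=
    ⟨Limits.Sigma.map fun X => inv (sigmaComparison H
      (fun _ : Module.Basis.ofVectorSpaceIndex k (⨂[k] i, Strings P X i) =>
        (F.obj (op (P (X 0)))).obj (P (X (Fin.last n))))), by
      refine Limits.Sigma.hom_ext _ _ fun X => ?_
      rw [Sigma.ι_map_assoc, Sigma.ι_map, IsIso.hom_inv_id_assoc, Category.comp_id], by
      refine Limits.Sigma.hom_ext _ _ fun X => ?_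
      rw [Sigma.ι_map_assoc, Sigma.ι_map, IsIso.inv_hom_id_assoc, Category.comp_id]⟩
  have : IsIso (sigmaComparison H (fun X : Fin (n + 1) → ι => barSummand k P F n X)) :=
    inferInstance
  exact IsIso.comp_isIso' ‹_› ‹_›

variable [IsBilinear k F]

instance isIso_barComparison : IsIso (barComparison k P F H) := by
  have : ∀ n, IsIso ((barComparison k P F H).f n) := fun n =>
    isIso_barObjComparison (k := k) (P := P) H F n
  exact HomologicalComplex.Hom.isIso_of_components _

end Comparison

/-! ### Change of the family. -/

section Reindex

variable {k : Type u} [Field k] {C : Type w} [Category.{v} C] [Preadditive C] [Linear k C]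
  {D : Type w'} [Category.{v'} D] [Abelian D] [Linear k D]

/-- Morphisms of left exact sequences that are an isomorphism in the middle and a monomorphism on the
right are an isomorphism on the left. -/
lemma isIso_τ₁_of_exact {S S' : ShortComplex D} (φ : S ⟶ S') (hS : S.Exact) [Mono S.f] [Mono S'.f]
    [IsIso φ.τ₂] [Mono φ.τ₃] : IsIso φ.τ₁ := by
  have h : (S'.f ≫ inv φ.τ₂) ≫ S.g = 0 := by
    rw [← cancel_mono φ.τ₃, Category.assoc, Category.assoc, ← φ.comm₂₃, IsIso.inv_hom_id_assoc,
      S'.zero, zero_comp]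
  have hl : hS.lift _ h ≫ S.f = S'.f ≫ inv φ.τ₂ := hS.lift_f _ h
  refine ⟨hS.lift _ h, ?_, ?_⟩
  · rw [← cancel_mono S.f, Category.assoc, hl, φ.comm₁₂_assoc, IsIso.hom_inv_id, Category.comp_id,
      Category.id_comp]
  · rw [← cancel_mono S'.f, Category.assoc, φ.comm₁₂, reassoc_of% hl, IsIso.inv_hom_id,
      Category.comp_id, Category.id_comp]

variable {ι : Type t} {ι' : Type*} {Q : ι' → C} (r : ι → ι') [HasBarCoproducts k Q D]
  [HasBarCoproducts k (fun i => Q (r i)) D]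

/-- Every member of the large family lies in the additive closure of the small one, so dinatural
families extend uniquely and the two coends corepresent the same functor. -/
lemma isIso_homologyMap_zero_reindex (hQ : ∀ i, InAdd (fun i => Q (r i)) (Q i))
    (F : Cᵒᵖ ⥤ C ⥤ D) [IsBilinear k F] :
    IsIso (HomologicalComplex.homologyMap (barReindex k F Q r) 0) := by
  let ρ : coendObj k (fun i => Q (r i)) F ⟶ coendObj k Q F :=
    HomologicalComplex.opcyclesMap (barReindex k F Q r) 0
  have hρ : ∀ i, coendι k (fun i => Q (r i)) F i ≫ ρ = coendι k Q F (r i) := fun i => by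
    have h := HomologicalComplex.p_opcyclesMap (barReindex k F Q r) 0
    have h' := barι_objReindex k (F := F) (Q := Q) r 0 (fun _ => i) (fun s => s.elim0)
    refine (Category.assoc _ _ _).trans ((congrArg (barVertex k _ F i ≫ ·) h).trans ?_)
    refine (Category.assoc _ _ _).symm.trans ((congrArg (· ≫ _) h').trans ?_)
    exact congrArg (· ≫ _) (barι_zero k (P := Q) (F := F) _ _)
  have hd := coendι_dinatural k (fun i => Q (r i)) F
  choose ω hω using fun i' => (hQ i').exists_leg (k := k) hd
  have hωd : IsDinatural Q F ω := fun i j f =>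
    (hω i).dinatural (hω j) ((hQ i).jointlyEpi (k := k) (Q j)) f
  have hωi : ∀ i, ω (r i) = coendι k (fun i => Q (r i)) F i := fun i =>
    ((hQ (r i)).jointlyEpi (k := k) _).leg_eq (hω (r i)) (hd.isLeg i)
  have h1 : ρ ≫ coendDesc k ω hωd = 𝟙 _ := coendObj_hom_ext k fun i => by
    rw [← Category.assoc, hρ, coendι_desc, hωi, Category.comp_id]
  have h2 : coendDesc k ω hωd ≫ ρ = 𝟙 _ := coendObj_hom_ext k fun i => by
    rw [coendι_desc_assoc, Category.comp_id]
    refine ((hQ i).jointlyEpi (k := k) _).leg_eq (τ := fun i => coendι k Q F (r i))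
      (fun j g => ?_) (fun j g => (coendι_dinatural k Q F g).symm)
    rw [← Category.assoc, hω i g, Category.assoc, hρ]
  have : IsIso (HomologicalComplex.opcyclesMap (barReindex k F Q r) 0) := ⟨_, h1, h2⟩
  have h := ChainComplex.isoHomologyι₀_inv_naturality (barReindex k F Q r)
  have h' := Iso.hom_inv_id_assoc (barComplex k (fun i => Q (r i)) F).isoHomologyι₀
    (HomologicalComplex.homologyMap (barReindex k F Q r) 0)
  rw [← h', h]
  infer_instance

variable [∀ X Y : C, Module.Finite k (X ⟶ Y)] [HasExactBarCoproducts k Q D]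
  [HasExactBarCoproducts k (fun i => Q (r i)) D]

/-- The derived coend does not change under enlarging the family, if the additive closure of the family
does not change and contains a generator. -/
theorem quasiIso_barReindex {U : C} (hU : InAdd (fun i => Q (r i)) U)
    (hQU : ∀ i, InAdd (fun _ : Unit => U) (Q i)) (hQ : ∀ i, InAdd (fun i => Q (r i)) (Q i))
    (hU' : InAdd Q U) (F : Cᵒᵖ ⥤ C ⥤ D) [hF : IsBilinear k F] : QuasiIso (barReindex k F Q r) := by
  suffices h : ∀ (n : ℕ) (F : Cᵒᵖ ⥤ C ⥤ D) [IsBilinear k F],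
      IsIso (HomologicalComplex.homologyMap (barReindex k F Q r) n) from
    ⟨fun n => (quasiIsoAt_iff_isIso_homologyMap _ _).mpr (h n F)⟩
  intro n
  induction n with
  | zero => exact fun F _ => isIso_homologyMap_zero_reindex r hQ F
  | succ n ih =>
    intro F hF
    have hflip : ∀ Y : C, (𝟭 (C ⥤ D)).flip.obj Y = (evaluation C D).obj Y := fun _ => rfl
    have i1 : ∀ Y : C, ((𝟭 (C ⥤ D)).flip.obj Y).Additive := fun Y =>
      inferInstanceAs ((evaluation C D).obj Y).Additive
    have i2 : ∀ Y : C, ((𝟭 (C ⥤ D)).flip.obj Y).Linear k := fun Y => ⟨fun _ _ => rfl⟩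
    -- The dimension shifting takes place with values in the functor category from `C` to `D`: the
    -- second variable is carried along pointwise, and `F` need not be exact in it.
    let Z := F.obj (op U)
    let T : CopowerBifunctor (k := k) (repCopower k U Z) U Z :=
      repCopowerBifunctor (k := k) (𝟭 (C ⥤ D)) U Z
    have hadd' : Z.Additive := additive_obj (k := k) F (op U)
    have hlin' : Z.Linear k := linear_obj (k := k) F (op U)
    have hb : IsBilinear k (repCopower k U Z) := T.isBilinear
    have hN : ∀ X : C, ∃ φ : (X ⟶ U) →ₗ[k] (F.obj (op U) ⟶ F.obj (op X)),
      ∀ g, φ g = F.map g.op := fun X =>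
        ⟨{ toFun := fun g => F.map g.op
           map_add' := fun f g => NatTrans.ext (funext (IsBilinear.map_add_left k f g))
           map_smul' := fun r f => NatTrans.ext (funext (IsBilinear.map_smul_left r f)) },
          fun _ => rfl⟩
    have hN' : ∀ X Y : C, ∃ φ : (X ⟶ Y) →+ (F.obj (op Y) ⟶ F.obj (op X)),
      ∀ g, φ g = F.map g.op := fun X Y =>
        ⟨AddMonoidHom.mk' (fun g => F.map g.op)
          (fun f g => NatTrans.ext (funext (IsBilinear.map_add_left k f g))), fun _ => rfl⟩
    let p : repCopower k U Z ⟶ F := repCopowerDesc k F hN (𝟙 _)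
    have hp : ∀ j, Epi (p.app (op (Q j))) := fun j => epi_repCopowerDesc F hN hN' (𝟙 _) (hQU j)
    have hs := fun j => shortExact_kernelFunctor p (op (Q j))
    have hm : ∀ X Y, Mono (((kernelFunctorι p).app X).app Y) := fun X Y => inferInstance
    have hb' : IsBilinear k (kernelFunctor p) := IsBilinear.of_mono (kernelFunctorι p)
    have w := kernelFunctorι_comp p
    have hse : ∀ i j, (ShortComplex.mk (((kernelFunctorι p).app (op (Q i))).app (Q j))
      ((p.app (op (Q i))).app (Q j))
      (NatTrans.congr_app (NatTrans.congr_app w (op (Q i))) (Q j))).ShortExact := fun i j =>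
        (hs i).map_of_exact ((evaluation C D).obj (Q j))
    have hS₁ := shortExact_barMap k (P := fun i => Q (r i)) (kernelFunctorι p) p w
      (fun i j => hse (r i) (r j)) (barMap_comp_eq_zero k _ _ w)
    have hS₂ := shortExact_barMap k (P := Q) (kernelFunctorι p) p w hse (barMap_comp_eq_zero k _ _ w)
    let Φ : ShortComplex.mk _ _ (barMap_comp_eq_zero k (P := fun i => Q (r i)) _ _ w) ⟶
        ShortComplex.mk _ _ (barMap_comp_eq_zero k (P := Q) _ _ w) :=
      { τ₁ := barReindex k (kernelFunctor p) Q r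
        τ₂ := barReindex k (repCopower k U Z) Q r
        τ₃ := barReindex k F Q r
        comm₁₂ := (barMap_reindex k r _).symm
        comm₂₃ := (barMap_reindex k r _).symm }
    have hrel : (ComplexShape.down ℕ).Rel (n + 1) n := rfl
    -- For both families the middle functor is acyclic in positive degrees, so the connecting
    -- morphisms identify homology in degree `n + 1` with the kernel of the map in degree `n`, where
    -- the comparison is known by induction.
    have m1 := hS₁.mono_δ (n + 1) n hrel ((HomologicalComplex.exactAt_iff_isZero_homology _ _).mp
      (T.exactAt_succ hU n))
    have m2 := hS₂.mono_δ (n + 1) n hrel ((HomologicalComplex.exactAt_iff_isZero_homology _ _).mp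
      (T.exactAt_succ hU' n))
    have := ih (kernelFunctor p)
    have := ih (repCopower k U Z)
    let Ψ : ShortComplex.mk _ _ (hS₁.δ_comp (n + 1) n hrel) ⟶
        ShortComplex.mk _ _ (hS₂.δ_comp (n + 1) n hrel) :=
      { τ₁ := HomologicalComplex.homologyMap Φ.τ₃ (n + 1)
        τ₂ := HomologicalComplex.homologyMap Φ.τ₁ n
        τ₃ := HomologicalComplex.homologyMap Φ.τ₂ n
        comm₁₂ := (HomologicalComplex.HomologySequence.δ_naturality Φ hS₁ hS₂ (n + 1) n hrel).symm
        comm₂₃ := by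
          refine (HomologicalComplex.homologyMap_comp _ _ _).symm.trans (Eq.trans ?_
            (HomologicalComplex.homologyMap_comp _ _ _))
          exact congrArg (fun z => HomologicalComplex.homologyMap z n) Φ.comm₁₂ }
    have : IsIso Ψ.τ₂ := ih (kernelFunctor p)
    have : IsIso Ψ.τ₃ := ih (repCopower k U Z)
    exact isIso_τ₁_of_exact Ψ (hS₁.homology_exact₁ (n + 1) n hrel)

end Reindex

end DerivedCoend

end

noncomputable section

namespace DerivedCoend

/-! ### The duality isomorphisms between `C(X, Y)` and `C(𝟙, Y ⊗ X^∨)`. -/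

section Duality

lemma tensorRightHomEquiv_leftUnitor {C : Type w} [Category.{v} C] [MonoidalCategory C] [RigidCategory C]
    (X Y : C) (g : X ⟶ Y) :
    tensorRightHomEquiv (𝟙_ C) X Xᘁ Y ((λ_ X).hom ≫ g) = η_ X Xᘁ ≫ g ▷ Xᘁ := by
  simp only [tensorRightHomEquiv, Equiv.coe_fn_mk]
  monoidal

variable (k : Type u) [Field k] {C : Type w} [Category.{v} C] [Preadditive C] [Linear k C]
  [MonoidalCategory C] [MonoidalPreadditive C] [MonoidalLinear k C] [RigidCategory C]

instance homFrom_linear (I : C) : (homFrom.{u, v, w} k I).Linear k where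
  map_smul f r := by
    ext x
    exact ULift.ext _ _ (Linear.comp_smul _ _ _ x.down r f)

/-- The duality map `C(X, Y) → C(𝟙, Y ⊗ X^∨)`. -/
def dualityMap (X Y : C) : (X ⟶ Y) →ₗ[k] (𝟙_ C ⟶ Y ⊗ Xᘁ) where
  toFun g := η_ X Xᘁ ≫ g ▷ Xᘁ
  map_add' f g := by rw [MonoidalPreadditive.add_whiskerRight, Preadditive.comp_add]
  map_smul' r f := by rw [MonoidalLinear.smul_whiskerRight, Linear.comp_smul]; rfl

lemma dualityMap_bijective (X Y : C) : Function.Bijective (dualityMap k X Y) := by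
  have : (dualityMap k X Y : (X ⟶ Y) → (𝟙_ C ⟶ Y ⊗ Xᘁ)) =
      (tensorRightHomEquiv (𝟙_ C) X Xᘁ Y) ∘ (fun g => (λ_ X).hom ≫ g) :=
    funext fun g => (tensorRightHomEquiv_leftUnitor X Y g).symm
  rw [this]
  refine (tensorRightHomEquiv (𝟙_ C) X Xᘁ Y).bijective.comp ⟨fun f g h => ?_, fun f => ?_⟩
  · exact (cancel_epi _).mp h
  · exact ⟨(λ_ X).inv ≫ f, by simp⟩

lemma dualityMap_comp {X Y Y' : C} (g : Y ⟶ Y') (x : X ⟶ Y) :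
    dualityMap k X Y' (x ≫ g) = dualityMap k X Y x ≫ g ▷ Xᘁ := by
  change η_ X Xᘁ ≫ (x ≫ g) ▷ Xᘁ = (η_ X Xᘁ ≫ x ▷ Xᘁ) ≫ g ▷ Xᘁ
  rw [comp_whiskerRight, Category.assoc]

/-- Naturality in the contravariant variable is the dinaturality of the coevaluation followed by the
interchange law. -/
lemma comp_dualityMap {X X' Y : C} (f : X' ⟶ X) (x : X ⟶ Y) :
    dualityMap k X' Y (f ≫ x) = dualityMap k X Y x ≫ Y ◁ fᘁ := by
  change η_ X' X'ᘁ ≫ (f ≫ x) ▷ X'ᘁ = (η_ X Xᘁ ≫ x ▷ Xᘁ) ≫ Y ◁ fᘁ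
  rw [comp_whiskerRight, Category.assoc, ← coevaluation_comp_rightAdjointMate_assoc,
    whisker_exchange]

/-- The duality isomorphisms `C(X, Y) ≅ C(𝟙, Y ⊗ X^∨)`. -/
def dualityNatTrans : homBifunctor.{u, v, w} k C ⟶
    tensorDual (𝟭 C) ⋙ (Functor.whiskeringRight _ _ _).obj (homFrom.{u, v, w} k (𝟙_ C)) where
  app X :=
    { app := fun Y => (ModuleCat.uliftFunctor.{max u w, v} k).map
        (ModuleCat.ofHom (dualityMap k X.unop Y))
      naturality := fun Y Y' g => by
        ext x
        refine ULift.ext _ _ ?_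
        exact dualityMap_comp k g x.down }
  naturality X X' f := by
    ext Y x
    refine ULift.ext _ _ ?_
    exact comp_dualityMap k f.unop x.down

instance isIso_dualityNatTrans : IsIso (dualityNatTrans.{u, v, w} (C := C) k) := by
  have : ∀ X Y, IsIso (((dualityNatTrans.{u, v, w} (C := C) k).app X).app Y) := by
    intro X Y
    rw [ConcreteCategory.isIso_iff_bijective]
    exact Equiv.ulift.symm.bijective.comp ((dualityMap_bijective k X.unop Y).comp
      Equiv.ulift.bijective)
  have : ∀ X, IsIso ((dualityNatTrans.{u, v, w} (C := C) k).app X) := fun X =>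
    NatIso.isIso_of_isIso_app _
  exact NatIso.isIso_of_isIso_app _

end Duality

/-! ### Comparison with the Hochschild complex. -/

section Hochschild

attribute [local instance] Abelian.hasFiniteBiproducts

variable {k : Type u} [Field k] {C : Type w} [Category.{v} C] [Abelian C] [Linear k C]
  [∀ X Y : C, Module.Finite k (X ⟶ Y)] {ι : Type t} [Finite ι] {P : ι → C}

/-- Every projective object is a summand of a finite sum of members of `P`, and the direct sum of
`P` serves as the generator `U`. -/
lemma quasiIso_barReindex_projFamily (hP : IsProjectiveGenerating P) (F : Cᵒᵖ ⥤ C ⥤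
    ModuleCat.{max u v w} k) [IsBilinear k F] :
    QuasiIso (barReindex k F (projFamily C) fun i => ⟨P i, hP.projective i⟩) := by
  obtain ⟨U, hU, hproj, hPU⟩ := hP.exists_generator
  have hall : ∀ X : {X : C // Projective X}, InAdd P (projFamily C X) := fun X =>
    have := X.2
    hP.inAdd X.1
  exact quasiIso_barReindex (Q := projFamily C) (fun i => ⟨P i, hP.projective i⟩) (U := U) hU
    (fun X => (hall X).trans hPU) hall
    (InAdd.single (P := projFamily C) ⟨U, hproj⟩) F

variable [MonoidalCategory C] [MonoidalPreadditive C] [MonoidalLinear k C] [RigidCategory C]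

theorem exists_quasiIso_hochschild (hP : IsProjectiveGenerating P) :
    ∃ φ : ((homFrom.{u, v, w} k (𝟙_ C)).mapHomologicalComplex (ComplexShape.down ℕ)).obj
        (barComplex k P (tensorDual (𝟭 C))) ⟶ hochschildComplex.{u, v, w} k C,
      QuasiIso φ ∧
      ∀ (n : ℕ) (X : Fin (n + 1) → ι) (f : ∀ i, Strings P X i)
          (g : P (X 0) ⟶ P (X (Fin.last n))),
        φ.f n (ULift.up ((η_ (P (X 0)) (P (X 0))ᘁ ≫ g ▷ (P (X 0))ᘁ) ≫
            chainι k P (tensorDual (𝟭 C)) n X f)) =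
          chainι k (projFamily C) (homBifunctor.{u, v, w} k C) n
            (fun i => ⟨P (X i), hP.projective (X i)⟩) f (ULift.up g) := by
  let H := homFrom.{u, v, w} k (𝟙_ C)
  let κ := barComparison k P (tensorDual (𝟭 C)) H
  let ψ := barMap k P (inv (dualityNatTrans.{u, v, w} (C := C) k))
  let ρ : barComplex k P (homBifunctor.{u, v, w} k C) ⟶ hochschildComplex.{u, v, w} k C :=
    barReindex k (homBifunctor.{u, v, w} k C) (projFamily C) fun i => ⟨P i, hP.projective i⟩
  have hψ : IsIso ψ := ⟨barMap k P (dualityNatTrans.{u, v, w} (C := C) k), by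
    rw [← barMap_comp, IsIso.inv_hom_id, barMap_id], by
    rw [← barMap_comp, IsIso.hom_inv_id, barMap_id]⟩
  have hρ : QuasiIso ρ := quasiIso_barReindex_projFamily hP _
  have hκ : IsIso κ := isIso_barComparison H (tensorDual (𝟭 C))
  have hκ' : QuasiIso (inv κ) := quasiIso_of_isIso _
  have hψ' : QuasiIso ψ := quasiIso_of_isIso _
  have hψρ : QuasiIso (ψ ≫ ρ) := quasiIso_comp _ _
  -- The first two maps are isomorphisms of complexes: pulling `C(𝟙, -)` into the bar construction,
  -- and inverse duality. Only the enlargement of the family is a mere quasi-isomorphism.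
  refine ⟨inv κ ≫ ψ ≫ ρ, quasiIso_comp _ _, fun n X f g => ?_⟩
  have h1 := barι_objComparison k (P := P) (F := tensorDual (𝟭 C)) H n X f
  have h2 : H.map (barι k P (tensorDual (𝟭 C)) n X f) ≫ (inv κ).f n =
      barι k P (tensorDual (𝟭 C) ⋙ (Functor.whiskeringRight _ _ _).obj H) n X f := by
    have h3 : κ.f n ≫ (inv κ).f n = 𝟙 _ := by
      rw [← HomologicalComplex.comp_f, IsIso.hom_inv_id, HomologicalComplex.id_f]
    have := congrArg (barι k P (tensorDual (𝟭 C) ⋙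
      (Functor.whiskeringRight _ _ _).obj H) n X f ≫ ·) h3
    refine (congrArg (· ≫ (inv κ).f n) h1).symm.trans ((Category.assoc _ _ _).trans (this.trans ?_))
    exact Category.comp_id _
  let y : (𝟙_ C ⟶ P (X (Fin.last n)) ⊗ (P (X 0))ᘁ) := η_ (P (X 0)) (P (X 0))ᘁ ≫ g ▷ (P (X 0))ᘁ
  have h4 := barι_objMap k (P := P) (inv (dualityNatTrans.{u, v, w} (C := C) k)) n X f
  have h5 := barι_objReindex k (F := homBifunctor.{u, v, w} k C) (Q := projFamily C)
    (fun i => ⟨P i, hP.projective i⟩) n X f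
  have h6 : ((inv (dualityNatTrans.{u, v, w} (C := C) k)).app (op (P (X 0)))).app
      (P (X (Fin.last n))) (ULift.up y) = ULift.up g := by
    have := NatTrans.congr_app (NatTrans.congr_app
      (IsIso.hom_inv_id (dualityNatTrans.{u, v, w} (C := C) k)) (op (P (X 0)))) (P (X (Fin.last n)))
    exact ConcreteCategory.congr_hom this (ULift.up g)
  have h7 : H.map (barι k P (tensorDual (𝟭 C)) n X f) ≫ (inv κ).f n ≫ ψ.f n ≫ ρ.f n =
      ((inv (dualityNatTrans.{u, v, w} (C := C) k)).app (op (P (X 0)))).app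
      (P (X (Fin.last n))) ≫ barι k (projFamily C) (homBifunctor.{u, v, w} k C) n
            (fun i => ⟨P (X i), hP.projective (X i)⟩) f := by
    refine (Category.assoc _ _ _).symm.trans ((congrArg (· ≫ _) h2).trans ?_)
    refine (Category.assoc _ _ _).symm.trans ((congrArg (· ≫ _) h4).trans ?_)
    exact (Category.assoc _ _ _).trans (congrArg (_ ≫ ·) h5)
  have h8 := ConcreteCategory.congr_hom h7 (ULift.up y)
  refine h8.trans ?_
  exact congrArg (barι k (projFamily C) (homBifunctor.{u, v, w} k C) n
            (fun i => ⟨P (X i), hP.projective (X i)⟩) f) h6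

end Hochschild

end DerivedCoend

end

noncomputable section

namespace DerivedCoend

/-! ### Underlying vector spaces and the free module as a projective generator. -/

section Underlying

open scoped ModuleCat

variable (k : Type u) [Field k] (A : Type u) [Ring A] [Algebra k A]

lemma isNoetherianRing_of_finite [Module.Finite k A] : IsNoetherianRing A :=
  have : IsNoetherian k A := inferInstance
  isNoetherian_of_tower k this

/-- The underlying vector space of a finitely generated module over a `k`-algebra. -/
def underlying : FGModuleCat.{u} A ⥤ ModuleCat.{u} k :=
  forget₂ (FGModuleCat.{u} A) (ModuleCat.{u} A) ⋙ ModuleCat.restrictScalars (algebraMap k A)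

instance underlying_additive : (underlying k A).Additive where
  map_add := rfl

instance underlying_linear : (underlying k A).Linear k where
  map_smul f r := by
    ext x
    rfl

instance underlying_faithful : (underlying k A).Faithful :=
  inferInstanceAs (forget₂ (FGModuleCat.{u} A) (ModuleCat.{u} A) ⋙
    ModuleCat.restrictScalars (algebraMap k A)).Faithful

instance underlying_reflectsIsomorphisms : (underlying k A).ReflectsIsomorphisms :=
  inferInstanceAs (Functor.ReflectsIsomorphisms (forget₂ (FGModuleCat.{u} A) (ModuleCat.{u} A) ⋙
    ModuleCat.restrictScalars (algebraMap k A)))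

variable [IsNoetherianRing A]

instance underlying_preservesFiniteColimits : PreservesFiniteColimits (underlying k A) :=
  comp_preservesFiniteColimits _ _

instance underlying_preservesFiniteLimits : PreservesFiniteLimits (underlying k A) :=
  have : PreservesFiniteLimits (ModuleCat.restrictScalars.{u} (algebraMap k A)) :=
    ⟨fun _ _ _ => ⟨inferInstance⟩⟩
  comp_preservesFiniteLimits _ _

lemma underlying_map_surjective {M N : FGModuleCat.{u} A} (f : M ⟶ N) [Epi f] :
    Function.Surjective ((underlying k A).map f) :=
  (ModuleCat.epi_iff_surjective _).mp inferInstance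

end Underlying

section Free

open scoped ModuleCat

variable {k : Type u} [Field k] {A : Type u} [Ring A] [Algebra k A] {C : Type w} [Category.{v} C]

/-- The free module of rank one represents the underlying vector space. -/
lemma exists_representing (e : C ≌ FGModuleCat.{u} A) : ∃ (L : C)
    (y : (e.functor ⋙ underlying k A).obj L), ∀ (X : C) (x : (e.functor ⋙ underlying k A).obj X),
      ∃! f : L ⟶ X, (e.functor ⋙ underlying k A).map f y = x := by
  let L := e.inverse.obj (FGModuleCat.of A A)
  let y : (e.functor.obj L).obj := (e.counitInv.app (FGModuleCat.of A A)).hom.hom (1 : A)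
  have hy : ∀ z : (e.functor.obj L).obj, ∃ a : A, a • y = z := by
    intro z
    refine ⟨((e.counit.app (FGModuleCat.of A A)).hom.hom z : A), ?_⟩
    have h2 := (e.counitInv.app (FGModuleCat.of A A)).hom.hom.map_smul
      ((e.counit.app (FGModuleCat.of A A)).hom.hom z : A) (1 : A)
    refine h2.symm.trans ?_
    rw [smul_eq_mul, mul_one]
    have h3 := e.counitIso.hom_inv_id_app (FGModuleCat.of A A)
    exact ConcreteCategory.congr_hom h3 z
  have hy1 : @Eq A ((e.counit.app (FGModuleCat.of A A)).hom.hom y) (1 : A) :=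
    ConcreteCategory.congr_hom (e.counitIso.inv_hom_id_app (FGModuleCat.of A A)) (1 : A)
  refine ⟨L, y, fun X x => ⟨e.functor.preimage (e.counit.app (FGModuleCat.of A A) ≫
    FGModuleCat.ofHom (LinearMap.toSpanSingleton A (e.functor.obj X).obj x)), ?_, ?_⟩⟩
  · change (e.functor.map (e.functor.preimage _)).hom.hom y = x
    rw [e.functor.map_preimage]
    change LinearMap.toSpanSingleton A (e.functor.obj X).obj x
      ((e.counit.app (FGModuleCat.of A A)).hom.hom y : A) = x
    rw [hy1]
    exact one_smul A (show (e.functor.obj X).obj from x)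
  · intro f hf
    apply e.functor.map_injective
    rw [e.functor.map_preimage]
    refine FGModuleCat.hom_ext (LinearMap.ext fun z => ?_)
    obtain ⟨a, rfl⟩ := hy z
    rw [map_smul, map_smul]
    congr 1
    refine Eq.trans hf ?_
    change x = LinearMap.toSpanSingleton A (e.functor.obj X).obj x
      ((e.counit.app (FGModuleCat.of A A)).hom.hom y : A)
    rw [hy1]
    exact (one_smul A (show (e.functor.obj X).obj from x)).symm

variable (k) [Module.Finite k A] [Abelian C]

include k

/-- The functor represented by `L` is the underlying vector space, which takes epimorphisms to
surjections. -/
lemma projective_of_representing (e : C ≌ FGModuleCat.{u} A) {L : C}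
    {y : (e.functor ⋙ underlying k A).obj L} (h : ∀ (X : C)
      (x : (e.functor ⋙ underlying k A).obj X),
        ∃! f : L ⟶ X, (e.functor ⋙ underlying k A).map f y = x) : Projective L := by
  have := isNoetherianRing_of_finite k A
  refine ⟨fun {E X} f p _ => ?_⟩
  obtain ⟨z, hz⟩ := underlying_map_surjective k A (e.functor.map p)
    ((e.functor ⋙ underlying k A).map f y)
  obtain ⟨g, hg, -⟩ := h E z
  refine ⟨g, (h X ((e.functor ⋙ underlying k A).map f y)).unique ?_ rfl⟩
  rw [Functor.map_comp]
  exact (congrArg ((underlying k A).map (e.functor.map p)) hg).trans hz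

/-- A finite category has a finite generating family of projective objects. -/
lemma exists_isProjectiveGenerating (e : C ≌ FGModuleCat.{u} A) :
    ∃ P : Fin 1 → C, IsProjectiveGenerating P := by
  have := isNoetherianRing_of_finite k A
  obtain ⟨L, y, h⟩ := exists_representing (k := k) e
  refine ⟨fun _ => L, fun _ => projective_of_representing k e h, fun X => ?_⟩
  · have := finite_of_fgModule k (e.functor.obj X)
    obtain ⟨n, s, hs⟩ := Module.Finite.exists_fin (R := k) (M := (e.functor.obj X).obj)
    choose f hf _ using fun i => h X (s i)
    refine ⟨n, fun _ => 0, Sigma.desc f, ⟨fun {Z} a b hab => ?_⟩⟩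
    apply (e.functor ⋙ underlying k A).map_injective
    refine ModuleCat.hom_ext (LinearMap.ext_on_range hs fun i => ?_)
    rw [← hf i]
    have := congrArg (Sigma.ι (fun _ : Fin n => L) i ≫ ·) hab
    simp only [Sigma.ι_desc_assoc] at this
    have h1 := ConcreteCategory.congr_hom (congrArg (e.functor ⋙ underlying k A).map this) y
    rw [Functor.map_comp, Functor.map_comp] at h1
    exact h1

end Free

/-! ### Acyclicity for vector-space-valued bifunctors `V(X) ⊗ W(Y)` with `W` representable. -/

section Flat

variable {k : Type u} [Field k] {C : Type w} [Category.{v} C]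

/-- The functor `(V, Y) ↦ V ⊗ W(Y)`. -/
def tensorUnderlying (W : C ⥤ ModuleCat.{u} k) : ModuleCat.{u} k ⥤ C ⥤ ModuleCat.{u} k :=
  curriedTensor (ModuleCat.{u} k) ⋙ (Functor.whiskeringLeft _ _ _).obj W

variable (W : C ⥤ ModuleCat.{u} k) (Y : C)

instance : ((tensorUnderlying W).flip.obj Y).Additive :=
  inferInstanceAs (tensorRight (W.obj Y)).Additive

instance : ((tensorUnderlying W).flip.obj Y).Linear k :=
  inferInstanceAs ((tensorRight (W.obj Y)).Linear k)

instance : PreservesFiniteLimits ((tensorUnderlying W).flip.obj Y) :=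
  (Module.Flat.iff_preservesFiniteLimits_tensorRight (W.obj Y)).mp inferInstance

instance : PreservesFiniteColimits ((tensorUnderlying W).flip.obj Y) :=
  inferInstanceAs (PreservesFiniteColimits (tensorRight (W.obj Y)))

end Flat

end DerivedCoend

end

noncomputable section

namespace DerivedCoend

section Flat

/-- Tensoring with a nonzero vector space is faithful. This recovers the linearity of `V` from the
bilinearity of `V ⊗ W`. -/
lemma map_eq_of_tensorUnderlying {k : Type u} [Field k] {C : Type w} [Category.{v} C]
    (W : C ⥤ ModuleCat.{u} k) {Y : C} [Nontrivial (W.obj Y)]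
    {Z Z' : ModuleCat.{u} k} {f g : Z ⟶ Z'}
    (h : ((tensorUnderlying W).map f).app Y = ((tensorUnderlying W).map g).app Y) : f = g := by
  refine ModuleCat.hom_ext (sub_eq_zero.mp ?_)
  rw [Module.FaithfullyFlat.zero_iff_rTensor_zero k (W.obj Y)]
  rw [LinearMap.rTensor_sub]
  exact sub_eq_zero.mpr (congrArg ModuleCat.Hom.hom h)

variable {k : Type u} [Field k] {C : Type w} [Category.{v} C] [Abelian C] [Linear k C]
  {ι : Type t} {P : ι → C} (W : C ⥤ ModuleCat.{u} k) [W.Additive] [W.Linear k]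
  
variable {V : Cᵒᵖ ⥤ ModuleCat.{u} k} {L : C} {y : W.obj L}

/-- The map `V(X) ⊗ W(X) → V(L)` given by the Yoneda lemma. -/
lemma exists_evalAt (hadd : V.Additive) (hlin : ∀ {X Y : C} (r : k) (f : X ⟶ Y),
      V.map (r • f).op = r • V.map f.op) 
    (hL : ∀ (X : C) (x : W.obj X), ∃! f : L ⟶ X, W.map f y = x) (X : C) :
    ∃ φ : V.obj (op X) ⊗ W.obj X ⟶ V.obj (op L), ∀ (f : L ⟶ X) (x : V.obj (op X)),
      φ (x ⊗ₜ[k] W.map f y) = V.map f.op x := by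
  choose ρ hρ hρ' using hL
  have hρ'' : ∀ X (f : L ⟶ X), ρ X (W.map f y) = f := fun X f => (hρ' X _ f rfl).symm
  let ψ : W.obj X →ₗ[k] V.obj (op X) →ₗ[k] V.obj (op L) :=
    { toFun := fun z => (V.map (ρ X z).op).hom
      map_add' := fun z z' => by
        have : ρ X (z + z') = ρ X z + ρ X z' := by
          refine (hρ' X _ _ ?_).symm
          change W.map (ρ X z + ρ X z') y = z + z'
          rw [W.map_add]
          exact congrArg₂ (· + ·) (hρ X z) (hρ X z')
        rw [this, op_add, V.map_add]
        rfl
      map_smul' := fun r z => by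
        have : ρ X (r • z) = r • ρ X z := by
          refine (hρ' X _ _ ?_).symm
          change W.map (r • ρ X z) y = r • z
          rw [W.map_smul]
          exact congrArg (r • ·) (hρ X z)
        rw [this, hlin]
        rfl }
  refine ⟨ModuleCat.ofHom (TensorProduct.lift ψ.flip), fun f x => ?_⟩
  change (V.map (ρ X (W.map f y)).op).hom x = _
  rw [hρ'']

variable [IsBilinear k (V ⋙ tensorUnderlying W)] [HasBarCoproducts k P (ModuleCat.{u} k)]

/-- The coends of `V ⊗ W` embed into the values of `V`, if `W` is represented by `L`. -/
lemma exists_mono_coendObj (hadd : V.Additive) (hlin : ∀ {X Y : C} (r : k) (f : X ⟶ Y),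
      V.map (r • f).op = r • V.map f.op) 
    (hL : ∀ (X : C) (x : W.obj X), ∃! f : L ⟶ X, W.map f y = x) (hLP : InAdd P L) :
    ∃ φ : coendObj k P (V ⋙ tensorUnderlying W) ⟶ V.obj (op L), Mono φ ∧
      ∀ i (f : L ⟶ P i) (x : V.obj (op (P i))),
        (coendι k P (V ⋙ tensorUnderlying W) i ≫ φ) (x ⊗ₜ[k] W.map f y) = V.map f.op x := by
  choose τ hτ using exists_evalAt W (V := V) hadd hlin hL
  have hdin : IsDinatural P (V ⋙ tensorUnderlying W) fun i => τ (P i) := by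
    intro i j f
    refine ModuleCat.hom_ext (TensorProduct.ext' fun x z => ?_)
    obtain ⟨g, hg, -⟩ := hL (P i) z
    subst hg
    have h1 : W.map f (W.map g y) = W.map (g ≫ f) y := by rw [W.map_comp]; rfl
    change τ (P i) (V.map f.op x ⊗ₜ[k] W.map g y) = τ (P j) (x ⊗ₜ[k] W.map f (W.map g y))
    rw [hτ, h1, hτ, op_comp, V.map_comp]
    rfl
  refine ⟨coendDesc k _ hdin, ?_, fun i f x => ?_⟩
  · obtain ⟨ω, hω⟩ := hLP.exists_leg (k := k) (coendι_dinatural k P (V ⋙ tensorUnderlying W))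
    -- The left inverse tensors with the universal element `y` and enters the coend through its leg
    -- at `L`, available since `L` lies in the additive closure of `P`.
    let σ : V.obj (op L) ⟶ coendObj k P (V ⋙ tensorUnderlying W) :=
      ModuleCat.ofHom ((TensorProduct.mk k (V.obj (op L)) (W.obj L)).flip y) ≫ ω
    have hσ : coendDesc k _ hdin ≫ σ = 𝟙 _ := by
      refine coendObj_hom_ext k fun i => ?_
      refine (coendι_desc_assoc k _ hdin i σ).trans (Eq.trans ?_ (Category.comp_id _).symm)
      refine ModuleCat.hom_ext (TensorProduct.ext' fun x z => ?_)
      obtain ⟨g, hg, -⟩ := hL (P i) z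
      subst hg
      change ω (τ (P i) (x ⊗ₜ[k] W.map g y) ⊗ₜ[k] y) = coendι k P (V ⋙ tensorUnderlying W) i (x ⊗ₜ[k] W.map g y)
      rw [hτ]
      have := hω.dinatural ((coendι_dinatural k P (V ⋙ tensorUnderlying W)).isLeg i)
        (hLP.jointlyEpi (k := k) _) g
      exact ConcreteCategory.congr_hom this (x ⊗ₜ[k] y)
    have : Mono (coendDesc k _ hdin ≫ σ) := by rw [hσ]; infer_instance
    exact mono_of_mono _ σ
  · exact (ConcreteCategory.congr_hom (coendι_desc k _ hdin i) (x ⊗ₜ[k] W.map f y)).trans (hτ _ _ _)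

variable [∀ X Y : C, Module.Finite k (X ⟶ Y)]

/-- The coend of `V(X) ⊗ C(L, X)` embeds naturally into `V(L)`. A pointwise monomorphism of functors
`V` therefore induces a monomorphism of coends, as dimension shifting requires. -/
lemma exactAt_succ_tensorUnderlying (hL : ∀ (X : C) (x : W.obj X), ∃! f : L ⟶ X, W.map f y = x)
    (hLP : InAdd P L) {U : C} (hU : InAdd P U) (hPU : ∀ i, InAdd (fun _ : Unit => U) (P i))
    (n : ℕ) : (barComplex k P (V ⋙ tensorUnderlying W)).ExactAt (n + 1) := by
  -- If `W(L)` is zero, then so is `y`, hence all of `W`, and the complex vanishes. Otherwise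
  -- tensoring with `W(L)` is faithful.
  rcases subsingleton_or_nontrivial (W.obj L) with h0 | h1
  · have hz : ∀ (X : C) (x : W.obj X), x = 0 := fun X x => by
      obtain ⟨f, hf, -⟩ := hL X x
      rw [← hf, Subsingleton.elim y 0, map_zero]
    rw [exactAt_succ_iff]
    refine ShortComplex.exact_of_isZero_X₂ _ ((IsZero.iff_id_eq_zero _).mpr
      (bar_hom_ext k fun X f => ModuleCat.hom_ext (TensorProduct.ext' fun x z => ?_)))
    rw [hz _ z, TensorProduct.tmul_zero]
    exact (map_zero (ModuleCat.Hom.hom _)).trans (map_zero (ModuleCat.Hom.hom _)).symm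
  · have key : ∀ V : Cᵒᵖ ⥤ ModuleCat.{u} k, IsBilinear k (V ⋙ tensorUnderlying W) →
      V.Additive ∧ ∀ {X Y : C} (r : k) (f : X ⟶ Y), V.map (r • f).op = r • V.map f.op := by
      intro V hV
      refine ⟨⟨fun {X X' f g} => ?_⟩, fun {X X'} r f => ?_⟩
      · refine map_eq_of_tensorUnderlying W (Y := L) ?_
        refine (hV.map_add_left f.unop g.unop L).trans ?_
        exact (((tensorUnderlying W).flip.obj L).map_add (f := V.map f) (g := V.map g)).symm
      · refine map_eq_of_tensorUnderlying W (Y := L) ?_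
        refine (hV.map_smul_left r f L).trans ?_
        exact (((tensorUnderlying W).flip.obj L).map_smul r (V.map f.op)).symm
    refine exactAt_succ_of_mono (k := k) (tensorUnderlying W) hU hPU (fun V hV => (key V hV).1)
      (fun V hV => (key V hV).2) ?_ V n
    intro V V'' Z i p w hs hi hV hV'' hV'
    obtain ⟨φ, hφ, h⟩ := exists_mono_coendObj W (key _ hV').1 (key _ hV').2 hL hLP
    obtain ⟨φ', hφ', h'⟩ := exists_mono_coendObj W (key _ hV'').1 (key _ hV'').2 hL hLP
    have : coendObjMap k P (Functor.whiskerRight i (tensorUnderlying W)) ≫ φ = φ' ≫ i.app (op L) := by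
      refine coendObj_hom_ext k fun j => ?_
      refine (coendι_map_assoc k (P := P) _ j φ).trans (ModuleCat.hom_ext (TensorProduct.ext' fun x z => ?_))
      obtain ⟨g, hg, -⟩ := hL (P j) z
      subst hg
      refine (h j g (i.app (op (P j)) x)).trans ?_
      refine Eq.trans ?_ (congrArg (i.app (op L)) (h' j g x)).symm
      exact (ConcreteCategory.congr_hom (i.naturality g.op) x).symm
    have : Mono (coendObjMap k P (Functor.whiskerRight i (tensorUnderlying W)) ≫ φ) := by
      rw [this]
      exact mono_comp _ _
    exact mono_of_mono _ φ

end Flat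

/-! ### Transfer of acyclicity along exact functors. -/

section Transfer

variable {k : Type u} [Field k] {C : Type w} [Category.{v} C] [Preadditive C] [Linear k C]
  [∀ X Y : C, Module.Finite k (X ⟶ Y)] {ι : Type t} [Finite ι] {P : ι → C}
  {D : Type*} [Category* D] [Abelian D] [Linear k D] {D' : Type*} [Category* D'] [Abelian D']
  [Linear k D'] (H : D ⥤ D') [H.Additive] [H.Linear k] [PreservesFiniteLimits H]
  [PreservesFiniteColimits H] {F : Cᵒᵖ ⥤ C ⥤ D} [IsBilinear k F]

lemma exactAt_comp {n : ℕ} (h : (barComplex k P F).ExactAt n) :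
    (barComplex k P (F ⋙ (Functor.whiskeringRight _ _ _).obj H)).ExactAt n := by
  have h1 : ((H.mapHomologicalComplex _).obj (barComplex k P F)).ExactAt n := by
    rw [HomologicalComplex.exactAt_iff] at h ⊢
    exact h.map H
  exact h1.of_iso (asIso (barComparison k P F H)).symm

lemma exactAt_of_comp [H.Faithful] {n : ℕ}
    (h : (barComplex k P (F ⋙ (Functor.whiskeringRight _ _ _).obj H)).ExactAt n) :
    (barComplex k P F).ExactAt n := by
  have h1 : ((H.mapHomologicalComplex _).obj (barComplex k P F)).ExactAt n :=
    h.of_iso (asIso (barComparison k P F H))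
  rw [HomologicalComplex.exactAt_iff] at h1 ⊢
  exact (ShortComplex.exact_map_iff_of_faithful _ H).mp h1

end Transfer

/-! ### Exact functors on the Deligne product. -/

section DeligneProduct

open scoped ModuleCat

variable {k : Type u} [Field k] {C : Type w} [Category.{v} C] [Abelian C] [Linear k C]
  {A : Type u} [Ring A] [Algebra k A] [Module.Finite k A] (e : C ≌ FGModuleCat.{u} A)

variable (k) in
/-- The functor `X ↦ Hom_k(X, k)`. -/
def dualUnderlying : Cᵒᵖ ⥤ ModuleCat.{u} k where
  obj X := ModuleCat.of k (Module.Dual k (e.functor.obj X.unop).obj)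
  map f := ModuleCat.ofHom ((e.functor.map f.unop).hom.hom.restrictScalars k).dualMap
  map_id X := by
    rw [unop_id, e.functor.map_id]
    rfl
  map_comp f g := by
    rw [unop_comp, e.functor.map_comp]
    rfl

variable (k) in
/-- The functor `(X, Y) ↦ X ⊠ Y` on a category that is identified with the finite-dimensional
`A`-modules. -/
abbrev boxFunctor : Cᵒᵖ ⥤ C ⥤ DeligneProduct k A :=
  e.functor.op ⋙ box k ⋙ (Functor.whiskeringLeft _ _ _).obj e.functor

/-- The underlying vector space of `X ⊠ Y` is `Hom_k(X, k) ⊗ Y`. -/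
def boxFunctorIso : dualUnderlying k e ⋙ tensorUnderlying (e.functor ⋙ underlying k A) ≅
    boxFunctor k e ⋙ (Functor.whiskeringRight _ _ _).obj (underlying k (Aᵐᵒᵖ ⊗[k] A)) :=
  NatIso.ofComponents (fun X => NatIso.ofComponents (fun Y => LinearEquiv.toModuleIso
    { AddEquiv.refl (Module.Dual k (e.functor.obj X.unop).obj ⊗[k] (e.functor.obj Y).obj) with
      map_smul' := fun r x => (boxCarrier_smul k r _ _ x).symm })
    (fun _ => ModuleCat.hom_ext (TensorProduct.ext' fun _ _ => rfl)))
    (fun _ => NatTrans.ext (funext fun _ => ModuleCat.hom_ext (TensorProduct.ext' fun _ _ => rfl)))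

instance boxFunctor_isBilinear [e.functor.Additive] [e.functor.Linear k] :
    IsBilinear k (boxFunctor k e) :=
  ofDeligne_isBilinear k e (𝟭 _)

instance boxFunctor_preservesFiniteColimits (X : Cᵒᵖ) :
    PreservesFiniteColimits ((boxFunctor k e).obj X) := by
  have := isNoetherianRing_of_finite k A
  have := isNoetherianRing_of_finite k (Aᵐᵒᵖ ⊗[k] A)
  have h : PreservesFiniteColimits ((e.functor ⋙ underlying k A) ⋙
      tensorLeft ((dualUnderlying k e).obj X)) := comp_preservesFiniteColimits _ _
  have h1 : PreservesFiniteColimits ((boxFunctor k e).obj X ⋙ underlying k (Aᵐᵒᵖ ⊗[k] A)) :=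
    ⟨fun J _ _ => preservesColimitsOfShape_of_natIso
      (show (e.functor ⋙ underlying k A) ⋙ tensorLeft ((dualUnderlying k e).obj X) ≅ _ from
        (boxFunctorIso e).app X)⟩
  exact preservesFiniteColimits_of_reflects_of_preserves _ (underlying k (Aᵐᵒᵖ ⊗[k] A))

variable [∀ X Y : C, Module.Finite k (X ⟶ Y)] [e.functor.Additive] [e.functor.Linear k]

/-- The functor from `Aᵐᵒᵖ ⊗ A`-modules to vector spaces is exact and faithful, so acyclicity may be
tested on `Hom_k(X, k) ⊗ Y`, whose second factor is represented by the free module. -/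
lemma exactAt_succ_boxFunctor {ι : Type t} [Finite ι] {P : ι → C} (hP : IsProjectiveGenerating P)
    (n : ℕ) : (barComplex k P (boxFunctor k e)).ExactAt (n + 1) := by
  have := isNoetherianRing_of_finite k A
  have := isNoetherianRing_of_finite k (Aᵐᵒᵖ ⊗[k] A)
  obtain ⟨U, hU, -, hPU⟩ := hP.exists_generator
  obtain ⟨L, y, hL⟩ := exists_representing (k := k) e
  have hLP : InAdd P L := by
    have := projective_of_representing k e hL
    exact hP.inAdd L
  have hbil : IsBilinear k (dualUnderlying k e ⋙ tensorUnderlying (e.functor ⋙ underlying k A)) :=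
    IsBilinear.of_mono (boxFunctorIso e).hom
  have h1 := exactAt_succ_tensorUnderlying (e.functor ⋙ underlying k A) (V := dualUnderlying k e)
    hL hLP hU hPU n
  have h2 := h1.of_iso (barIso k P (boxFunctorIso e))
  exact exactAt_of_comp (underlying k (Aᵐᵒᵖ ⊗[k] A)) h2

/-- Exact functors on the Deligne product that preserve projectivity have a derived coend that
resolves the coend. -/
theorem resolvesCoend_ofDeligne {D : Type*} [Category* D] [Abelian D] [Linear k D]
    (F : DeligneProduct k A ⥤ D) [F.Additive] [F.Linear k] [PreservesFiniteLimits F]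
    [PreservesFiniteColimits F] (hF : ∀ X Y : C, Projective X → Projective Y →
      Projective (((ofDeligne k e F).obj (op X)).obj Y))
    {ι : Type t} [Finite ι] {P : ι → C} (hP : IsProjectiveGenerating P) :
    ResolvesCoend k P (ofDeligne k e F) := by
  have := isNoetherianRing_of_finite k (Aᵐᵒᵖ ⊗[k] A)
  have hcol : ∀ X, PreservesFiniteColimits ((ofDeligne k e F).obj X) := fun X =>
    inferInstanceAs (PreservesFiniteColimits ((boxFunctor k e).obj X ⋙ F))
  have hproj : ∀ i j, Projective (((ofDeligne k e F).obj (op (P i))).obj (P j)) :=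
    fun i j => hF _ _ (hP.projective i) (hP.projective j)
  refine resolvesCoend_of_exactAt hP fun n => ?_
  have h : (barComplex k P (boxFunctor k e ⋙ (Functor.whiskeringRight _ _ _).obj F)).ExactAt
    (n + 1) := exactAt_comp F (exactAt_succ_boxFunctor e hP n)
  exact h

end DeligneProduct

end DerivedCoend

end

noncomputable section

namespace DerivedCoend

/-! ### Fitting's lemma for finite-dimensional algebras. -/

section LocalEnd

/-- In a finite-dimensional algebra without nontrivial idempotents, `f` or `1 - f` is a unit. -/
lemma isUnit_or_isUnit_one_sub (k : Type*) [Field k] {E : Type*} [Ring E] [Algebra k E]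
    [Module.Finite k E] (h : ∀ e : E, e * e = e → e = 0 ∨ e = 1) (f : E) :
    IsUnit f ∨ IsUnit (1 - f) := by
  have hint : IsIntegral k f := Algebra.IsIntegral.isIntegral f
  -- The additional factor `X` makes the power `n` of `X` that splits off positive, even if `f` is
  -- invertible.
  have h0 : Polynomial.X * minpoly k f ≠ 0 :=
    mul_ne_zero Polynomial.X_ne_zero (minpoly.ne_zero hint)
  obtain ⟨q, hq, hq'⟩ := Polynomial.exists_eq_pow_rootMultiplicity_mul_and_not_dvd
    (Polynomial.X * minpoly k f) h0 0
  rw [map_zero, sub_zero] at hq hq'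
  set n := (Polynomial.X * minpoly k f).rootMultiplicity 0 with hn
  have hn0 : n ≠ 0 := fun h => hq' (by rw [h, pow_zero, one_mul] at hq; rw [← hq]; exact dvd_mul_right _ _)
  have hcop : IsCoprime (Polynomial.X ^ n) q :=
    ((Polynomial.prime_X (R := k)).coprime_iff_not_dvd.mpr hq').pow_left
  obtain ⟨u, v, huv⟩ := hcop
  have ha : Polynomial.aeval f (Polynomial.X ^ n * q) = 0 := by
    rw [← hq, map_mul, minpoly.aeval, mul_zero]
  have hs : Polynomial.aeval f (u * Polynomial.X ^ n) + Polynomial.aeval f (v * q) = 1 := by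
    rw [← map_add, huv, map_one]
  have hm : Polynomial.aeval f (u * Polynomial.X ^ n) * Polynomial.aeval f (v * q) = 0 := by
    rw [← map_mul, show u * Polynomial.X ^ n * (v * q) = (u * v) * (Polynomial.X ^ n * q) by ring,
      map_mul, ha, mul_zero]
  -- The Bézout relation between `X ^ n` and `q` gives two complementary idempotents in `f`. If the
  -- first is zero, then `f` is nilpotent; if it is one, then it exhibits an inverse of `f`, since
  -- `n` is positive.
  rcases h (Polynomial.aeval f (u * Polynomial.X ^ n)) (by
    conv_rhs => rw [← mul_one (Polynomial.aeval f (u * Polynomial.X ^ n)), ← hs, mul_add, hm,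
      add_zero]) with he | he
  · right
    refine IsNilpotent.isUnit_one_sub ⟨n, ?_⟩
    rw [he, zero_add] at hs
    rw [← mul_one (f ^ n), ← hs, map_mul, ← Polynomial.aeval_X_pow (R := k) f (n := n), ← map_mul, ← map_mul,
      show Polynomial.X ^ n * (v * q) = v * (Polynomial.X ^ n * q) by ring, map_mul, ha, mul_zero]
  · left
    obtain ⟨m, hm'⟩ := Nat.exists_eq_succ_of_ne_zero hn0
    rw [hm', Nat.succ_eq_add_one] at he
    refine ⟨⟨f, Polynomial.aeval f (u * Polynomial.X ^ m), ?_, ?_⟩, rfl⟩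
    · rw [← he, show u * Polynomial.X ^ (m + 1) = Polynomial.X * (u * Polynomial.X ^ m) by ring,
        map_mul (Polynomial.aeval f) Polynomial.X, Polynomial.aeval_X]
    · rw [← he, pow_succ, ← mul_assoc, map_mul (Polynomial.aeval f) _ Polynomial.X,
        Polynomial.aeval_X]

end LocalEnd

/-! ### Dimensions of spaces of morphisms. -/

section HomDim

variable (k : Type u) [Field k] {C : Type w} [Category.{v} C] [Abelian C] [Linear k C]

/-- The dimension of the space of morphisms. -/
def homDim (W X : C) : ℕ := Module.finrank k (W ⟶ X)

variable {k}

lemma homDim_congr_left {W W' : C} (e : W ≅ W') (X : C) : homDim k W X = homDim k W' X :=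
  (Linear.homCongr k e (Iso.refl X)).finrank_eq

lemma homDim_congr_right (W : C) {X X' : C} (e : X ≅ X') : homDim k W X = homDim k W X' :=
  (Linear.homCongr k (Iso.refl W) e).finrank_eq

variable [∀ X Y : C, Module.Finite k (X ⟶ Y)]

lemma homDim_pos {W X : C} (f : W ⟶ X) (hf : f ≠ 0) : 0 < homDim k W X :=
  have : Nontrivial (W ⟶ X) := ⟨f, 0, hf⟩
  Module.finrank_pos

lemma homDim_le_of_mono (W : C) {X Y : C} (f : X ⟶ Y) [Mono f] : homDim k W X ≤ homDim k W Y :=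
  LinearMap.finrank_le_finrank_of_injective (f := Linear.rightComp k W f)
    fun _ _ h => (cancel_mono f).mp h

lemma homDim_le_of_epi (W : C) [Projective W] {X Y : C} (f : X ⟶ Y) [Epi f] :
    homDim k W Y ≤ homDim k W X :=
  LinearMap.finrank_le_finrank_of_surjective (f := Linear.rightComp k W f)
    fun g => ⟨Projective.factorThru g f, Projective.factorThru_comp g f⟩

/-- Exactness in the middle suffices for the inequality. -/
lemma homDim_le_add (W : C) [Projective W] {S : ShortComplex C} (hS : S.Exact) :
    homDim k W S.X₂ ≤ homDim k W S.X₁ + homDim k W S.X₃ := by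
  have h1 := (Linear.rightComp k W S.g).finrank_range_add_finrank_ker
  have h2 : Module.finrank k (LinearMap.range (Linear.rightComp k W S.g)) ≤ homDim k W S.X₃ :=
    Submodule.finrank_le _
  have h3 : LinearMap.ker (Linear.rightComp k W S.g) ≤ LinearMap.range (Linear.rightComp k W S.f) :=
    fun x hx => by
      exact ⟨hS.liftFromProjective x hx, hS.liftFromProjective_comp x hx⟩
  have h4 := Submodule.finrank_mono h3
  have h5 := LinearMap.finrank_range_le (Linear.rightComp k W S.f)
  unfold homDim at *
  omega

lemma homDim_shortExact (W : C) [Projective W] {S : ShortComplex C} (hS : S.ShortExact) :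
    homDim k W S.X₂ = homDim k W S.X₁ + homDim k W S.X₃ := by
  refine le_antisymm (homDim_le_add W hS.exact) ?_
  have := hS.epi_g
  have := hS.mono_f
  have h1 := (Linear.rightComp k W S.g).finrank_range_add_finrank_ker
  have h2 : LinearMap.range (Linear.rightComp k W S.g) = ⊤ := LinearMap.range_eq_top.mpr
    fun g => ⟨Projective.factorThru g S.g, Projective.factorThru_comp g S.g⟩
  have h3 : LinearMap.range (Linear.rightComp k W S.f) ≤ LinearMap.ker (Linear.rightComp k W S.g) := by
    rintro _ ⟨x, rfl⟩
    change (x ≫ S.f) ≫ S.g = 0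
    rw [Category.assoc, S.zero, comp_zero]
  have h4 := Submodule.finrank_mono h3
  rw [LinearMap.finrank_range_of_inj (f := Linear.rightComp k W S.f) fun _ _ h => (cancel_mono S.f).mp h] at h4
  rw [h2, finrank_top] at h1
  unfold homDim
  omega

/-- The dimension of the space of morphisms out of a split object. -/
lemma homDim_split {W R R' : C} (i : R ⟶ W) (p : W ⟶ R) (i' : R' ⟶ W) (p' : W ⟶ R')
    (h : i ≫ p = 𝟙 R) (h' : i' ≫ p' = 𝟙 R') (hs : p ≫ i + p' ≫ i' = 𝟙 W) (X : C) :
    homDim k W X = homDim k R X + homDim k R' X := by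
  have h1 : i ≫ p' = 0 := by
    have := i ≫= hs
    rw [Preadditive.comp_add, reassoc_of% h, Category.comp_id] at this
    have h2 : (i ≫ p') ≫ i' = 0 := by simpa using this
    rw [← Category.comp_id (i ≫ p'), ← h', ← Category.assoc, h2, zero_comp]
  have h2 : i' ≫ p = 0 := by
    have := i' ≫= hs
    rw [Preadditive.comp_add, reassoc_of% h', Category.comp_id] at this
    have h2 : (i' ≫ p) ≫ i = 0 := by simpa using this
    rw [← Category.comp_id (i' ≫ p), ← h, ← Category.assoc, h2, zero_comp]
  unfold homDim
  rw [← Module.finrank_prod]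
  refine LinearEquiv.finrank_eq (LinearEquiv.ofLinearMap
    ((Linear.leftComp k X i).prod (Linear.leftComp k X i'))
    ((Linear.leftComp k X p).coprod (Linear.leftComp k X p')) ?_ ?_)
  · ext f <;> simp [reassoc_of% h, reassoc_of% h', reassoc_of% h1, reassoc_of% h2]
  · refine LinearMap.ext fun f => ?_
    change p ≫ i ≫ f + p' ≫ i' ≫ f = f
    rw [← Category.assoc, ← Category.assoc, ← Preadditive.add_comp, hs, Category.id_comp]

end HomDim

end DerivedCoend

end

noncomputable section

namespace DerivedCoend

attribute [local instance] Abelian.hasFiniteBiproducts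

/-! ### Decomposition into indecomposable objects. -/

section Indecomposable

/-- A nonzero object without nontrivial idempotent endomorphisms. -/
def IsIndecomposable {C : Type w} [Category.{v} C] [Preadditive C] (R : C) : Prop :=
  ¬ IsZero R ∧ ∀ e : R ⟶ R, e ≫ e = e → e = 0 ∨ e = 𝟙 R

lemma exists_isUnit_of_isUnit_sum {E : Type*} [Ring E] [IsLocalRing E] {β : Type*} (s : Finset β)
    (f : β → E) (h : IsUnit (∑ b ∈ s, f b)) : ∃ b ∈ s, IsUnit (f b) := by
  classical
  induction s using Finset.induction_on with
  | empty => exact absurd h (by simp)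
  | insert b s hb ih =>
    rw [Finset.sum_insert hb] at h
    rcases IsLocalRing.isUnit_or_isUnit_of_isUnit_add h with h | h
    · exact ⟨b, Finset.mem_insert_self _ _, h⟩
    · obtain ⟨c, hc, h⟩ := ih h
      exact ⟨c, Finset.mem_insert_of_mem hc, h⟩

variable {k : Type u} [Field k] {C : Type w} [Category.{v} C] [Abelian C] [Linear k C]

lemma InAdd.projective {ι : Type*} {P : ι → C} (hP : ∀ i, Projective (P i)) {X : C}
    (hX : InAdd P X) : Projective X := by
  obtain ⟨m, j, a, b, hab⟩ := hX
  refine ⟨fun f e _ => ⟨∑ s, a s ≫ Projective.factorThru (b s ≫ f) e, ?_⟩⟩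
  rw [Preadditive.sum_comp]
  simp only [Category.assoc, Projective.factorThru_comp]
  simp only [← Category.assoc]
  rw [← Preadditive.sum_comp, hab, Category.id_comp]

lemma IsIndecomposable.not_isZero {R : C} (h : IsIndecomposable R) : 𝟙 R ≠ 0 :=
  fun h' => h.1 ((IsZero.iff_id_eq_zero R).mpr h')

variable [∀ X Y : C, Module.Finite k (X ⟶ Y)]

include k in
lemma IsIndecomposable.isLocalRing_end {R : C} (h : IsIndecomposable R) : IsLocalRing (End R) := by
  have : Nontrivial (End R) := ⟨1, 0, h.not_isZero⟩
  have : Module.Finite k (End R) := inferInstanceAs (Module.Finite k (R ⟶ R))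
  exact IsLocalRing.of_isUnit_or_isUnit_one_sub_self
    (isUnit_or_isUnit_one_sub k fun e he => h.2 e he)

include k in
/-- Indecomposable summands of sums of indecomposable objects. -/
lemma IsIndecomposable.exists_iso {R : C} (h : IsIndecomposable R) {β : Type*} {R' : β → C}
    (h' : ∀ b, IsIndecomposable (R' b)) (hR : InAdd R' R) : ∃ b, Nonempty (R ≅ R' b) := by
  obtain ⟨m, j, a, b, hab⟩ := hR
  have := h.isLocalRing_end (k := k)
  -- The identity of `R` is a sum of endomorphisms through the objects `R' b`; in a local ring one
  -- of the summands must be invertible.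
  obtain ⟨s, -, hs⟩ := exists_isUnit_of_isUnit_sum (E := End R) Finset.univ
    (fun s => (a s ≫ b s : R ⟶ R)) 
      ((congrArg (IsUnit (M := End R)) hab).mpr isUnit_one)
  obtain ⟨c, -, hc⟩ := (isUnit_iff_exists (M := End R)).mp hs
  have hc' : a s ≫ b s ≫ c = 𝟙 R := (Category.assoc _ _ _).symm.trans hc
  refine ⟨j s, ⟨⟨a s, b s ≫ c, hc', ?_⟩⟩⟩
  have h1 := hc' =≫ a s
  rw [Category.assoc, Category.id_comp] at h1
  -- The other composite is an idempotent of an indecomposable object. It cannot be zero, since the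
  -- identity of `R` factors through it.
  rcases (h' (j s)).2 ((b s ≫ c) ≫ a s) (by simp only [Category.assoc] at h1 ⊢; rw [h1]) with h0 | h0
  · refine absurd ?_ h.not_isZero
    rw [← hc', ← Category.comp_id (a s ≫ b s ≫ c), ← hc']
    have : (a s ≫ b s ≫ c) ≫ a s ≫ b s ≫ c = a s ≫ ((b s ≫ c) ≫ a s) ≫ b s ≫ c := by simp
    rw [this, h0]
    simp
  · exact h0

/-- Objects of a hom-finite abelian category are finite direct sums of indecomposable objects. -/
lemma exists_indecomposable_decomposition (W : C) : ∃ (β : Type) (_ : Fintype β) (R : β → C),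
    (∀ b, IsIndecomposable (R b)) ∧ InAdd R W ∧ (∀ b, InAdd (fun _ : Unit => W) (R b)) ∧
      ∀ X : C, homDim k W X = ∑ b, homDim k (R b) X := by
  -- The induction is on the dimension of the endomorphism space, which is smaller for both parts of
  -- a proper splitting.
  induction hn : homDim k W W using Nat.strong_induction_on generalizing W with
  | _ n ih =>
    subst hn
    by_cases hW : IsZero W
    · refine ⟨Empty, inferInstance, Empty.elim, fun b => b.elim,
        ⟨0, Fin.elim0, fun s => s.elim0, fun s => s.elim0, hW.eq_of_src _ _⟩, fun b => b.elim,
        fun X => ?_⟩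
      have : Subsingleton (W ⟶ X) := ⟨hW.eq_of_src⟩
      rw [Finset.univ_eq_empty, Finset.sum_empty]
      exact Module.finrank_zero_of_subsingleton
    by_cases hI : IsIndecomposable W
    · exact ⟨Unit, inferInstance, fun _ => W, fun _ => hI, InAdd.single (P := fun _ : Unit => W) (),
        InAdd.single (P := fun _ : Unit => W), fun X => by simp⟩
    obtain ⟨e, he, he0, he1⟩ : ∃ e : W ⟶ W, e ≫ e = e ∧ e ≠ 0 ∧ e ≠ 𝟙 W := by
      by_contra! H
      exact hI ⟨hW, fun e he => or_iff_not_imp_left.mpr (H e he)⟩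
    obtain ⟨Y, i, p, hip, hpi⟩ := IsIdempotentComplete.idempotents_split W e he
    obtain ⟨Y', i', p', hip', hpi'⟩ := IsIdempotentComplete.idempotents_split W (𝟙 W - e) (by simp [he])
    have hs : p ≫ i + p' ≫ i' = 𝟙 W := by rw [hpi, hpi', add_sub_cancel]
    have hs' : p' ≫ i' + p ≫ i = 𝟙 W := by rw [add_comm, hs]
    have hi : i ≠ 0 := fun h => he0 (by rw [← hpi, h, comp_zero])
    have hi' : i' ≠ 0 := fun h => he1 (by rw [h, comp_zero, eq_comm, sub_eq_zero] at hpi'; exact hpi'.symm)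
    have hd := homDim_split (k := k) i p i' p' hip hip' hs W
    have hm : Mono i := (SplitMono.mk p hip).mono
    have hm' : Mono i' := (SplitMono.mk p' hip').mono
    have h1 := homDim_le_of_mono (k := k) Y i
    have h1' := homDim_le_of_mono (k := k) Y' i'
    have h2 := homDim_pos (k := k) i hi
    have h2' := homDim_pos (k := k) i' hi'
    obtain ⟨β, _, R, hR, hWR, hRW, hdim⟩ := ih _ (by omega) Y rfl
    obtain ⟨β', _, R', hR', hWR', hRW', hdim'⟩ := ih _ (by omega) Y' rfl
    have hY : InAdd (fun _ : Unit => W) Y :=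
      (InAdd.single (P := fun _ : Unit => W) ()).of_retract i p hip
    have hY' : InAdd (fun _ : Unit => W) Y' :=
      (InAdd.single (P := fun _ : Unit => W) ()).of_retract i' p' hip'
    refine ⟨β ⊕ β', inferInstance, Sum.elim R R', ?_, ?_, ?_, fun X => ?_⟩
    · rintro (b | b)
      exacts [hR b, hR' b]
    · have hWb : InAdd (fun b : Bool => cond b Y Y') W :=
        InAdd.of_fintype (P := fun b : Bool => cond b Y Y') (β := Bool) id
          (fun b => by cases b; exacts [p', p]) (fun b => by cases b; exacts [i', i]) (by simpa using hs)
      refine hWb.trans fun b => ?_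
      cases b
      · exact hWR'.trans fun b => InAdd.single (P := Sum.elim R R') (Sum.inr b)
      · exact hWR.trans fun b => InAdd.single (P := Sum.elim R R') (Sum.inl b)
    · rintro (b | b)
      exacts [(hRW b).trans fun _ => hY, (hRW' b).trans fun _ => hY']
    · rw [homDim_split i p i' p' hip hip' hs, hdim, hdim', Fintype.sum_sum_type]
      rfl

lemma homDim_biproduct {β : Type*} [Fintype β] (f : β → C) (X : C) :
    homDim k (⨁ f) X = ∑ b, homDim k (f b) X := by
  unfold homDim
  rw [← Module.finrank_pi_fintype]
  exact LinearEquiv.finrank_eq (LinearEquiv.ofLinearMap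
    (LinearMap.pi fun b => Linear.leftComp k X (biproduct.ι f b))
    { toFun := fun g => biproduct.desc g
      map_add' := fun g g' => biproduct.hom_ext' _ _ fun b => by simp
      map_smul' := fun r g => biproduct.hom_ext' _ _ fun b => by simp }
    (LinearMap.ext fun g => funext fun b => by simp)
    (LinearMap.ext fun g => biproduct.hom_ext' _ _ fun b => by simp))

/-- A summand of a finite direct sum of copies of `W` has a complement. -/
lemma InAdd.exists_complement {W R : C} (h : InAdd (fun _ : Unit => W) R) :
    ∃ (m : ℕ) (R' : C), InAdd (fun _ : Unit => W) R' ∧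
      ∀ X, m * homDim k W X = homDim k R X + homDim k R' X := by
  obtain ⟨m, j, a, b, hab⟩ := h
  let i : R ⟶ ⨁ fun _ : Fin m => W := biproduct.lift a
  let p : (⨁ fun _ : Fin m => W) ⟶ R := biproduct.desc b
  have hip : i ≫ p = 𝟙 R := (biproduct.lift_desc).trans hab
  obtain ⟨Y', i', p', hip', hpi'⟩ := IsIdempotentComplete.idempotents_split _ (𝟙 _ - p ≫ i)
    (by simp [reassoc_of% hip])
  refine ⟨m, Y', ((InAdd.biproduct (P := fun _ : Unit => W) j)).of_retract i' p' hip', fun X => ?_⟩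
  rw [← homDim_split i p i' p' hip hip' (by rw [hpi', add_sub_cancel]), homDim_biproduct]
  simp

end Indecomposable

/-! ### Dimension functions of projective objects. -/

section Generators

variable {k : Type u} [Field k] {C : Type w} [Category.{v} C] [Abelian C] [Linear k C]
  [∀ X Y : C, Module.Finite k (X ⟶ Y)]

variable (k) in
/-- The dimensions of the spaces of morphisms out of projective objects are nonnegative combinations
of those for finitely many projective objects. -/
lemma exists_projective_basis {U : C} [Projective U]
    (hU : ∀ X : C, Projective X → InAdd (fun _ : Unit => U) X) :
    ∃ (β : Type) (_ : Fintype β) (R : β → C), (∀ b, ¬ IsZero (R b)) ∧ (∀ b, Projective (R b)) ∧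
      InAdd R U ∧ ∀ W : C, Projective W → ∃ c : β → ℕ, ∀ X : C,
        homDim k W X = ∑ b, c b * homDim k (R b) X := by
  classical
  obtain ⟨β, _, R, hR, hUR, hRU, -⟩ := exists_indecomposable_decomposition (k := k) U
  have hUp : ∀ _ : Unit, Projective U := fun _ => inferInstance
  refine ⟨β, ‹_›, R, fun b => (hR b).1, fun b => (hRU b).projective hUp, hUR, fun W hW => ?_⟩
  obtain ⟨γ, _, S, hS, -, hSW, hdim⟩ := exists_indecomposable_decomposition (k := k) W
  -- Each indecomposable summand of `W` is isomorphic to some `R b`. As the `R b` may repeat, `r` is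
  -- a choice, and the coefficient of `b` counts the summands assigned to it.
  choose r hr using fun c => (hS c).exists_iso (k := k) hR
    ((hSW c).trans fun _ => (hU W hW).trans fun _ => hUR)
  refine ⟨fun b => (Finset.univ.filter fun c => r c = b).card, fun X => ?_⟩
  rw [hdim, Finset.sum_congr rfl fun c _ => homDim_congr_left (k := k) (hr c).some X,
    ← Finset.sum_fiberwise_of_maps_to (t := Finset.univ) (g := r) (fun _ _ => Finset.mem_univ _)]
  refine Finset.sum_congr rfl fun b _ => ?_
  rw [Finset.sum_congr rfl (g := fun _ => homDim k (R b) X)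
    (fun c hc => by rw [(Finset.mem_filter.mp hc).2]), Finset.sum_const, smul_eq_mul]

/-- Projective objects with nonzero morphisms to all nonzero objects are generators. -/
lemma inAdd_of_homDim_ne_zero {W : C} [Projective W]
    (h : ∀ X : C, ¬ IsZero X → homDim k W X ≠ 0) (X : C) [Projective X] :
    InAdd (fun _ : Unit => W) X := by
  let f : (⨁ fun _ : Fin (Module.finrank k (W ⟶ X)) => W) ⟶ X :=
    biproduct.desc fun s => Module.finBasis k (W ⟶ X) s
  -- All morphisms from `W` to `X` factor through `f`. Morphisms from the projective `W` to the
  -- cokernel lift to `X`, hence vanish, so the cokernel is zero by hypothesis.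
  have hf : Epi f := by
    by_contra hf
    have hz : ¬ IsZero (cokernel f) := fun hz =>
      hf (Preadditive.epi_of_cokernel_zero (hz.eq_of_tgt _ _))
    refine h _ hz ?_
    have : Subsingleton (W ⟶ cokernel f) := subsingleton_of_forall_eq 0 fun g => by
      rw [← Projective.factorThru_comp g (cokernel.π f)]
      generalize Projective.factorThru g (cokernel.π f) = g'
      rw [← (Module.finBasis k (W ⟶ X)).sum_repr g', Preadditive.sum_comp]
      refine Finset.sum_eq_zero fun s _ => ?_
      have : biproduct.ι (fun _ => W) s ≫ f = Module.finBasis k (W ⟶ X) s := biproduct.ι_desc _ _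
      rw [Linear.smul_comp, ← this, Category.assoc, cokernel.condition, comp_zero, smul_zero]
    exact Module.finrank_zero_of_subsingleton
  exact (InAdd.biproduct (P := fun _ : Unit => W) fun _ => ()).of_retract
    (Projective.factorThru (𝟙 X) f) f (Projective.factorThru_comp _ _)

/-- Because the `R b` may repeat, the multiplicities in a decomposition of `W` can be zero. Each `R
b` is however a summand of `m b` copies of `W`, and averaging the resulting expressions makes every
coefficient positive. -/
lemma exists_pos_combination {β : Type*} [Fintype β] {R : β → C} (hR : ∀ b, Projective (R b))
    (hc : ∀ W : C, Projective W → ∃ c : β → ℕ, ∀ X : C,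
        homDim k W X = ∑ b, c b * homDim k (R b) X) {W : C} [Projective W]
    (h : ∀ X : C, ¬ IsZero X → homDim k W X ≠ 0) :
    ∃ a : β → ℝ, (∀ b, 0 < a b) ∧ ∀ X : C, (homDim k W X : ℝ) = ∑ b, a b * homDim k (R b) X := by
  classical
  choose m R' hR' hm using fun b => (inAdd_of_homDim_ne_zero h (R b)).exists_complement (k := k)
  choose c hc' using fun b => hc (R' b) ((hR' b).projective fun _ => inferInstance)
  obtain ⟨c₀, hc₀⟩ := hc W inferInstance
  -- Here `N` copies of `W` are decomposed: one by `c₀`, and `m b` copies as `R b` plus its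
  -- complement. Each `R b` then occurs at least once.
  let N : ℝ := 1 + ∑ b, (m b : ℝ)
  have hN : 0 < N := by positivity
  refine ⟨fun b => (1 + c₀ b + ∑ b', (c b' b : ℝ)) / N, fun b => by positivity, fun X => ?_⟩
  have h1 : N * (homDim k W X : ℝ) = ∑ b, (1 + c₀ b + ∑ b', (c b' b : ℝ)) * homDim k (R b) X := by
    have h2 : ∀ b, (m b : ℝ) * homDim k W X =
        homDim k (R b) X + ∑ b', (c b b' : ℝ) * homDim k (R b') X := fun b => by
      have := hm b X
      rw [hc'] at this
      exact_mod_cast this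
    have h3 : (homDim k W X : ℝ) = ∑ b, (c₀ b : ℝ) * homDim k (R b) X := by exact_mod_cast hc₀ X
    simp only [add_mul, Finset.sum_add_distrib, Finset.sum_mul, one_mul, N]
    rw [Finset.sum_congr rfl fun b _ => h2 b, Finset.sum_add_distrib,
      Finset.sum_comm (f := fun b b' => (c b b' : ℝ) * homDim k (R b') X), ← h3]
    ring
  rw [← mul_right_inj' hN.ne', h1, Finset.mul_sum]
  refine Finset.sum_congr rfl fun b _ => ?_
  field_simp

end Generators

end DerivedCoend

end

noncomputable section

namespace DerivedCoend

/-! ### The Perron–Frobenius theorem for positive matrices. -/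

section PerronFrobenius

open Finset

variable {β : Type*} [Fintype β]

/-- A matrix with positive entries has a positive eigenvector. -/
lemma exists_pos_eigenvector [Nonempty β] (a : β → β → ℝ) (ha : ∀ i j, 0 < a i j) :
    ∃ (x : β → ℝ) (c : ℝ), (∀ j, 0 < x j) ∧ 0 < c ∧ ∀ l, ∑ j, x j * a j l = c * x l := by
  classical
  -- This is the Collatz–Wielandt argument: a pair with the largest possible second entry turns out
  -- to be an eigenvector with its eigenvalue.
  let S : Set ((β → ℝ) × ℝ) := {p | p.1 ∈ stdSimplex ℝ β ∧ 0 ≤ p.2 ∧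
    ∀ l, p.2 * p.1 l ≤ ∑ j, p.1 j * a j l}
  let B : ℝ := ∑ j, ∑ l, a j l
  have hsum : ∀ y : β → ℝ, ∀ c : ℝ, (∀ l, c * y l ≤ ∑ j, y j * a j l) → ∑ l, y l = 1 →
      (∀ l, 0 ≤ y l) → c ≤ B := by
    intro y c h h1 h0
    have h2 : ∑ l, c * y l ≤ ∑ l, ∑ j, y j * a j l := sum_le_sum fun l _ => h l
    rw [← mul_sum, h1, mul_one] at h2
    refine h2.trans ?_
    rw [sum_comm]
    refine sum_le_sum fun j _ => sum_le_sum fun l _ => ?_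
    have : y j ≤ 1 := h1 ▸ single_le_sum (fun i _ => h0 i) (mem_univ j)
    nlinarith [ha j l]
  have hS : IsCompact S := by
    have h : IsClosed ({p | ∀ l, p.2 * p.1 l ≤ ∑ j, p.1 j * a j l} :
        Set ((β → ℝ) × ℝ)) := by
      rw [Set.ofPred_forall]
      exact isClosed_iInter fun l => isClosed_le (by fun_prop) (by fun_prop)
    refine ((isCompact_stdSimplex ℝ β).prod (isCompact_Icc (a := 0) (b := B))).of_isClosed_subset
      ?_ fun p hp => ⟨hp.1, hp.2.1, hsum p.1 p.2 hp.2.2 hp.1.2 hp.1.1⟩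
    refine ((isClosed_stdSimplex ℝ β).preimage continuous_fst).inter
      ((isClosed_le continuous_const continuous_snd).inter h)
  obtain ⟨b₀⟩ := ‹Nonempty β›
  have hne : S.Nonempty := ⟨(Pi.single b₀ 1, 0), single_mem_stdSimplex ℝ b₀, le_rfl, fun l => by
    rw [zero_mul]
    exact sum_nonneg fun j _ => mul_nonneg ((single_mem_stdSimplex ℝ b₀).1 j) (ha j l).le⟩
  obtain ⟨⟨x, c⟩, ⟨hx, hc, hxc⟩, hmax⟩ := hS.exists_isMaxOn hne continuous_snd.continuousOn
  have hypos : ∀ z : β → ℝ, (∀ j, 0 ≤ z j) → z ≠ 0 → ∀ l, 0 < ∑ j, z j * a j l := by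
    intro z hz hz0 l
    obtain ⟨j, hj⟩ := Function.ne_iff.mp hz0
    exact sum_pos' (fun i _ => mul_nonneg (hz i) (ha i l).le)
      ⟨j, mem_univ j, mul_pos ((hz j).lt_of_ne' hj) (ha j l)⟩
  have hx0 : x ≠ 0 := fun h => by simpa [h] using hx.2
  let y : β → ℝ := fun l => ∑ j, x j * a j l
  have hy : ∀ l, 0 < y l := hypos x hx.1 hx0
  have hyc : ∀ l, y l = c * x l := by
    by_contra! H
    -- If `x` is not an eigenvector, one more application of the matrix makes all inequalities
    -- strict, so that `y`, after normalization, admits the larger value `c + ε`.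
    let z : β → ℝ := fun l => y l - c * x l
    have hz : ∀ l, 0 ≤ z l := fun l => sub_nonneg.mpr (hxc l)
    have hz0 : z ≠ 0 := fun h => by
      obtain ⟨l, hl⟩ := H
      exact hl (sub_eq_zero.mp (congrFun h l))
    have hw := hypos z hz hz0
    have hwy : ∀ l, ∑ j, z j * a j l = ∑ j, y j * a j l - c * y l := fun l => by
      simp only [z, sub_mul, sum_sub_distrib]
      congr 1
      rw [mul_sum]
      exact sum_congr rfl fun j _ => by ring
    obtain ⟨l₀, -, hl₀⟩ := exists_min_image univ (fun l => (∑ j, z j * a j l) / y l) ⟨b₀, mem_univ _⟩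
    let ε := (∑ j, z j * a j l₀) / y l₀
    have hε : 0 < ε := div_pos (hw l₀) (hy l₀)
    have hle : ∀ l, (c + ε) * y l ≤ ∑ j, y j * a j l := fun l => by
      have h1 := hl₀ l (mem_univ l)
      rw [le_div_iff₀ (hy l), hwy l] at h1
      change ε * y l ≤ _ at h1
      linarith
    let s := ∑ l, y l
    have hs : 0 < s := sum_pos (fun l _ => hy l) ⟨b₀, mem_univ _⟩
    have hmem : ((fun l => y l / s, c + ε) : (β → ℝ) × ℝ) ∈ S := by
      refine ⟨⟨fun l => (div_pos (hy l) hs).le, ?_⟩, by positivity, fun l => ?_⟩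
      · change ∑ l, y l / s = 1
        rw [← sum_div, div_self hs.ne']
      · change (c + ε) * (y l / s) ≤ ∑ j, y j / s * a j l
        rw [mul_div_assoc', sum_congr rfl fun j _ => div_mul_eq_mul_div (y j) s (a j l), ← sum_div]
        exact div_le_div_of_nonneg_right (hle l) hs.le
    have := hmax hmem
    change c + ε ≤ c at this
    linarith
  have hcx : ∀ l, 0 < c * x l := fun l => hyc l ▸ hy l
  have hc0 : 0 < c := hc.lt_of_ne fun h => by
    have := hcx b₀
    rw [show c = 0 from h.symm, zero_mul] at this
    exact lt_irrefl _ this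
  exact ⟨x, c, fun l => (mul_pos_iff_of_pos_left hc0).mp (hcx l), hc0, hyc⟩

end PerronFrobenius

end DerivedCoend

end

noncomputable section

namespace DerivedCoend

/-! ### Exactness, projectivity and nonvanishing in rigid categories with simple unit. -/

section Rigid

variable {k : Type u} [Field k] {C : Type w} [Category.{v} C] [Abelian C] [Linear k C]

lemma exists_ne_zero_of_homDim_ne_zero {W X : C} (h : homDim k W X ≠ 0) : ∃ f : W ⟶ X, f ≠ 0 := by
  by_contra! H
  have : Subsingleton (W ⟶ X) := subsingleton_of_forall_eq 0 H
  exact h Module.finrank_zero_of_subsingleton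

lemma homDim_adj {D : Type*} [Category* D] [Abelian D] [Linear k D] {F : C ⥤ D} {G : D ⥤ C}
    (adj : F ⊣ G) [G.Additive] [G.Linear k] (W : C) (X : D) :
    homDim k (F.obj W) X = homDim k W (G.obj X) :=
  LinearEquiv.finrank_eq
    { adj.homEquiv W X with
      map_add' := fun f g => by
        change adj.homEquiv W X (f + g) = adj.homEquiv W X f + adj.homEquiv W X g
        rw [adj.homEquiv_unit, adj.homEquiv_unit, adj.homEquiv_unit, G.map_add, Preadditive.comp_add]
      map_smul' := fun r f => by
        change adj.homEquiv W X (r • f) = r • adj.homEquiv W X f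
        rw [adj.homEquiv_unit, adj.homEquiv_unit, G.map_smul, Linear.comp_smul] }

/-- Left exactness of the functor of morphisms out of an object. -/
lemma homDim_le_add_of_mono [∀ X Y : C, Module.Finite k (X ⟶ Y)] (W : C) {S : ShortComplex C}
    (hS : S.Exact) [Mono S.f] : homDim k W S.X₂ ≤ homDim k W S.X₁ + homDim k W S.X₃ := by
  have h1 := (Linear.rightComp k W S.g).finrank_range_add_finrank_ker
  have h2 : Module.finrank k (LinearMap.range (Linear.rightComp k W S.g)) ≤ homDim k W S.X₃ :=
    Submodule.finrank_le _
  have h3 : LinearMap.ker (Linear.rightComp k W S.g) ≤ LinearMap.range (Linear.rightComp k W S.f) :=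
    fun x hx => ⟨hS.lift x hx, hS.lift_f x hx⟩
  have h4 := Submodule.finrank_mono h3
  have h5 := LinearMap.finrank_range_le (Linear.rightComp k W S.f)
  unfold homDim at *
  omega

variable [MonoidalCategory C] [RigidCategory C]

/-- The left and right duals give tensoring adjoints on both sides; hence it is exact in each
variable and preserves projective objects. -/
instance tensorRight_isLeftAdjoint (Z : C) : (tensorRight Z).IsLeftAdjoint :=
  (tensorRightAdjunction Z Zᘁ).isLeftAdjoint

instance tensorRight_isRightAdjoint (Z : C) : (tensorRight Z).IsRightAdjoint :=
  (tensorRightAdjunction (ᘁZ) Z).isRightAdjoint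

instance tensorLeft_isLeftAdjoint (Z : C) : (tensorLeft Z).IsLeftAdjoint :=
  (tensorLeftAdjunction (ᘁZ) Z).isLeftAdjoint

instance tensorLeft_isRightAdjoint (Z : C) : (tensorLeft Z).IsRightAdjoint :=
  (tensorLeftAdjunction Z Zᘁ).isRightAdjoint

instance mono_whiskerRight {X Y : C} (f : X ⟶ Y) [Mono f] (Z : C) : Mono (f ▷ Z) :=
  inferInstanceAs (Mono ((tensorRight Z).map f))

instance epi_whiskerRight {X Y : C} (f : X ⟶ Y) [Epi f] (Z : C) : Epi (f ▷ Z) :=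
  inferInstanceAs (Epi ((tensorRight Z).map f))

instance epi_whiskerLeft {X Y : C} (f : X ⟶ Y) [Epi f] (Z : C) : Epi (Z ◁ f) :=
  inferInstanceAs (Epi ((tensorLeft Z).map f))

lemma projective_tensor_left (Y Z : C) [Projective Y] : Projective (Y ⊗ Z) :=
  (tensorRightAdjunction Z Zᘁ).map_projective Y inferInstance

lemma projective_tensor_right (Y Z : C) [Projective Z] : Projective (Y ⊗ Z) :=
  (tensorLeftAdjunction (ᘁY) Y).map_projective Z inferInstance

variable [MonoidalPreadditive C] [MonoidalLinear k C]

lemma homDim_tensorRight (W X Z : C) : homDim k W (X ⊗ Z) = homDim k (W ⊗ ᘁZ) X :=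
  (homDim_adj (k := k) (tensorRightAdjunction (ᘁZ) Z) W X).symm

lemma homDim_tensorLeft (W X Z : C) : homDim k W (Z ⊗ X) = homDim k (Zᘁ ⊗ W) X :=
  (homDim_adj (k := k) (tensorLeftAdjunction Z Zᘁ) W X).symm

lemma homDim_tensorRight_rightDual (W X Z : C) : homDim k W (X ⊗ Zᘁ) = homDim k (W ⊗ Z) X :=
  (homDim_adj (k := k) (tensorRightAdjunction Z Zᘁ) W X).symm

/-- Moving `U^∨ ⊗ U` to the source turns the dimensions for `X ⊗ Q` into dimensions of morphisms out
of an object that is projective if `U` is, for every `W`, even the unit. -/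
lemma homDim_tensor_dual_self (W X U : C) :
    homDim k W (X ⊗ (Uᘁ ⊗ U)) = homDim k ((W ⊗ ᘁU) ⊗ U) X := by
  rw [homDim_congr_right W (α_ X Uᘁ U).symm, homDim_tensorRight, homDim_tensorRight_rightDual]

include k in
lemma coevaluation_ne_zero {X : C} (hX : ¬ IsZero X) : η_ X Xᘁ ≠ 0 := by
  intro h
  refine hX ((IsZero.iff_id_eq_zero X).mpr ((dualityMap_bijective k X X).1 ?_))
  rw [map_zero]
  change η_ X Xᘁ ≫ 𝟙 X ▷ Xᘁ = 0
  rw [h, zero_comp]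

lemma evaluation_ne_zero {X : C} (hX : ¬ IsZero X) : ε_ X Xᘁ ≠ 0 := by
  intro h
  refine hX ((IsZero.iff_id_eq_zero X).mpr ?_)
  have h1 := ExactPairing.evaluation_coevaluation X Xᘁ
  rw [h, MonoidalPreadditive.whiskerLeft_zero, comp_zero, comp_zero] at h1
  have h2 : 𝟙 X = (λ_ X).inv ≫ ((λ_ X).hom ≫ (ρ_ X).inv) ≫ (ρ_ X).hom := by simp
  rw [h2, ← h1, zero_comp, comp_zero]

variable [Simple (𝟙_ C)]

/-- The evaluation is a nonzero map to a simple object, hence epi, so `Y` is a quotient of `X^∨ ⊗ X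
⊗ Y`. -/
lemma isZero_of_isZero_tensor {X Y : C} (hX : ¬ IsZero X) (h : IsZero (X ⊗ Y)) : IsZero Y := by
  have h1 : Epi (ε_ X Xᘁ) := epi_of_nonzero_to_simple (evaluation_ne_zero hX)
  have h2 : IsZero (Xᘁ ⊗ (X ⊗ Y)) := (tensorLeft (Xᘁ)).map_isZero h
  have h3 : IsZero ((Xᘁ ⊗ X) ⊗ Y) := h2.of_iso (α_ _ _ _)
  have h4 : IsZero (𝟙_ C ⊗ Y) := IsZero.of_epi (ε_ X Xᘁ ▷ Y) h3
  exact h4.of_iso (λ_ Y).symm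

include k in
lemma exists_mono_unit {U X : C} (f : U ⟶ X) (hf : f ≠ 0) : ∃ g : 𝟙_ C ⟶ X ⊗ Uᘁ, Mono g := by
  refine ⟨dualityMap k U X f, mono_of_nonzero_from_simple fun h => hf ?_⟩
  exact (dualityMap_bijective k U X).1 (h.trans (map_zero _).symm)

lemma homDim_dual_self_ne_zero {U : C} (hU : ∀ X : C, ¬ IsZero X → homDim k U X ≠ 0)
    {X : C} (hX : ¬ IsZero X) : homDim k (Uᘁ ⊗ U) X ≠ 0 := by
  rw [← homDim_tensorLeft]
  refine hU _ fun h => hX (isZero_of_isZero_tensor (fun hz => ?_) h)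
  exact hU (𝟙_ C) (Simple.not_isZero _) (by
    have : Subsingleton (U ⟶ 𝟙_ C) := ⟨hz.eq_of_src⟩
    exact Module.finrank_zero_of_subsingleton)

variable [∀ X Y : C, Module.Finite k (X ⟶ Y)]

/-- Tensoring with `U^∨ ⊗ U` produces enough morphisms, if `U` is a generator. -/
lemma homDim_tensor_dual_self_ne_zero {U : C} (hU : ∀ X : C, ¬ IsZero X → homDim k U X ≠ 0)
    {W : C} (f : W ⟶ U) (hf : f ≠ 0) {X : C} (hX : ¬ IsZero X) :
    homDim k ((W ⊗ ᘁU) ⊗ U) X ≠ 0 := by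
  obtain ⟨h, hh⟩ := exists_ne_zero_of_homDim_ne_zero (hU X hX)
  obtain ⟨g, hg⟩ := exists_mono_unit (k := k) h hh
  rw [← homDim_tensor_dual_self, homDim_congr_right W (α_ X Uᘁ U).symm]
  -- A nonzero morphism from `U` to `X` embeds the unit into `X ⊗ U^∨`, hence `U` into `X ⊗ U^∨ ⊗
  -- U`; composing with `f` stays nonzero.
  refine (homDim_pos (k := k) (f ≫ (λ_ U).inv ≫ g ▷ U) fun h0 => hf ?_).ne'
  exact (cancel_mono ((λ_ U).inv ≫ g ▷ U)).mp (h0.trans zero_comp.symm)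

end Rigid

/-! ### Weighted dimension functions. -/

section Weighted

variable (k : Type u) [Field k] {C : Type w} [Category.{v} C] [Abelian C] [Linear k C]
  {β : Type} [Fintype β] (R : β → C) (x : β → ℝ)

/-- A weighted sum of dimensions of spaces of morphisms out of the objects of a family. -/
def wdim (X : C) : ℝ := ∑ b, x b * homDim k (R b) X

variable {k R x}

lemma wdim_congr {X X' : C} (e : X ≅ X') : wdim k R x X = wdim k R x X' :=
  Finset.sum_congr rfl fun b _ => by rw [homDim_congr_right _ e]

lemma wdim_nonneg (hx : ∀ b, 0 < x b) (X : C) : 0 ≤ wdim k R x X :=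
  Finset.sum_nonneg fun b _ => mul_nonneg (hx b).le (Nat.cast_nonneg _)

lemma mul_homDim_le_wdim (hx : ∀ b, 0 < x b) (b : β) (X : C) :
    x b * homDim k (R b) X ≤ wdim k R x X :=
  Finset.single_le_sum (f := fun b => x b * (homDim k (R b) X : ℝ))
    (fun b _ => mul_nonneg (hx b).le (Nat.cast_nonneg _)) (Finset.mem_univ b)

lemma isZero_of_wdim_le (hx : ∀ b, 0 < x b)
    (hR : ∀ X : C, ¬ IsZero X → ∃ b, homDim k (R b) X ≠ 0) {X : C} (h : wdim k R x X ≤ 0) :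
    IsZero X := by
  by_contra hX
  obtain ⟨b, hb⟩ := hR X hX
  have := mul_homDim_le_wdim (k := k) (R := R) hx b X
  have := mul_pos (hx b) (Nat.cast_pos.mpr (Nat.pos_of_ne_zero hb))
  linarith

/-- Nonnegative combinations of the dimensions are bounded by the weighted dimension. -/
lemma exists_homDim_le_wdim (hx : ∀ b, 0 < x b) {W : C} {c : β → ℕ}
    (hc : ∀ X : C, homDim k W X = ∑ b, c b * homDim k (R b) X) :
    ∃ B : ℝ, 0 ≤ B ∧ ∀ X, (homDim k W X : ℝ) ≤ B * wdim k R x X := by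
  refine ⟨∑ b, c b / x b, Finset.sum_nonneg fun b _ => by have := hx b; positivity, fun X => ?_⟩
  rw [hc, Finset.sum_mul]
  push_cast
  refine Finset.sum_le_sum fun b _ => ?_
  have h1 : (c b : ℝ) * homDim k (R b) X = c b / x b * (x b * homDim k (R b) X) := by
    have := (hx b).ne'
    field_simp
  rw [h1]
  exact mul_le_mul_of_nonneg_left (mul_homDim_le_wdim hx b X) (by have := hx b; positivity)

lemma exists_wdim_le_homDim (hx : ∀ b, 0 < x b) {W : C} {a : β → ℝ} (ha : ∀ b, 0 < a b)
    (h : ∀ X : C, (homDim k W X : ℝ) = ∑ b, a b * homDim k (R b) X) :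
    ∃ c : ℝ, 0 < c ∧ ∀ X, c * wdim k R x X ≤ homDim k W X := by
  have hB : 0 < 1 + ∑ b, x b / a b :=
    add_pos_of_pos_of_nonneg one_pos (Finset.sum_nonneg fun b _ => (div_pos (hx b) (ha b)).le)
  refine ⟨(1 + ∑ b, x b / a b)⁻¹, inv_pos.mpr hB, fun X => ?_⟩
  rw [inv_mul_le_iff₀ hB, add_mul, one_mul, Finset.sum_mul]
  have hle : wdim k R x X ≤ ∑ b, x b / a b * (homDim k W X : ℝ) := by
    refine Finset.sum_le_sum fun b _ => ?_
    have h1 : x b * homDim k (R b) X = x b / a b * (a b * homDim k (R b) X) := by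
      have := (ha b).ne'
      field_simp
    rw [h1, h]
    refine mul_le_mul_of_nonneg_left ?_ (div_pos (hx b) (ha b)).le
    exact Finset.single_le_sum (f := fun b => a b * (homDim k (R b) X : ℝ))
      (fun b _ => mul_nonneg (ha b).le (Nat.cast_nonneg _)) (Finset.mem_univ b)
  have : (0 : ℝ) ≤ homDim k W X := Nat.cast_nonneg _
  linarith

variable [∀ X Y : C, Module.Finite k (X ⟶ Y)]

lemma wdim_shortExact [∀ b, Projective (R b)] {S : ShortComplex C} (hS : S.ShortExact) :
    wdim k R x S.X₂ = wdim k R x S.X₁ + wdim k R x S.X₃ := by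
  unfold wdim
  rw [← Finset.sum_add_distrib]
  refine Finset.sum_congr rfl fun b _ => ?_
  rw [homDim_shortExact _ hS]
  push_cast
  ring

lemma wdim_le_of_epi [∀ b, Projective (R b)] (hx : ∀ b, 0 < x b) {X Y : C} (f : X ⟶ Y) [Epi f] :
    wdim k R x Y ≤ wdim k R x X :=
  Finset.sum_le_sum fun b _ => mul_le_mul_of_nonneg_left
    (Nat.cast_le.mpr (homDim_le_of_epi (R b) f)) (hx b).le

end Weighted

end DerivedCoend

end

noncomputable section

namespace DerivedCoend

attribute [local instance] Abelian.hasFiniteBiproducts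

/-! ### Generators detect nonzero objects. -/

section Generator

variable {k : Type u} [Field k] {C : Type w} [Category.{v} C] [Abelian C] [Linear k C]
  [∀ X Y : C, Module.Finite k (X ⟶ Y)]

lemma InAdd.exists_comp_ne_zero {ι : Type*} {P : ι → C} {X Y Z : C} (hX : InAdd P X) (f : Y ⟶ X)
    (g : X ⟶ Z) (h : f ≫ g ≠ 0) : ∃ i, (∃ b : P i ⟶ X, b ≫ g ≠ 0) ∧ ∃ a : X ⟶ P i, f ≫ a ≠ 0 := by
  obtain ⟨m, j, a, b, hab⟩ := hX
  by_contra! H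
  refine h ?_
  rw [← Category.id_comp g, ← hab, Preadditive.sum_comp, Preadditive.comp_sum]
  refine Finset.sum_eq_zero fun s _ => ?_
  by_cases hs : b s ≫ g = 0
  · rw [Category.assoc, hs, comp_zero, comp_zero]
  · rw [Category.assoc, ← Category.assoc, H (j s) ⟨b s, hs⟩ (a s), zero_comp]

lemma IsProjectiveGenerating.homDim_ne_zero {ι : Type t} {P : ι → C}
    (hP : IsProjectiveGenerating P) {U : C} (hU : ∀ i, InAdd (fun _ : Unit => U) (P i)) (X : C)
    (hX : ¬ IsZero X) : homDim k U X ≠ 0 := by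
  obtain ⟨n, j, g, hg⟩ := hP.exists_epi X
  have h0 : 𝟙 _ ≫ biproduct.desc g ≠ 0 := fun h => hX (by
    rw [Category.id_comp] at h
    refine (IsZero.iff_id_eq_zero X).mpr ?_
    rw [← cancel_epi (biproduct.desc g), h, zero_comp, zero_comp])
  obtain ⟨-, ⟨b, hb⟩, -⟩ := ((InAdd.biproduct j).trans hU).exists_comp_ne_zero _ _ h0
  exact (homDim_pos _ hb).ne'

end Generator

/-! ### A dimension function that is multiplicative for one generator. -/

section Perron

variable (k : Type u) [Field k] {C : Type w} [Category.{v} C] [Abelian C] [Linear k C]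
  [MonoidalCategory C]

/-- A dimension function on the objects of a tensor category that is multiplicative for the tensor
product with `Q`, as a combination of the dimensions of spaces of morphisms out of projective
objects. -/
structure PerronData (Q : C) where
  /-- The index set of the projective objects. -/
  β : Type
  fintype : Fintype β
  /-- The projective objects. -/
  R : β → C
  /-- The coefficients. -/
  x : β → ℝ
  /-- The eigenvalue. -/
  eig : ℝ
  pos : ∀ b, 0 < x b
  eig_pos : 0 < eig
  projective : ∀ b, Projective (R b)
  inAdd : ∀ X : C, Projective X → InAdd R X
  generating : ∀ X : C, ¬ IsZero X → ∃ b, homDim k (R b) X ≠ 0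
  wdim_tensor : ∀ X, wdim k R x (X ⊗ Q) = eig * wdim k R x X
  homDim_le : ∀ W : C, Projective W → ∃ B : ℝ, 0 ≤ B ∧ ∀ X, (homDim k W X : ℝ) ≤ B * wdim k R x X
  le_homDim : ∃ c : ℝ, 0 < c ∧ ∀ X, c * wdim k R x X ≤ homDim k (𝟙_ C) (X ⊗ Q)

attribute [instance] PerronData.fintype

variable {k}

namespace PerronData

variable {Q : C} (p : PerronData k Q)

/-- The dimension function. -/
def dim (X : C) : ℝ := wdim k p.R p.x X

lemma dim_nonneg (X : C) : 0 ≤ p.dim X := wdim_nonneg p.pos X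

lemma isZero {X : C} (h : p.dim X ≤ 0) : IsZero X := isZero_of_wdim_le p.pos p.generating h

lemma dim_pos {X : C} (h : ¬ IsZero X) : 0 < p.dim X := by
  by_contra! H
  exact h (p.isZero H)

lemma dim_unit_pos [Simple (𝟙_ C)] : 0 < p.dim (𝟙_ C) := p.dim_pos (Simple.not_isZero _)

lemma dim_congr {X X' : C} (e : X ≅ X') : p.dim X = p.dim X' := wdim_congr e

lemma dim_shortExact [∀ X Y : C, Module.Finite k (X ⟶ Y)] {S : ShortComplex C}
    (hS : S.ShortExact) : p.dim S.X₂ = p.dim S.X₁ + p.dim S.X₃ :=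
  have := p.projective
  wdim_shortExact hS

lemma dim_le_of_epi [∀ X Y : C, Module.Finite k (X ⟶ Y)] {X Y : C} (f : X ⟶ Y) [Epi f] :
    p.dim Y ≤ p.dim X :=
  have := p.projective
  wdim_le_of_epi p.pos f

/-- The multiplicity of the unit object as a subobject. -/
lemma homDim_unit_mul_le [∀ X Y : C, Module.Finite k (X ⟶ Y)] [Simple (𝟙_ C)] (Y : C) :
    (homDim k (𝟙_ C) Y : ℝ) * p.dim (𝟙_ C) ≤ homDim k (𝟙_ C) (𝟙_ C) * p.dim Y := by
  -- Split off one copy of the simple unit: it contributes its full value to `dim`, and at most the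
  -- dimension of `End(𝟙)` to the morphisms out of the unit.
  induction hn : ∑ b, homDim k (p.R b) Y using Nat.strong_induction_on generalizing Y with
  | _ n ih =>
    subst hn
    by_cases h0 : homDim k (𝟙_ C) Y = 0
    · rw [h0, Nat.cast_zero, zero_mul]
      exact mul_nonneg (Nat.cast_nonneg _) (p.dim_nonneg Y)
    obtain ⟨f, hf⟩ := exists_ne_zero_of_homDim_ne_zero h0
    have : Mono f := mono_of_nonzero_from_simple hf
    have hS : (ShortComplex.mk f (cokernel.π f) (cokernel.condition f)).ShortExact :=
      { exact := ShortComplex.exact_cokernel f }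
    have h1 : homDim k (𝟙_ C) Y ≤ homDim k (𝟙_ C) (𝟙_ C) + homDim k (𝟙_ C) (cokernel f) :=
      homDim_le_add_of_mono (k := k) (𝟙_ C) hS.exact
    have h2 := p.dim_shortExact hS
    dsimp only at h2
    obtain ⟨b, hb⟩ := p.generating (𝟙_ C) (Simple.not_isZero _)
    have h3 : ∀ b, homDim k (p.R b) Y = homDim k (p.R b) (𝟙_ C) + homDim k (p.R b) (cokernel f) :=
      fun b => have := p.projective b; homDim_shortExact _ hS
    have h3' : ∑ b, homDim k (p.R b) (cokernel f) < ∑ b, homDim k (p.R b) Y := by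
      refine Finset.sum_lt_sum (fun b _ => ?_) ⟨b, Finset.mem_univ b, ?_⟩
      · rw [h3 b]
        exact Nat.le_add_left _ _
      · rw [h3 b]
        exact Nat.lt_add_of_pos_left (Nat.pos_of_ne_zero hb)
    have h4 := ih _ h3' (cokernel f) rfl
    have h5 : (homDim k (𝟙_ C) Y : ℝ) ≤ homDim k (𝟙_ C) (𝟙_ C) + homDim k (𝟙_ C) (cokernel f) := by
      exact_mod_cast h1
    rw [h2]
    nlinarith [p.dim_unit_pos]

end PerronData

variable [∀ X Y : C, Module.Finite k (X ⟶ Y)] [RigidCategory C] [MonoidalPreadditive C]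
  [MonoidalLinear k C] [Simple (𝟙_ C)]

/-- Tensoring with `U^∨ ⊗ U` acts on the functions `homDim (R b)` by a matrix with positive entries.
A positive eigenvector of this matrix gives the weights. -/
theorem nonempty_perronData {U : C} [Projective U]
    (hU : ∀ X : C, Projective X → InAdd (fun _ : Unit => U) X)
    (hU' : ∀ X : C, ¬ IsZero X → homDim k U X ≠ 0) : Nonempty (PerronData k (Uᘁ ⊗ U)) := by
  obtain ⟨β, _, R, hR0, hR, hUR, hc⟩ := exists_projective_basis k hU
  have hgen : ∀ X : C, ¬ IsZero X → ∃ b, homDim k (R b) X ≠ 0 := fun X hX => by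
    obtain ⟨f, hf⟩ := exists_ne_zero_of_homDim_ne_zero (hU' X hX)
    obtain ⟨b, ⟨g, hg⟩, -⟩ := hUR.exists_comp_ne_zero (𝟙 U) f (by rwa [Category.id_comp])
    exact ⟨b, (homDim_pos _ hg).ne'⟩
  have hne : Nonempty β := by
    obtain ⟨b, -⟩ := hgen (𝟙_ C) (Simple.not_isZero _)
    exact ⟨b⟩
  -- A nonzero morphism to `U` is what makes the corresponding row of the matrix positive; the unit
  -- needs one as well, for the bound `le_homDim`.
  have hto : ∀ b, ∃ f : R b ⟶ U, f ≠ 0 := fun b => by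
    obtain ⟨-, -, f, hf⟩ := (hU (R b) (hR b)).exists_comp_ne_zero (𝟙 (R b)) (𝟙 (R b))
      (by rw [Category.id_comp]; exact fun h => hR0 b ((IsZero.iff_id_eq_zero _).mpr h))
    exact ⟨f, by simpa using hf⟩
  have hto1 : ∃ f : 𝟙_ C ⟶ U, f ≠ 0 := by
    have hUz : ¬ IsZero U := fun hz => hU' (𝟙_ C) (Simple.not_isZero _) (by
      have : Subsingleton (U ⟶ 𝟙_ C) := ⟨hz.eq_of_src⟩
      exact Module.finrank_zero_of_subsingleton)
    -- The unit maps by the coevaluation to the projective object `U ⊗ U^∨`, which is a summand of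
    -- copies of `U`.
    obtain ⟨-, -, f, hf⟩ := (hU (U ⊗ Uᘁ) (projective_tensor_left U _)).exists_comp_ne_zero (η_ U Uᘁ) (𝟙 _)
      (by rw [Category.comp_id]; exact coevaluation_ne_zero (k := k) hUz)
    exact ⟨_, hf⟩
  have hp : ∀ W : C, Projective ((W ⊗ ᘁU) ⊗ U) := fun W => projective_tensor_right _ _
  choose a ha ha' using fun b => exists_pos_combination hR hc (W := (R b ⊗ ᘁU) ⊗ U)
    fun X hX => by
      obtain ⟨f, hf⟩ := hto b
      exact homDim_tensor_dual_self_ne_zero hU' f hf hX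
  obtain ⟨x, c, hx, hc0, hxc⟩ := exists_pos_eigenvector a ha
  obtain ⟨a₁, ha₁, ha₁'⟩ := exists_pos_combination hR hc (W := (𝟙_ C ⊗ ᘁU) ⊗ U)
    fun X hX => by
      obtain ⟨f, hf⟩ := hto1
      exact homDim_tensor_dual_self_ne_zero hU' f hf hX
  refine ⟨⟨β, ‹_›, R, x, c, hx, hc0, hR, fun X hX => (hU X hX).trans fun _ => hUR, hgen,
    fun X => ?_, fun W hW => ?_, ?_⟩⟩
  · unfold wdim
    rw [Finset.mul_sum]
    have h1 : ∀ b, x b * (homDim k (R b) (X ⊗ (Uᘁ ⊗ U)) : ℝ) =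
        ∑ b', x b * a b b' * homDim k (R b') X := fun b => by
      rw [homDim_tensor_dual_self, ha', Finset.mul_sum]
      exact Finset.sum_congr rfl fun b' _ => by ring
    rw [Finset.sum_congr rfl fun b _ => h1 b, Finset.sum_comm]
    refine Finset.sum_congr rfl fun b' _ => ?_
    rw [← Finset.sum_mul, hxc]
    ring
  · obtain ⟨n, hn⟩ := hc W hW
    exact exists_homDim_le_wdim hx hn
  · obtain ⟨c', hc', h⟩ := exists_wdim_le_homDim hx ha₁ ha₁'
    exact ⟨c', hc', fun X => by rw [homDim_tensor_dual_self]; exact h X⟩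

end Perron

end DerivedCoend

end

noncomputable section

namespace DerivedCoend

attribute [local instance] Abelian.hasFiniteBiproducts

/-! ### Functors `M` for which `Y ⊗ M(X)` is bilinear. -/

section Bilinear

variable (k : Type u) [Field k] {C : Type w} [Category.{v} C] [Abelian C] [Linear k C]
  [MonoidalCategory C] [MonoidalPreadditive C] [MonoidalLinear k C]

omit [MonoidalLinear k C] in
include k in
-- Evaluating at the unit object recovers `M` itself.
lemma map_add_of_isBilinear {M : Cᵒᵖ ⥤ C} [h : IsBilinear k (M ⋙ tensoringRight C)] {X Y : C}
    (f g : X ⟶ Y) : M.map (f + g).op = M.map f.op + M.map g.op := by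
  have h1 : 𝟙_ C ◁ M.map (f + g).op = 𝟙_ C ◁ M.map f.op + 𝟙_ C ◁ M.map g.op :=
    h.map_add_left f g (𝟙_ C)
  rwa [← MonoidalPreadditive.whiskerLeft_add, whiskerLeft_iff] at h1

lemma map_smul_of_isBilinear {M : Cᵒᵖ ⥤ C} [h : IsBilinear k (M ⋙ tensoringRight C)] {X Y : C}
    (r : k) (f : X ⟶ Y) : M.map (r • f).op = r • M.map f.op := by
  have h1 : 𝟙_ C ◁ M.map (r • f).op = r • 𝟙_ C ◁ M.map f.op := h.map_smul_left r f (𝟙_ C)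
  rwa [← MonoidalLinear.whiskerLeft_smul, whiskerLeft_iff] at h1

variable {k} in
lemma isBilinear_tensoringRight {M : Cᵒᵖ ⥤ C}
    (h : ∀ {X Y : C} (f g : X ⟶ Y), M.map (f + g).op = M.map f.op + M.map g.op)
    (h' : ∀ {X Y : C} (r : k) (f : X ⟶ Y), M.map (r • f).op = r • M.map f.op) :
    IsBilinear k (M ⋙ tensoringRight C) where
  map_add_left f g Y :=
    (congrArg (Y ◁ ·) (h f g)).trans (MonoidalPreadditive.whiskerLeft_add _ _)
  map_smul_left r f Y := (congrArg (Y ◁ ·) (h' r f)).trans (MonoidalLinear.whiskerLeft_smul _ _ _)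
  map_add_right _ _ _ _ _ := MonoidalPreadditive.add_whiskerRight _ _
  map_smul_right _ _ _ _ _ := MonoidalLinear.smul_whiskerRight _ _ _

instance isBilinear_comp_tensoringRight (M : Cᵒᵖ ⥤ C) [IsBilinear k (M ⋙ tensoringRight C)]
    (G : C ⥤ C) [G.Additive] [G.Linear k] : IsBilinear k ((M ⋙ G) ⋙ tensoringRight C) :=
  isBilinear_tensoringRight
    (fun f g => (congrArg G.map (map_add_of_isBilinear k f g)).trans G.map_add)
    (fun r f => (congrArg G.map (map_smul_of_isBilinear k r f)).trans (G.map_smul _ _))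

omit [MonoidalLinear k C] in
include k in
lemma map_sum_of_isBilinear {M : Cᵒᵖ ⥤ C} [IsBilinear k (M ⋙ tensoringRight C)] {β : Type*}
    (s : Finset β) {X Y : C} (f : β → (X ⟶ Y)) :
    M.map (∑ b ∈ s, f b).op = ∑ b ∈ s, M.map (f b).op :=
  map_sum (AddMonoidHom.mk' (fun g : X ⟶ Y => M.map g.op) (map_add_of_isBilinear k)) f s

end Bilinear

/-! ### The coend of `X ⊗ M(X)`: functoriality and right exactness. -/

section TensorCoend

variable (k : Type u) [Field k] {C : Type w} [Category.{v} C] [Abelian C] [Linear k C]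
  [MonoidalCategory C] [∀ X Y : C, Module.Finite k (X ⟶ Y)] {ι : Type t} [Finite ι] (P : ι → C)
  (M : Cᵒᵖ ⥤ C) [IsBilinear k (M ⋙ tensoringRight C)]

/-- The coend `∫^X X ⊗ M(X)` over the family `P`. -/
def tensorCoend : C := coendObj k P (M ⋙ tensoringRight C)

/-- The structure maps of the coend. -/
def tensorCoendι (i : ι) : P i ⊗ M.obj (op (P i)) ⟶ tensorCoend k P M :=
  coendι k P (M ⋙ tensoringRight C) i

variable {P M}

lemma tensorCoend_hom_ext {Z : C} {g h : tensorCoend k P M ⟶ Z}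
    (H : ∀ i, tensorCoendι k P M i ≫ g = tensorCoendι k P M i ≫ h) : g = h :=
  coendObj_hom_ext k H

lemma tensorCoendι_dinatural {i j : ι} (f : P i ⟶ P j) :
    P i ◁ M.map f.op ≫ tensorCoendι k P M i = f ▷ M.obj (op (P j)) ≫ tensorCoendι k P M j :=
  coendι_dinatural k P (M ⋙ tensoringRight C) f

variable {k}

lemma exists_tensorCoend_desc {Z : C} (τ : ∀ i, P i ⊗ M.obj (op (P i)) ⟶ Z)
    (hτ : ∀ ⦃i j⦄ (f : P i ⟶ P j), P i ◁ M.map f.op ≫ τ i = f ▷ M.obj (op (P j)) ≫ τ j) :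
    ∃ g : tensorCoend k P M ⟶ Z, ∀ i, tensorCoendι k P M i ≫ g = τ i :=
  ⟨coendDesc (F := M ⋙ tensoringRight C) k τ hτ, coendι_desc (F := M ⋙ tensoringRight C) k τ hτ⟩

variable {M' M'' : Cᵒᵖ ⥤ C} [IsBilinear k (M' ⋙ tensoringRight C)]
  [IsBilinear k (M'' ⋙ tensoringRight C)]

variable (k P) in
/-- The morphism of coends induced by a natural transformation. -/
def tensorCoendMap (α : M ⟶ M') : tensorCoend k P M ⟶ tensorCoend k P M' :=
  coendObjMap k P (Functor.whiskerRight α (tensoringRight C))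

lemma tensorCoendι_map (α : M ⟶ M') (i : ι) : tensorCoendι k P M i ≫ tensorCoendMap k P α =
    P i ◁ α.app (op (P i)) ≫ tensorCoendι k P M' i :=
  coendι_map k (Functor.whiskerRight α (tensoringRight C)) i

lemma tensorCoendι_map_assoc (α : M ⟶ M') (i : ι) {Z : C} (h : tensorCoend k P M' ⟶ Z) :
    tensorCoendι k P M i ≫ tensorCoendMap k P α ≫ h =
      P i ◁ α.app (op (P i)) ≫ tensorCoendι k P M' i ≫ h :=
  (reassoc_of% (tensorCoendι_map (k := k) (P := P) α i)) h

lemma tensorCoendMap_comp (α : M ⟶ M') (β : M' ⟶ M'') :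
    tensorCoendMap k P α ≫ tensorCoendMap k P β = tensorCoendMap k P (α ≫ β) := by
  refine tensorCoend_hom_ext k fun i => ?_
  rw [tensorCoendι_map_assoc, tensorCoendι_map, tensorCoendι_map, NatTrans.comp_app,
    MonoidalCategory.whiskerLeft_comp, Category.assoc]

lemma tensorCoendMap_id : tensorCoendMap k P (𝟙 M) = 𝟙 _ :=
  tensorCoend_hom_ext k fun i => by
    rw [tensorCoendι_map, NatTrans.id_app, MonoidalCategory.whiskerLeft_id, Category.id_comp,
      Category.comp_id]

lemma exists_tensorCoend_leg {R : C} (hR : InAdd P R) : ∃ ω : R ⊗ M.obj (op R) ⟶ tensorCoend k P M,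
    ∀ (i : ι) (f : R ⟶ P i),
      R ◁ M.map f.op ≫ ω = f ▷ M.obj (op (P i)) ≫ tensorCoendι k P M i := by
  have hd := coendι_dinatural k P (M ⋙ tensoringRight C)
  obtain ⟨ω, hω⟩ := hR.exists_leg (k := k) hd
  exact ⟨ω, fun i f => hω.dinatural (hd.isLeg i) (hR.jointlyEpi (k := k) (P i)) f⟩

lemma epi_tensorCoendMap (α : M ⟶ M') [∀ i, Epi (α.app (op (P i)))] [RigidCategory C] :
    Epi (tensorCoendMap k P α) := by
  refine ⟨fun g h e => tensorCoend_hom_ext k fun i => ?_⟩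
  rw [← cancel_epi (P i ◁ α.app (op (P i))), ← tensorCoendι_map_assoc, e, tensorCoendι_map_assoc]

variable [RigidCategory C]

/-- The coend of `X ⊗ M(X) ⊗ Q` maps onto the tensor product of `Q` and the coend of `X ⊗ M(X)`. -/
lemma exists_epi_tensorCoend [MonoidalPreadditive C] [MonoidalLinear k C] (Q : C) :
    ∃ f : tensorCoend k P (M ⋙ tensorRight Q) ⟶ tensorCoend k P M ⊗ Q, Epi f := by
  obtain ⟨f, hf⟩ := exists_tensorCoend_desc (k := k) (P := P) (M := M ⋙ tensorRight Q)
    (fun i => (α_ (P i) (M.obj (op (P i))) Q).inv ≫ tensorCoendι k P M i ▷ Q) fun i j f => by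
      change P i ◁ (M.map f.op ▷ Q) ≫ _ = f ▷ (M.obj (op (P j)) ⊗ Q) ≫ _
      rw [associator_inv_naturality_left_assoc, ← comp_whiskerRight, ← tensorCoendι_dinatural,
        comp_whiskerRight, associator_inv_naturality_middle_assoc]
  refine ⟨f, ⟨fun {Z} g h e => ?_⟩⟩
  -- Morphisms out of the coend tensored with `Q` correspond to morphisms from the coend into an
  -- object tensored with `Q^∨`, and these are determined by the structure maps.
  let adj := tensorRightAdjunction Q Qᘁ
  refine (adj.homEquiv _ _).injective (tensorCoend_hom_ext k fun i => ?_)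
  rw [← adj.homEquiv_naturality_left, ← adj.homEquiv_naturality_left]
  congr 1
  have := tensorCoendι k P (M ⋙ tensorRight Q) i ≫= e
  rw [← Category.assoc, ← Category.assoc, hf, Category.assoc, Category.assoc] at this
  exact (cancel_epi _).mp this

/-- The kernel of the morphism of coends that is induced by an epimorphism. -/
lemma exact_tensorCoendMap (α : M ⟶ M') [∀ i, Epi (α.app (op (P i)))] {B : C} (ψ : B ⟶ tensorCoend k P M)
    (w : ψ ≫ tensorCoendMap k P α = 0)
    (H : ∀ {Z : C} (u : tensorCoend k P M ⟶ Z), ψ ≫ u = 0 → ∀ i,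
      ∃ u' : P i ⊗ M'.obj (op (P i)) ⟶ Z, P i ◁ α.app (op (P i)) ≫ u' = tensorCoendι k P M i ≫ u) :
    (ShortComplex.mk ψ (tensorCoendMap k P α) w).Exact := by
  have H' : ∀ {Z : C} (u : tensorCoend k P M ⟶ Z), ψ ≫ u = 0 →
      ∃ u' : tensorCoend k P M' ⟶ Z, tensorCoendMap k P α ≫ u' = u := fun {Z} u hu => by
    choose u' hu' using H u hu
    -- The componentwise factorizations are automatically dinatural, since the epimorphisms induced
    -- by `α` can be cancelled.
    obtain ⟨g, hg⟩ := exists_tensorCoend_desc (k := k) u' fun i j f => by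
      rw [← cancel_epi (P i ◁ α.app (op (P j))), ← MonoidalCategory.whiskerLeft_comp_assoc,
        ← α.naturality, MonoidalCategory.whiskerLeft_comp_assoc, hu', whisker_exchange_assoc, hu',
        ← Category.assoc, ← Category.assoc, tensorCoendι_dinatural]
    refine ⟨g, tensorCoend_hom_ext k fun i => ?_⟩
    rw [tensorCoendι_map_assoc, hg, hu']
  have := epi_tensorCoendMap (k := k) (P := P) α
  refine ShortComplex.exact_of_g_is_cokernel _ (CokernelCofork.IsColimit.ofπ _ _
    (fun u hu => (H' u hu).choose) (fun u hu => (H' u hu).choose_spec) fun u hu g hg => ?_)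
  rw [← cancel_epi (tensorCoendMap k P α)]
  exact hg.trans (H' u hu).choose_spec.symm

end TensorCoend

/-! ### The quotient by the part generated by the unit object. -/

section Socle

variable (k : Type u) [Field k] {C : Type w} [Category.{v} C] [Abelian C] [Linear k C]
  [MonoidalCategory C] [∀ X Y : C, Module.Finite k (X ⟶ Y)]

/-- The morphism from a sum of copies of the unit object given by a basis of the space of morphisms
from the unit object. -/
def socle (Y : C) : (⨁ fun _ : Fin (Module.finrank k (𝟙_ C ⟶ Y)) => 𝟙_ C) ⟶ Y :=
  biproduct.desc (Module.finBasis k (𝟙_ C ⟶ Y))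

variable {k}

lemma socle_comp_eq_zero_iff {Y Z : C} (u : Y ⟶ Z) :
    socle k Y ≫ u = 0 ↔ ∀ f : 𝟙_ C ⟶ Y, f ≫ u = 0 := by
  refine ⟨fun h f => ?_, fun h => biproduct.hom_ext' _ _ fun s => ?_⟩
  · have h1 : Linear.rightComp k (𝟙_ C) u = 0 := (Module.finBasis k (𝟙_ C ⟶ Y)).ext fun s => by
      have := biproduct.ι (fun _ : Fin (Module.finrank k (𝟙_ C ⟶ Y)) => 𝟙_ C) s ≫= h
      rwa [socle, biproduct.ι_desc_assoc, comp_zero] at this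
    exact LinearMap.congr_fun h1 f
  · rw [socle, biproduct.ι_desc_assoc, h, comp_zero]

lemma comp_cokernel_socle {Y : C} (f : 𝟙_ C ⟶ Y) : f ≫ cokernel.π (socle k Y) = 0 :=
  (socle_comp_eq_zero_iff _).mp (cokernel.condition _) f

variable (k C) in
/-- The quotient of an object by the sum of the images of the morphisms from the unit object. -/
def unitQuotient : C ⥤ C where
  obj Y := cokernel (socle k Y)
  map {Y Y'} f := cokernel.desc _ (f ≫ cokernel.π (socle k Y'))
    ((socle_comp_eq_zero_iff _).mpr fun g => by rw [← Category.assoc, comp_cokernel_socle])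
  map_id Y := by rw [← cancel_epi (cokernel.π (socle k Y))]; simp
  map_comp {Y _ _} _ _ := by rw [← cancel_epi (cokernel.π (socle k Y))]; simp

variable (k C) in
/-- The quotient map. -/
def toUnitQuotient : 𝟭 C ⟶ unitQuotient k C where
  app Y := cokernel.π (socle k Y)
  naturality _ _ _ := (cokernel.π_desc _ _ _).symm

instance (Y : C) : Epi ((toUnitQuotient k C).app Y) :=
  inferInstanceAs (Epi (cokernel.π (socle k Y)))

lemma toUnitQuotient_map {Y Y' : C} (f : Y ⟶ Y') : (toUnitQuotient k C).app Y ≫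
    (unitQuotient k C).map f = f ≫ (toUnitQuotient k C).app Y' :=
  ((toUnitQuotient k C).naturality f).symm

instance : (unitQuotient k C).Additive where
  map_add {Y _ _ _} := by
    rw [← cancel_epi ((toUnitQuotient k C).app Y), Preadditive.comp_add, toUnitQuotient_map,
      toUnitQuotient_map, toUnitQuotient_map, Preadditive.add_comp]

instance : (unitQuotient k C).Linear k where
  map_smul {Y _} _ _ := by
    rw [← cancel_epi ((toUnitQuotient k C).app Y), Linear.comp_smul, toUnitQuotient_map,
      toUnitQuotient_map, Linear.smul_comp]

/-- All morphisms from the unit to `Y` land in the kernel of the quotient map. The estimate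
`homDim_unit_mul_le` applies to this kernel, and `dim` is additive. -/
lemma homDim_add_dim_unitQuotient_le {Q : C} (p : PerronData k Q) [Simple (𝟙_ C)] (Y : C) :
    (homDim k (𝟙_ C) Y : ℝ) * p.dim (𝟙_ C) +
      homDim k (𝟙_ C) (𝟙_ C) * p.dim ((unitQuotient k C).obj Y) ≤
        homDim k (𝟙_ C) (𝟙_ C) * p.dim Y := by
  let q := (toUnitQuotient k C).app Y
  have hS : (ShortComplex.mk (kernel.ι q) q (kernel.condition q)).ShortExact :=
    { exact := ShortComplex.exact_kernel q
      epi_g := inferInstanceAs (Epi ((toUnitQuotient k C).app Y)) }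
  have h1 := p.dim_shortExact hS
  dsimp only at h1
  have h2 := p.homDim_unit_mul_le (kernel q)
  have h3 : homDim k (𝟙_ C) Y ≤ homDim k (𝟙_ C) (kernel q) :=
    LinearMap.finrank_le_finrank_of_surjective (f := Linear.rightComp k (𝟙_ C) (kernel.ι q))
      fun f => ⟨kernel.lift q f (comp_cokernel_socle f), kernel.lift_ι _ _ _⟩
  have h4 : (homDim k (𝟙_ C) Y : ℝ) ≤ homDim k (𝟙_ C) (kernel q) := by exact_mod_cast h3
  have h5 := mul_le_mul_of_nonneg_right h4 (p.dim_nonneg (𝟙_ C))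
  have h6 : p.dim Y = p.dim (kernel q) + p.dim ((unitQuotient k C).obj Y) := h1
  rw [h6]
  linarith

end Socle

end DerivedCoend

end

noncomputable section

namespace DerivedCoend

attribute [local instance] Abelian.hasFiniteBiproducts

lemma homDim_biproduct_right {k : Type u} [Field k] {C : Type w} [Category.{v} C] [Abelian C]
    [Linear k C] [∀ X Y : C, Module.Finite k (X ⟶ Y)] {β : Type*} [Fintype β] (W : C) (f : β → C) :
    homDim k W (⨁ f) ≤ ∑ b, homDim k W (f b) := by
  unfold homDim
  rw [← Module.finrank_pi_fintype]
  refine LinearMap.finrank_le_finrank_of_injective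
    (f := LinearMap.pi fun b => Linear.rightComp k W (biproduct.π f b)) fun x y h => ?_
  exact biproduct.hom_ext _ _ fun b => congrFun h b

/-! ### The bound for the dimension of the coend. -/

section Bound

variable {k : Type u} [Field k] {C : Type w} [Category.{v} C] [Abelian C] [Linear k C]
  [MonoidalCategory C] [MonoidalPreadditive C] [MonoidalLinear k C] [RigidCategory C]
  [∀ X Y : C, Module.Finite k (X ⟶ Y)] {ι : Type t} [Finite ι] {P : ι → C}

omit [MonoidalLinear k C] [RigidCategory C] in
lemma whiskerLeft_socle_comp (X : C) {Y Z : C} (u : X ⊗ Y ⟶ Z)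
    (h : ∀ s, X ◁ Module.finBasis k (𝟙_ C ⟶ Y) s ≫ u = 0) : X ◁ socle k Y ≫ u = 0 := by
  rw [socle, biproduct.desc_eq, whiskerLeft_sum, Preadditive.sum_comp]
  refine Finset.sum_eq_zero fun s _ => ?_
  rw [MonoidalCategory.whiskerLeft_comp, Category.assoc, h, comp_zero]

omit [MonoidalLinear k C] in
lemma exists_whiskerLeft_toUnitQuotient_comp (X : C) {Y Z : C} (u : X ⊗ Y ⟶ Z)
    (h : ∀ s, X ◁ Module.finBasis k (𝟙_ C ⟶ Y) s ≫ u = 0) :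
    ∃ u' : X ⊗ (unitQuotient k C).obj Y ⟶ Z, X ◁ (toUnitQuotient k C).app Y ≫ u' = u := by
  have hex := (ShortComplex.exact_cokernel (socle k Y)).map_of_epi_of_preservesCokernel
    (tensorLeft X) inferInstance inferInstance
  have hepi : Epi ((tensorLeft X).map (cokernel.π (socle k Y))) := inferInstance
  exact ⟨@ShortComplex.Exact.desc _ _ _ _ _ hex _ u (whiskerLeft_socle_comp X u h) hepi,
    @ShortComplex.Exact.g_desc _ _ _ _ _ hex _ u (whiskerLeft_socle_comp X u h) hepi⟩

/-- The kernel of the map to the coend of the quotient functor is generated by copies of the objects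
`P i`, one for each basis element of `C(𝟙, M(P i))`. By dinaturality, a morphism from `R` into it
comes from an element of `C(𝟙, M(R))`. -/
lemma homDim_tensorCoend_le (M : Cᵒᵖ ⥤ C) [IsBilinear k (M ⋙ tensoringRight C)] {R : C}
    [Projective R] (hR : InAdd P R) : homDim k R (tensorCoend k P M) ≤
      homDim k (𝟙_ C) (M.obj (op R)) + homDim k R (tensorCoend k P (M ⋙ unitQuotient k C)) := by
  let α : M ⟶ M ⋙ unitQuotient k C :=
    { app := fun X => (toUnitQuotient k C).app (M.obj X)
      naturality := fun _ _ _ => (toUnitQuotient_map _).symm }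
  have hα : ∀ i, Epi (α.app (op (P i))) := fun i =>
    inferInstanceAs (Epi ((toUnitQuotient k C).app (M.obj (op (P i)))))
  obtain ⟨ω, hω⟩ := exists_tensorCoend_leg (k := k) (M := M) hR
  -- An element of `C(𝟙, M(R))` gives a morphism from `R` to `R ⊗ M(R)`, followed by the leg at `R`.
  let φ : (𝟙_ C ⟶ M.obj (op R)) →ₗ[k] (R ⟶ tensorCoend k P M) :=
    { toFun := fun f => (ρ_ R).inv ≫ R ◁ f ≫ ω
      map_add' := fun f g => by
        rw [MonoidalPreadditive.whiskerLeft_add, Preadditive.add_comp, Preadditive.comp_add]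
      map_smul' := fun r f => by
        rw [MonoidalLinear.whiskerLeft_smul, Linear.smul_comp, Linear.comp_smul, RingHom.id_apply] }
  have := Fintype.ofFinite ι
  let b := fun i => Module.finBasis k (𝟙_ C ⟶ M.obj (op (P i)))
  let ψ' : ∀ s : (Σ i, Fin (Module.finrank k (𝟙_ C ⟶ M.obj (op (P i))))),
      P s.1 ⟶ tensorCoend k P M := fun s =>
    (ρ_ (P s.1)).inv ≫ P s.1 ◁ b s.1 s.2 ≫ tensorCoendι k P M s.1
  let ψ := biproduct.desc ψ'
  have w : ψ ≫ tensorCoendMap k P α = 0 := by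
    refine biproduct.hom_ext' _ _ fun s => ?_
    have h0 : b s.1 s.2 ≫ α.app (op (P s.1)) = 0 := comp_cokernel_socle _
    rw [biproduct.ι_desc_assoc, comp_zero, Category.assoc, Category.assoc, tensorCoendι_map,
      ← MonoidalCategory.whiskerLeft_comp_assoc, h0, MonoidalPreadditive.whiskerLeft_zero,
      zero_comp, comp_zero]
  have hex := exact_tensorCoendMap α ψ w fun u hu i =>
    exists_whiskerLeft_toUnitQuotient_comp (P i) (tensorCoendι k P M i ≫ u) fun s => by
      have := biproduct.ι (fun s : (Σ i, Fin (Module.finrank k (𝟙_ C ⟶ M.obj (op (P i))))) => P s.1)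
        ⟨i, s⟩ ≫= hu
      rw [biproduct.ι_desc_assoc, comp_zero] at this
      simpa only [ψ', Category.assoc, Preadditive.IsIso.comp_left_eq_zero] using this
  have hker : LinearMap.ker (Linear.rightComp k R (tensorCoendMap k P α)) ≤ LinearMap.range φ := by
    intro g hg
    obtain ⟨g', rfl⟩ : ∃ g', g' ≫ ψ = g :=
      ⟨hex.liftFromProjective g hg, hex.liftFromProjective_comp g hg⟩
    -- Each component of `g'` is moved from the first tensor factor to the argument of `M`.
    refine ⟨∑ s, b s.1 s.2 ≫ M.map (g' ≫ biproduct.π _ s).op, ?_⟩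
    have hψ : ψ = ∑ s, biproduct.π _ s ≫ ψ' s := by
      refine biproduct.hom_ext' _ _ fun s => ?_
      rw [biproduct.ι_desc, Preadditive.comp_sum, Finset.sum_eq_single s,
        biproduct.ι_π_self_assoc]
      · exact fun t _ ht => by rw [biproduct.ι_π_ne_assoc _ ht.symm, zero_comp]
      · exact fun h => absurd (Finset.mem_univ s) h
    rw [map_sum, hψ, Preadditive.comp_sum]
    refine Finset.sum_congr rfl fun s _ => ?_
    change (ρ_ R).inv ≫ R ◁ (b s.1 s.2 ≫ M.map (g' ≫ biproduct.π _ s).op) ≫ ω = _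
    rw [MonoidalCategory.whiskerLeft_comp_assoc, hω, whisker_exchange_assoc,
      ← rightUnitor_inv_naturality_assoc, Category.assoc]
  have h1 := (Linear.rightComp k R (tensorCoendMap k P α)).finrank_range_add_finrank_ker
  have h2 : Module.finrank k (LinearMap.range (Linear.rightComp k R (tensorCoendMap k P α))) ≤
      homDim k R (tensorCoend k P (M ⋙ unitQuotient k C)) := Submodule.finrank_le _
  have h4 := Submodule.finrank_mono hker
  have h5 := LinearMap.finrank_range_le φ
  unfold homDim at *
  omega

namespace PerronData

variable {Q : C} (p : PerronData k Q)

/-- The bound for the dimension of the coend of `X ⊗ M(X)`, up to a constant. -/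
def bound (M : Cᵒᵖ ⥤ C) : ℝ := ∑ b, p.x b * p.dim (M.obj (op (p.R b)))

omit [MonoidalPreadditive C] [MonoidalLinear k C] [RigidCategory C]
  [∀ X Y : C, Module.Finite k (X ⟶ Y)] in
lemma bound_nonneg (M : Cᵒᵖ ⥤ C) : 0 ≤ p.bound M :=
  Finset.sum_nonneg fun b _ => mul_nonneg (p.pos b).le (p.dim_nonneg _)

omit [MonoidalPreadditive C] [MonoidalLinear k C] [RigidCategory C]
  [∀ X Y : C, Module.Finite k (X ⟶ Y)] in
lemma bound_tensorRight (M : Cᵒᵖ ⥤ C) : p.bound (M ⋙ tensorRight Q) = p.eig * p.bound M := by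
  unfold bound
  rw [Finset.mul_sum]
  refine Finset.sum_congr rfl fun b _ => ?_
  have : p.dim ((M ⋙ tensorRight Q).obj (op (p.R b))) = p.eig * p.dim (M.obj (op (p.R b))) :=
    p.wdim_tensor _
  rw [this]
  ring

omit [MonoidalPreadditive C] [MonoidalLinear k C] [RigidCategory C] in
lemma dim_biproduct_le {β : Type*} [Fintype β] (f : β → C) : p.dim (⨁ f) ≤ ∑ b, p.dim (f b) := by
  unfold dim wdim
  rw [Finset.sum_comm]
  refine Finset.sum_le_sum fun b _ => ?_
  rw [← Finset.mul_sum]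
  refine mul_le_mul_of_nonneg_left ?_ (p.pos b).le
  exact_mod_cast homDim_biproduct_right _ _

omit [MonoidalPreadditive C] [MonoidalLinear k C] [RigidCategory C] in
lemma dim_le_sum_of_jointly_epi {β : Type*} [Finite β] {Y : β → C} {Z : C} (f : ∀ b, Y b ⟶ Z)
    (hf : ∀ {W : C} (g h : Z ⟶ W), (∀ b, f b ≫ g = f b ≫ h) → g = h) [Fintype β] :
    p.dim Z ≤ ∑ b, p.dim (Y b) := by
  have : Epi (biproduct.desc f) := ⟨fun g h e => hf g h fun b => by
    simpa using biproduct.ι Y b ≫= e⟩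
  exact (p.dim_le_of_epi (biproduct.desc f)).trans (p.dim_biproduct_le Y)

omit [MonoidalLinear k C] [RigidCategory C] in
lemma exists_dim_obj_le (X : C) [Projective X] : ∃ B : ℝ, 0 ≤ B ∧
    ∀ (M : Cᵒᵖ ⥤ C) [IsBilinear k (M ⋙ tensoringRight C)],
      p.dim (M.obj (op X)) ≤ B * p.bound M := by
  obtain ⟨m, j, a, b, hab⟩ := p.inAdd X ‹_›
  refine ⟨∑ s, (p.x (j s))⁻¹, Finset.sum_nonneg fun s _ => inv_nonneg.mpr (p.pos _).le,
    fun M _ => ?_⟩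
  have hab' : ∑ s, M.map (b s).op ≫ M.map (a s).op = 𝟙 _ := by
    rw [← M.map_id, ← op_id, ← hab, map_sum_of_isBilinear k]
    exact Finset.sum_congr rfl fun s _ => by rw [op_comp, M.map_comp]
  refine (p.dim_le_sum_of_jointly_epi (fun s => M.map (a s).op) fun g h H => ?_).trans ?_
  · rw [← Category.id_comp g, ← Category.id_comp h, ← hab', Preadditive.sum_comp,
      Preadditive.sum_comp]
    exact Finset.sum_congr rfl fun s _ => by rw [Category.assoc, Category.assoc, H]
  · rw [Finset.sum_mul]
    refine Finset.sum_le_sum fun s _ => ?_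
    rw [le_inv_mul_iff₀ (p.pos _)]
    exact Finset.single_le_sum (f := fun b => p.x b * p.dim (M.obj (op (p.R b))))
      (fun b _ => mul_nonneg (p.pos b).le (p.dim_nonneg _)) (Finset.mem_univ (j s))

omit [∀ X Y : C, Module.Finite k (X ⟶ Y)] in
lemma exists_dim_tensor_le (X : C) [Projective X] : ∃ B : ℝ, 0 ≤ B ∧
    ∀ Z : C, p.dim (X ⊗ Z) ≤ B * p.dim Z := by
  have h : ∀ b, Projective (Xᘁ ⊗ p.R b) := fun b =>
    have := p.projective b
    projective_tensor_right _ _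
  choose B hB hB' using fun b => p.homDim_le (Xᘁ ⊗ p.R b) (h b)
  refine ⟨∑ b, p.x b * B b, Finset.sum_nonneg fun b _ => mul_nonneg (p.pos b).le (hB b),
    fun Z => ?_⟩
  rw [Finset.sum_mul]
  refine Finset.sum_le_sum fun b _ => ?_
  rw [homDim_tensorLeft, mul_assoc]
  exact mul_le_mul_of_nonneg_left (hB' b Z) (p.pos b).le

/-- A crude estimate by the finitely many objects `P i ⊗ M(P i)` that cover the coend. What matters
is that `B` does not depend on `M`: this starts the iteration that leads to the sharp constant. -/
lemma exists_dim_tensorCoend_le (hP : IsProjectiveGenerating P) : ∃ B : ℝ, 0 ≤ B ∧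
    ∀ (M : Cᵒᵖ ⥤ C) [IsBilinear k (M ⋙ tensoringRight C)],
      p.dim (tensorCoend k P M) ≤ B * p.bound M := by
  have := Fintype.ofFinite ι
  choose B hB hB' using fun i => have := hP.projective i; p.exists_dim_tensor_le (P i)
  choose B' hB0' hB'' using fun i => have := hP.projective i; p.exists_dim_obj_le (P i)
  refine ⟨∑ i, B i * B' i, Finset.sum_nonneg fun i _ => mul_nonneg (hB i) (hB0' i), fun M _ => ?_⟩
  refine (p.dim_le_sum_of_jointly_epi (tensorCoendι k P M) fun g h => tensorCoend_hom_ext k).trans ?_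
  rw [Finset.sum_mul]
  refine Finset.sum_le_sum fun i _ => (hB' i _).trans ?_
  rw [mul_assoc]
  exact mul_le_mul_of_nonneg_left (hB'' i M) (hB i)

lemma dim_tensorCoend_le_add (hP : IsProjectiveGenerating P) (M : Cᵒᵖ ⥤ C)
    [IsBilinear k (M ⋙ tensoringRight C)] : p.dim (tensorCoend k P M) ≤
      ∑ b, p.x b * homDim k (𝟙_ C) (M.obj (op (p.R b))) +
        p.dim (tensorCoend k P (M ⋙ unitQuotient k C)) := by
  unfold dim wdim
  rw [← Finset.sum_add_distrib]
  refine Finset.sum_le_sum fun b _ => ?_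
  have := p.projective b
  rw [← mul_add]
  refine mul_le_mul_of_nonneg_left ?_ (p.pos b).le
  exact_mod_cast homDim_tensorCoend_le M (hP.inAdd (p.R b))

omit [MonoidalPreadditive C] [MonoidalLinear k C] [RigidCategory C] in
lemma add_bound_unitQuotient_le [Simple (𝟙_ C)] (M : Cᵒᵖ ⥤ C) :
    p.dim (𝟙_ C) * ∑ b, p.x b * homDim k (𝟙_ C) (M.obj (op (p.R b))) +
      homDim k (𝟙_ C) (𝟙_ C) * p.bound (M ⋙ unitQuotient k C) ≤
        homDim k (𝟙_ C) (𝟙_ C) * p.bound M := by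
  unfold bound
  rw [Finset.mul_sum, Finset.mul_sum, Finset.mul_sum, ← Finset.sum_add_distrib]
  refine Finset.sum_le_sum fun b _ => ?_
  have := mul_le_mul_of_nonneg_left (homDim_add_dim_unitQuotient_le p (M.obj (op (p.R b))))
    (p.pos b).le
  refine le_trans (le_of_eq ?_) (this.trans (le_of_eq ?_))
  · rw [Functor.comp_obj]
    ring
  · ring

/-- The bound for the dimension of the coend of `X ⊗ M(X)`. -/
theorem dim_tensorCoend_le [Simple (𝟙_ C)] (hP : IsProjectiveGenerating P) (M : Cᵒᵖ ⥤ C)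
    [IsBilinear k (M ⋙ tensoringRight C)] :
    p.dim (𝟙_ C) * p.dim (tensorCoend k P M) ≤ homDim k (𝟙_ C) (𝟙_ C) * p.bound M := by
  obtain ⟨c, hc, hc'⟩ := p.le_homDim
  obtain ⟨B, hB, hB'⟩ := p.exists_dim_tensorCoend_le hP
  have ha := p.dim_unit_pos
  have hl := p.eig_pos
  set a := p.dim (𝟙_ C)
  set l := p.eig
  have hK : (0 : ℝ) < homDim k (𝟙_ C) (𝟙_ C) := by
    exact_mod_cast homDim_pos (k := k) (𝟙 (𝟙_ C)) (id_nonzero _)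
  set K : ℝ := (homDim k (𝟙_ C) (𝟙_ C) : ℝ)
  -- The proportion by which the excess over the sharp constant `K` shrinks in one round; it is
  -- capped at one to keep `1 - s` nonnegative.
  obtain ⟨s, hs0, hs1, hs⟩ : ∃ s : ℝ, 0 < s ∧ s ≤ 1 ∧ s * (K * l) ≤ a * c := by
    refine ⟨min 1 (a * c / (K * l)), lt_min one_pos (by positivity), min_le_left _ _, ?_⟩
    calc _ ≤ a * c / (K * l) * (K * l) :=
          mul_le_mul_of_nonneg_right (min_le_right _ _) (by positivity)
      _ = a * c := div_mul_cancel₀ _ (by positivity)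
  have key : ∀ n : ℕ, ∀ (M : Cᵒᵖ ⥤ C) [IsBilinear k (M ⋙ tensoringRight C)],
      a * p.dim (tensorCoend k P M) ≤ (K + a * B * (1 - s) ^ n) * p.bound M := by
    intro n
    induction n with
    | zero =>
      intro M _
      have := mul_le_mul_of_nonneg_left (hB' M) ha.le
      have := mul_nonneg hK.le (p.bound_nonneg M)
      rw [pow_zero, mul_one, add_mul]
      linarith
    | succ n ih =>
      intro M _
      -- Tensoring with `Q` multiplies the bound by `l` and the dimension of the coend by at least
      -- `l`. In exchange, `M'` contains at least a fixed proportion of unit objects, and for that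
      -- part the constant `K` is already sharp.
      let M' := M ⋙ tensorRight Q
      obtain ⟨f, hf⟩ := exists_epi_tensorCoend (k := k) (P := P) (M := M) Q
      have h1 : l * p.dim (tensorCoend k P M) ≤ p.dim (tensorCoend k P M') :=
        (p.wdim_tensor _).symm.le.trans (p.dim_le_of_epi f)
      have h2 := p.dim_tensorCoend_le_add hP M'
      have h3 := p.add_bound_unitQuotient_le M'
      have h4 := ih (M' ⋙ unitQuotient k C)
      have h5 : c * p.bound M ≤ ∑ b, p.x b * homDim k (𝟙_ C) (M'.obj (op (p.R b))) := by
        unfold bound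
        rw [Finset.mul_sum]
        refine Finset.sum_le_sum fun b _ => ?_
        have := mul_le_mul_of_nonneg_left (hc' (M.obj (op (p.R b)))) (p.pos b).le
        refine le_trans (le_of_eq ?_) this
        change c * (p.x b * wdim k p.R p.x _) = _
        ring
      have h6 := p.bound_tensorRight M
      set t := ∑ b, p.x b * (homDim k (𝟙_ C) (M'.obj (op (p.R b))) : ℝ)
      set r := a * B * (1 - s) ^ n
      have hr : 0 ≤ r := by
        have : 0 ≤ 1 - s := by linarith
        positivity
      have hbM := p.bound_nonneg M
      rw [pow_succ, ← mul_assoc]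
      have hKl : 0 < K * l := mul_pos hK hl
      rw [← mul_le_mul_iff_of_pos_left hKl]
      rw [h6] at h3
      -- With `r` the current excess, `e1` to `e3` bound `K * l * a` times the dimension of the
      -- coend by `(K + r) * K * l * bound M - r * a * t`; by `e4` and `e5` the subtracted term is
      -- at least `r * s * K * l * bound M`.
      have e1 := mul_le_mul_of_nonneg_left (h1.trans h2) (mul_nonneg hK.le ha.le)
      have e2 := mul_le_mul_of_nonneg_left h4 hK.le
      have e3 := mul_le_mul_of_nonneg_left h3 (add_nonneg hK.le hr)
      have e4 := mul_le_mul_of_nonneg_left h5 (mul_nonneg hr ha.le)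
      have e5 := mul_le_mul_of_nonneg_right hs (mul_nonneg hr hbM)
      linarith
  have hlim : Filter.Tendsto (fun n : ℕ => (K + a * B * (1 - s) ^ n) * p.bound M) Filter.atTop
      (nhds ((K + a * B * 0) * p.bound M)) :=
    ((tendsto_pow_atTop_nhds_zero_of_lt_one (by linarith) (by linarith)).const_mul _).const_add K
      |>.mul_const _
  rw [mul_zero, add_zero] at hlim
  exact ge_of_tendsto' hlim fun n => key n M

end PerronData

end Bound

end DerivedCoend

end

noncomputable section

namespace DerivedCoend

attribute [local instance] Abelian.hasFiniteBiproducts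

/-! ### Linear algebra over a separable extension. -/

section LinearAlgebra

/-- The dimension of a quotient of the tensor product over an extension field. -/
lemma finrank_mul_finrank_le_of_balanced {k K V N W : Type*} [Field k] [Field K] [Algebra k K]
    [Module.Finite k K] [AddCommGroup V] [Module k V] [Module.Finite k V] [AddCommGroup N]
    [Module k N] [Module.Finite k N] [AddCommGroup W] [Module k W] (φ : K →ₐ[k] Module.End k V)
    (σ : K → N → N) (B : V →ₗ[k] N →ₗ[k] W) (hB : ∀ c v n, B (φ c v) n = B v (σ c n))
    (hspan : ∀ w, w ∈ Submodule.span k {w | ∃ v n, B v n = w}) :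
    Module.finrank k W * Module.finrank k K ≤ Module.finrank k V * Module.finrank k N := by
  let _ : Module K V := Module.compHom V φ.toRingHom
  have hsmul : ∀ (c : K) (v : V), c • v = φ c v := fun _ _ => rfl
  have : IsScalarTower k K V := ⟨fun r c v => by rw [hsmul, hsmul, map_smul]; rfl⟩
  have : Module.Finite K V := Module.Finite.of_restrictScalars_finite k K V
  let b := Module.finBasis K V
  -- Scalars from `K` move to the second argument, so a `K`-basis of `V` suffices in the first one.
  -- This saves the factor given by the degree of `K`.
  let L : (Fin (Module.finrank K V) → N) →ₗ[k] W := ∑ s, B (b s) ∘ₗ LinearMap.proj s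
  have hL : LinearMap.range L = ⊤ := by
    rw [eq_top_iff]
    refine fun w _ => (Submodule.span_le.mpr ?_) (hspan w)
    rintro _ ⟨v, n, rfl⟩
    refine ⟨fun s => σ (b.repr v s) n, ?_⟩
    conv_rhs => rw [← b.sum_repr v, map_sum, LinearMap.sum_apply]
    rw [LinearMap.sum_apply]
    exact Finset.sum_congr rfl fun s _ => (hB _ _ _).symm
  have h1 := LinearMap.finrank_le_finrank_of_surjective (LinearMap.range_eq_top.mp hL)
  rw [Module.finrank_pi_fintype, Finset.sum_const, Finset.card_univ, Fintype.card_fin,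
    smul_eq_mul] at h1
  rw [← Module.finrank_mul_finrank k K V]
  calc _ ≤ Module.finrank K V * Module.finrank k N * Module.finrank k K :=
        Nat.mul_le_mul_right _ h1
    _ = _ := by ring

open Algebra.TensorProduct in
-- The hypothesis on `t` lets scalars pass from the right tensor factor to the left one. For `z = t`
-- with product one, it shows that `t` is idempotent.
lemma mul_eq_lmul_tmul_mul {k K : Type*} [Field k] [Field K] [Algebra k K] {t : K ⊗[k] K}
    (ht : ∀ s : K, ((1 : K) ⊗ₜ[k] s - s ⊗ₜ[k] (1 : K)) * t = 0) (z : K ⊗[k] K) :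
    z * t = (lmul' k z ⊗ₜ[k] (1 : K)) * t := by
  have ht' : ∀ s : K, (1 : K) ⊗ₜ[k] s * t = s ⊗ₜ[k] (1 : K) * t := fun s => by
    rw [← sub_eq_zero, ← sub_mul, ht]
  induction z using TensorProduct.induction_on with
  | zero => simp
  | add x y hx hy => rw [add_mul, hx, hy, map_add, TensorProduct.add_tmul, add_mul]
  | tmul x y =>
    have : x ⊗ₜ[k] y = (x ⊗ₜ[k] (1 : K)) * ((1 : K) ⊗ₜ[k] y) := by simp
    rw [this, mul_assoc, ht', ← mul_assoc]
    simp

end LinearAlgebra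

/-! ### The two actions of the endomorphisms of the unit. -/

section UnitAction

variable {C : Type w} [Category.{v} C] [MonoidalCategory C]

/-- The action of the endomorphisms of the unit object by tensoring on the right. -/
def rightAct (X : C) (c : 𝟙_ C ⟶ 𝟙_ C) : X ⟶ X := (ρ_ X).inv ≫ X ◁ c ≫ (ρ_ X).hom

/-- The action of the endomorphisms of the unit object by tensoring on the left. -/
def leftAct (X : C) (c : 𝟙_ C ⟶ 𝟙_ C) : X ⟶ X := (λ_ X).inv ≫ c ▷ X ≫ (λ_ X).hom

lemma rightAct_naturality {X Y : C} (f : X ⟶ Y) (c : 𝟙_ C ⟶ 𝟙_ C) :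
    rightAct X c ≫ f = f ≫ rightAct Y c := by
  rw [rightAct, rightAct, Category.assoc, Category.assoc, ← rightUnitor_naturality,
    whisker_exchange_assoc, ← rightUnitor_inv_naturality_assoc]

lemma leftAct_naturality {X Y : C} (f : X ⟶ Y) (c : 𝟙_ C ⟶ 𝟙_ C) :
    leftAct X c ≫ f = f ≫ leftAct Y c := by
  rw [leftAct, leftAct, Category.assoc, Category.assoc, ← leftUnitor_naturality,
    ← whisker_exchange_assoc, ← leftUnitor_inv_naturality_assoc]

lemma leftAct_naturality_assoc {X Y Z : C} (f : X ⟶ Y) (c : 𝟙_ C ⟶ 𝟙_ C) (h : Y ⟶ Z) :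
    leftAct X c ≫ f ≫ h = f ≫ leftAct Y c ≫ h :=
  (reassoc_of% (leftAct_naturality f c)) h

lemma whiskerLeft_leftAct (X Y : C) (c : 𝟙_ C ⟶ 𝟙_ C) : X ◁ leftAct Y c = rightAct X c ▷ Y := by
  simp [leftAct, rightAct]

lemma rightAct_id (X : C) : rightAct X (𝟙 _) = 𝟙 X := by simp [rightAct]

lemma leftAct_id (X : C) : leftAct X (𝟙 _) = 𝟙 X := by simp [leftAct]

lemma rightAct_comp (X : C) (c d : 𝟙_ C ⟶ 𝟙_ C) :
    rightAct X (c ≫ d) = rightAct X c ≫ rightAct X d := by simp [rightAct]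

lemma leftAct_comp (X : C) (c d : 𝟙_ C ⟶ 𝟙_ C) :
    leftAct X (c ≫ d) = leftAct X c ≫ leftAct X d := by simp [leftAct]

/-- On the unit object the left action of `c` is `c` itself, and the left action commutes with all
morphisms. -/
lemma unit_comp_comm (c d : 𝟙_ C ⟶ 𝟙_ C) : c ≫ d = d ≫ c := by
  have h : ∀ c : 𝟙_ C ⟶ 𝟙_ C, leftAct (𝟙_ C) c = c := fun c => by
    rw [leftAct, unitors_equal, rightUnitor_naturality, ← unitors_equal, Iso.inv_hom_id_assoc]
  rw [← h c, leftAct_naturality]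

variable {k : Type u} [Field k] [Preadditive C] [Linear k C] [MonoidalPreadditive C]
  [MonoidalLinear k C]

variable (k) in
/-- The right action is linear. -/
def rightActLinear (X : C) : (𝟙_ C ⟶ 𝟙_ C) →ₗ[k] (X ⟶ X) where
  toFun := rightAct X
  map_add' c d := by simp [rightAct]
  map_smul' r c := by simp [rightAct]

variable (k) in
/-- The left action is linear. -/
def leftActLinear (X : C) : (𝟙_ C ⟶ 𝟙_ C) →ₗ[k] (X ⟶ X) where
  toFun := leftAct X
  map_add' c d := by simp [leftAct]
  map_smul' r c := by simp [leftAct]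

end UnitAction

/-! ### Functors as bimodules over the endomorphisms of the unit. -/

section Bimodule

variable {k : Type u} [Field k] {C : Type w} [Category.{v} C] [Abelian C] [Linear k C]
  [MonoidalCategory C] [MonoidalPreadditive C] [MonoidalLinear k C]
  {K : Type*} [Field K] [Algebra k K] (σ : K →ₐ[k] End (𝟙_ C))

omit [MonoidalPreadditive C] [MonoidalLinear k C] in
lemma comm_of_algHom (c d : K) : (show 𝟙_ C ⟶ 𝟙_ C from σ (c * d)) = σ c ≫ σ d := by
  rw [mul_comm c d]
  exact map_mul σ d c

variable (M : Cᵒᵖ ⥤ C) [IsBilinear k (M ⋙ tensoringRight C)]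

/-- The endomorphisms of the unit object act on a functor through the right action on its
argument. -/
def outerAct : K →ₐ[k] End M :=
  AlgHom.ofLinearMap
    { toFun := fun c =>
        { app := fun X => M.map (rightAct X.unop (σ c)).op
          naturality := fun _ _ f => by
            rw [← M.map_comp, ← M.map_comp]
            exact congrArg (fun g => M.map (Quiver.Hom.op g)) (rightAct_naturality f.unop _) }
      map_add' := fun c d => NatTrans.ext (funext fun X => by
        refine Eq.trans ?_ (map_add_of_isBilinear k _ _)
        exact congrArg (fun g => M.map (Quiver.Hom.op g))
          ((congrArg (rightActLinear k X.unop) (map_add σ c d)).trans (map_add _ _ _)))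
      map_smul' := fun r c => NatTrans.ext (funext fun X => by
        refine Eq.trans ?_ (map_smul_of_isBilinear k _ _)
        exact congrArg (fun g => M.map (Quiver.Hom.op g))
          ((congrArg (rightActLinear k X.unop) (map_smul σ r c)).trans (map_smul _ _ _))) }
    (NatTrans.ext (funext fun X => by
      refine Eq.trans ?_ (M.map_id X)
      exact congrArg (fun g => M.map (Quiver.Hom.op g))
        ((congrArg (rightAct X.unop) (map_one σ)).trans (rightAct_id _))))
    fun c d => NatTrans.ext (funext fun X => by
      refine Eq.trans ?_ (M.map_comp _ _)
      exact congrArg (fun g => M.map (Quiver.Hom.op g))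
        ((congrArg (rightAct X.unop) (comm_of_algHom σ c d)).trans (rightAct_comp _ _ _)))

omit [IsBilinear k (M ⋙ tensoringRight C)] in
/-- The endomorphisms of the unit object act on a functor through the left action on its values. -/
def innerAct : K →ₐ[k] End M :=
  AlgHom.ofLinearMap
    { toFun := fun c =>
        { app := fun X => leftAct (M.obj X) (σ c)
          naturality := fun _ _ _ => (leftAct_naturality _ _).symm }
      map_add' := fun c d => NatTrans.ext (funext fun X =>
        (congrArg (leftActLinear k (M.obj X)) (map_add σ c d)).trans (map_add _ _ _))
      map_smul' := fun r c => NatTrans.ext (funext fun X =>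
        (congrArg (leftActLinear k (M.obj X)) (map_smul σ r c)).trans (map_smul _ _ _)) }
    (NatTrans.ext (funext fun X =>
      (congrArg (leftAct (M.obj X)) (map_one σ)).trans (leftAct_id _)))
    fun c d => NatTrans.ext (funext fun X =>
      (congrArg (leftAct (M.obj X)) (map_mul σ c d)).trans (leftAct_comp _ _ _))

lemma outerAct_app (c : K) (X : C) :
    (outerAct σ M c).app (op X) = M.map (rightAct X (σ c)).op := rfl

omit [IsBilinear k (M ⋙ tensoringRight C)] in
lemma innerAct_app (c : K) (X : C) :
    (innerAct σ M c).app (op X) = leftAct (M.obj (op X)) (σ c) := rfl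

/-- The action of `K ⊗ K` on a functor. -/
def bimoduleAct : K ⊗[k] K →ₐ[k] End M :=
  Algebra.TensorProduct.lift (outerAct σ M) (innerAct σ M) fun c d =>
    NatTrans.ext (funext fun X => leftAct_naturality (M.map (rightAct X.unop (σ c)).op) (σ d))

lemma bimoduleAct_tmul (c d : K) :
    bimoduleAct σ M (c ⊗ₜ d) = (show M ⟶ M from innerAct σ M d) ≫ outerAct σ M c :=
  Algebra.TensorProduct.lift_tmul _ _ _ _ _

variable {M} {M' : Cᵒᵖ ⥤ C} [IsBilinear k (M' ⋙ tensoringRight C)]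

lemma bimoduleAct_naturality (α : M ⟶ M') (z : K ⊗[k] K) :
    (show M ⟶ M from bimoduleAct σ M z) ≫ α = α ≫ bimoduleAct σ M' z := by
  induction z using TensorProduct.induction_on with
  | zero =>
    rw [map_zero, map_zero]
    exact zero_comp.trans comp_zero.symm
  | add x y hx hy =>
    rw [map_add, map_add]
    exact (Preadditive.add_comp _ _ _ _ _ _).trans
      ((congrArg₂ (· + ·) hx hy).trans (Preadditive.comp_add _ _ _ _ _ _).symm)
  | tmul c d =>
    rw [bimoduleAct_tmul, bimoduleAct_tmul]
    refine NatTrans.ext (funext fun X => ?_)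
    change (leftAct (M.obj X) (σ d) ≫ M.map (rightAct X.unop (σ c)).op) ≫ α.app X =
      α.app X ≫ leftAct (M'.obj X) (σ d) ≫ M'.map (rightAct X.unop (σ c)).op
    rw [Category.assoc, α.naturality, leftAct_naturality_assoc]

variable [∀ X Y : C, Module.Finite k (X ⟶ Y)] {ι : Type t} [Finite ι] {P : ι → C}

omit [MonoidalLinear k C] in
lemma tensorCoendMap_add (α β : M ⟶ M') :
    tensorCoendMap k P (α + β) = tensorCoendMap k P α + tensorCoendMap k P β :=
  tensorCoend_hom_ext k fun i => by
    rw [Preadditive.comp_add, tensorCoendι_map, tensorCoendι_map, tensorCoendι_map, NatTrans.app_add,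
      MonoidalPreadditive.whiskerLeft_add, Preadditive.add_comp]

/-- Dinaturality turns the action through the argument of `M` into the right action on `X`, which in
`X ⊗ M(X)` equals the left action on `M(X)`. -/
lemma tensorCoendMap_outerAct (c : K) :
    tensorCoendMap k P (outerAct σ M c : M ⟶ M) = tensorCoendMap k P (innerAct σ M c : M ⟶ M) :=
  tensorCoend_hom_ext k fun i => by
    rw [tensorCoendι_map, tensorCoendι_map, outerAct_app, innerAct_app, tensorCoendι_dinatural,
      whiskerLeft_leftAct]

/-- On the coend, the two actions agree. -/
lemma tensorCoendMap_bimoduleAct (z : K ⊗[k] K) :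
    tensorCoendMap k P (bimoduleAct σ M z : M ⟶ M) =
      tensorCoendMap k P (innerAct σ M (Algebra.TensorProduct.lmul' k z) : M ⟶ M) := by
  induction z using TensorProduct.induction_on with
  | zero =>
    rw [map_zero, map_zero, map_zero]
  | add x y hx hy =>
    rw [map_add, map_add, map_add]
    exact (tensorCoendMap_add _ _).trans ((congrArg₂ (· + ·) hx hy).trans
      (tensorCoendMap_add _ _).symm)
  | tmul c d =>
    rw [bimoduleAct_tmul, Algebra.TensorProduct.lmul'_apply_tmul, map_mul]
    refine (tensorCoendMap_comp (M := M) (M' := M) _ _).symm.trans ?_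
    rw [tensorCoendMap_outerAct]
    exact tensorCoendMap_comp (M := M) (M' := M) _ _

end Bimodule

end DerivedCoend

end

noncomputable section

namespace DerivedCoend

attribute [local instance] Abelian.hasFiniteBiproducts

/-! ### The coend of `X ⊗ C(X, U) ⊗ Z`. -/

section RepCopower

variable {k : Type u} [Field k] {C : Type w} [Category.{v} C] [Abelian C] [Linear k C]
  [∀ X Y : C, Module.Finite k (X ⟶ Y)]

/-- A finite copower is a direct sum. -/
lemma exists_repCopower_decomposition (U Z X : C) :
    ∃ π : ∀ _ : Fin (Module.finrank k (X ⟶ U)), (repCopower k U Z).obj (op X) ⟶ Z,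
      ∑ s, π s ≫ repCopowerι k U Z X (Module.finBasis k (X ⟶ U) s) = 𝟙 _ ∧
      ∀ v s, repCopowerι k U Z X v ≫ π s = (Module.finBasis k (X ⟶ U)).repr v s • 𝟙 Z := by
  let b := Module.finBasis k (X ⟶ U)
  let φ : ∀ s, (X ⟶ U) →ₗ[k] (Z ⟶ Z) := fun s => (LinearMap.toSpanSingleton k _ (𝟙 Z)) ∘ₗ b.coord s
  let π : ∀ _, (repCopower k U Z).obj (op X) ⟶ Z := fun s => copowerDesc k (φ s)
  have h : ∀ v s, repCopowerι k U Z X v ≫ π s = b.repr v s • 𝟙 Z :=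
    fun v s => copowerι_desc k (φ s) v
  refine ⟨π, copower_hom_ext k fun v => ?_, h⟩
  change repCopowerι k U Z X v ≫ _ = repCopowerι k U Z X v ≫ 𝟙 _
  rw [Preadditive.comp_sum, Category.comp_id]
  conv_rhs => rw [← b.sum_repr v, map_sum]
  refine Finset.sum_congr rfl fun s _ => ?_
  rw [← Category.assoc, h, map_smul, Linear.smul_comp, Category.id_comp]

variable [MonoidalCategory C] [MonoidalPreadditive C] [MonoidalLinear k C]

instance isBilinear_repCopower (U Z : C) :
    IsBilinear k (repCopower k U Z ⋙ tensoringRight C) :=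
  isBilinear_tensoringRight
    (fun {X Y} f g => copower_hom_ext k fun v => by
      change repCopowerι k U Z Y v ≫ _ = repCopowerι k U Z Y v ≫ _
      rw [Preadditive.comp_add, repCopowerι_map, repCopowerι_map, repCopowerι_map,
        Preadditive.add_comp, map_add])
    (fun {X Y} r f => copower_hom_ext k fun v => by
      change repCopowerι k U Z Y v ≫ _ = repCopowerι k U Z Y v ≫ _
      rw [Linear.comp_smul, repCopowerι_map, repCopowerι_map, Linear.smul_comp, map_smul])

omit [MonoidalLinear k C] in
lemma whiskerLeft_repCopower_hom_ext {Y U Z X W : C} {g h : Y ⊗ (repCopower k U Z).obj (op X) ⟶ W}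
    (H : ∀ v, Y ◁ repCopowerι k U Z X v ≫ g = Y ◁ repCopowerι k U Z X v ≫ h) : g = h := by
  obtain ⟨π, hπ, -⟩ := exists_repCopower_decomposition (k := k) U Z X
  rw [← Category.id_comp g, ← Category.id_comp h, ← MonoidalCategory.whiskerLeft_id, ← hπ,
    whiskerLeft_sum, Preadditive.sum_comp, Preadditive.sum_comp]
  refine Finset.sum_congr rfl fun s _ => ?_
  rw [MonoidalCategory.whiskerLeft_comp, Category.assoc, Category.assoc, H]

variable {ι : Type t} [Finite ι] {P : ι → C}

/-- The coend of `X ⊗ C(X, U) ⊗ Z` maps onto `U ⊗ Z`. -/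
lemma exists_epi_tensorCoend_repCopower {U : C} (hU : InAdd P U) (Z : C) :
    ∃ f : tensorCoend k P (repCopower k U Z) ⟶ U ⊗ Z, Epi f := by
  choose π hπ hπ' using fun i => exists_repCopower_decomposition (k := k) U Z (P i)
  -- The evaluation of morphisms at `P i`, written in a basis; `hτ` is its basis-free description.
  let τ : ∀ i, P i ⊗ (repCopower k U Z).obj (op (P i)) ⟶ U ⊗ Z := fun i =>
    ∑ s, P i ◁ π i s ≫ Module.finBasis k (P i ⟶ U) s ▷ Z
  have hτ : ∀ i v, P i ◁ repCopowerι k U Z (P i) v ≫ τ i = v ▷ Z := fun i v => by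
    rw [Preadditive.comp_sum]
    conv_rhs => rw [← (Module.finBasis k (P i ⟶ U)).sum_repr v, sum_whiskerRight]
    refine Finset.sum_congr rfl fun s _ => ?_
    rw [← MonoidalCategory.whiskerLeft_comp_assoc, hπ', MonoidalLinear.whiskerLeft_smul,
      MonoidalCategory.whiskerLeft_id, Linear.smul_comp, Category.id_comp,
      MonoidalLinear.smul_whiskerRight]
  obtain ⟨f, hf⟩ := exists_tensorCoend_desc (k := k) τ fun i j g =>
    whiskerLeft_repCopower_hom_ext fun v => by
      rw [← MonoidalCategory.whiskerLeft_comp_assoc, repCopowerι_map, hτ, whisker_exchange_assoc,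
        hτ, comp_whiskerRight]
  refine ⟨f, ⟨fun g h e => ?_⟩⟩
  have key : ∀ i (v : P i ⟶ U), v ▷ Z ≫ g = v ▷ Z ≫ h := fun i v => by
    rw [← hτ, ← hf, Category.assoc, Category.assoc, Category.assoc, Category.assoc, e]
  obtain ⟨m, j, a, b, hab⟩ := hU
  rw [← Category.id_comp g, ← Category.id_comp h, ← id_whiskerRight, ← hab, sum_whiskerRight,
    Preadditive.sum_comp, Preadditive.sum_comp]
  refine Finset.sum_congr rfl fun s _ => ?_
  rw [comp_whiskerRight, Category.assoc, Category.assoc, key]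

end RepCopower

/-! ### The summand on which the two actions of the unit agree. -/

section Center

variable {k : Type u} [Field k] {C : Type w} [Category.{v} C] [Abelian C] [Linear k C]
  [MonoidalCategory C] [MonoidalPreadditive C] [MonoidalLinear k C]
  {K : Type*} [Field K] [Algebra k K] (σ : K →ₐ[k] End (𝟙_ C)) (t : K ⊗[k] K)

/-- A direct summand of a functor cut out by the action of an element of `K ⊗ K`. -/
structure BimoduleSummand (M : Cᵒᵖ ⥤ C) [IsBilinear k (M ⋙ tensoringRight C)] where
  /-- The summand. -/
  N : Cᵒᵖ ⥤ C
  bilinear : IsBilinear k (N ⋙ tensoringRight C)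
  /-- The inclusion. -/
  i : N ⟶ M
  /-- The projection. -/
  p : M ⟶ N
  i_p : i ≫ p = 𝟙 N
  p_i : p ≫ i = bimoduleAct σ M t

attribute [instance] BimoduleSummand.bilinear

variable {σ t} in
lemma BimoduleSummand.i_p_assoc {M N' : Cᵒᵖ ⥤ C} [IsBilinear k (M ⋙ tensoringRight C)]
    (S : BimoduleSummand σ t M) (h : S.N ⟶ N') : S.i ≫ S.p ≫ h = h := by
  rw [← Category.assoc, S.i_p, Category.id_comp]

variable {σ t} (ht : ∀ s : K, ((1 : K) ⊗ₜ[k] s - s ⊗ₜ[k] (1 : K)) * t = 0)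
  (ht' : Algebra.TensorProduct.lmul' k t = 1)

include ht ht' in
-- The separability element `t` is idempotent, and idempotents of functors with values in an abelian
-- category split.
lemma nonempty_bimoduleSummand (M : Cᵒᵖ ⥤ C) [IsBilinear k (M ⋙ tensoringRight C)] :
    Nonempty (BimoduleSummand σ t M) := by
  have htt : t * t = t := by
    rw [mul_eq_lmul_tmul_mul ht t, ht']
    exact one_mul t
  have he : (show M ⟶ M from bimoduleAct σ M t) ≫ (show M ⟶ M from bimoduleAct σ M t) =
      bimoduleAct σ M t := by
    have := map_mul (bimoduleAct σ M) t t
    rw [htt] at this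
    exact this.symm
  obtain ⟨N, i, p, hip, hpi⟩ := IsIdempotentComplete.idempotents_split M _ he
  have hN : ∀ {X Y : C} (f : X ⟶ Y),
      N.map f.op = i.app (op Y) ≫ M.map f.op ≫ p.app (op X) := fun {X Y} f => by
    rw [p.naturality, ← NatTrans.comp_app_assoc, hip, NatTrans.id_app, Category.id_comp]
  refine ⟨⟨N, isBilinear_tensoringRight (fun f g => ?_) (fun r f => ?_), i, p, hip, hpi⟩⟩
  · rw [hN, hN, hN, map_add_of_isBilinear k, Preadditive.add_comp, Preadditive.comp_add]
  · rw [hN, hN, map_smul_of_isBilinear k, Linear.smul_comp, Linear.comp_smul]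

namespace BimoduleSummand

section

variable {M : Cᵒᵖ ⥤ C} [IsBilinear k (M ⋙ tensoringRight C)] (S : BimoduleSummand σ t M)

include ht in
-- The projection absorbs `t`, and `t` equalizes the two factors of `K ⊗ K`.
lemma outerAct_p (c : K) :
    (show M ⟶ M from outerAct σ M c) ≫ S.p = (show M ⟶ M from innerAct σ M c) ≫ S.p := by
  have h : ∀ z, (show M ⟶ M from bimoduleAct σ M z) ≫ S.p ≫ S.i = bimoduleAct σ M (z * t) :=
    fun z => by
      rw [S.p_i, mul_comm]
      exact (map_mul (bimoduleAct σ M) t z).symm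
  have h1 : bimoduleAct σ M ((1 : K) ⊗ₜ[k] c) = innerAct σ M c := by
    rw [bimoduleAct_tmul, map_one]
    exact Category.comp_id _
  have h2 : bimoduleAct σ M (c ⊗ₜ[k] (1 : K)) = outerAct σ M c := by
    rw [bimoduleAct_tmul, map_one]
    exact Category.id_comp _
  have h3 := mul_eq_lmul_tmul_mul ht ((1 : K) ⊗ₜ[k] c)
  rw [Algebra.TensorProduct.lmul'_apply_tmul, one_mul] at h3
  have h4 := (h ((1 : K) ⊗ₜ[k] c)).trans ((congrArg (bimoduleAct σ M) h3).trans (h _).symm)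
  rw [h1, h2] at h4
  have h5 := congrArg (· ≫ S.p) h4
  simpa only [Category.assoc, S.i_p, Category.comp_id] using h5.symm

variable [∀ X Y : C, Module.Finite k (X ⟶ Y)] {ι : Type t} [Finite ι] {P : ι → C}

include ht' in
-- On the coend the two actions agree, so `t` acts through its product, which is one: nothing is
-- lost by passing to the summand.
lemma epi_tensorCoendMap_i : Epi (tensorCoendMap k P S.i) := by
  have h : tensorCoendMap k P S.p ≫ tensorCoendMap k P S.i = 𝟙 _ := by
    rw [tensorCoendMap_comp, S.p_i, tensorCoendMap_bimoduleAct, ht', map_one]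
    exact tensorCoendMap_id
  exact ⟨fun g g' e => by rw [← Category.id_comp g, ← Category.id_comp g', ← h, Category.assoc, e,
    Category.assoc]⟩

include ht' in
lemma dim_tensorCoend_le {Q : C} (p : PerronData k Q) :
    p.dim (tensorCoend k P M) ≤ p.dim (tensorCoend k P S.N) :=
  have := S.epi_tensorCoendMap_i (P := P) ht'
  p.dim_le_of_epi (tensorCoendMap k P S.i)

end

variable [∀ X Y : C, Module.Finite k (X ⟶ Y)]

include ht in
/-- The summand of `C(X, U) ⊗ Z` is the tensor product over `K`. -/
lemma homDim_mul_le [Module.Finite k K] {U Z : C} (S : BimoduleSummand σ t (repCopower k U Z))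
    (W R : C) : homDim k W (S.N.obj (op R)) * Module.finrank k K ≤ homDim k R U * homDim k W Z := by
  let φ : K →ₐ[k] Module.End k (R ⟶ U) := AlgHom.ofLinearMap
    { toFun := fun c => Linear.rightComp k R (rightAct U (σ c))
      map_add' := fun c d => LinearMap.ext fun f => by
        change f ≫ rightActLinear k U (σ (c + d)) =
          f ≫ rightActLinear k U (σ c) + f ≫ rightActLinear k U (σ d)
        rw [map_add, ← Preadditive.comp_add]
        exact congrArg (f ≫ ·) (map_add (rightActLinear k U) (σ c) (σ d))
      map_smul' := fun r c => LinearMap.ext fun f => by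
        change f ≫ rightActLinear k U (σ (r • c)) = r • (f ≫ rightActLinear k U (σ c))
        rw [map_smul, ← Linear.comp_smul]
        exact congrArg (f ≫ ·) (map_smul (rightActLinear k U) r (σ c)) }
    (LinearMap.ext fun f => by
      change f ≫ rightAct U (σ 1) = f
      rw [map_one]
      exact (congrArg (f ≫ ·) (rightAct_id U)).trans (Category.comp_id f))
    (fun c d => LinearMap.ext fun f => by
      change f ≫ rightAct U (σ (c * d)) = (f ≫ rightAct U (σ d)) ≫ rightAct U (σ c)
      rw [Category.assoc, ← rightAct_comp, map_mul]
      rfl)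
  let B : (R ⟶ U) →ₗ[k] (W ⟶ Z) →ₗ[k] (W ⟶ S.N.obj (op R)) :=
    LinearMap.mk₂ k (fun v n => n ≫ repCopowerι k U Z R v ≫ S.p.app (op R))
      (fun v v' n => by rw [map_add, Preadditive.add_comp, Preadditive.comp_add])
      (fun r v n => by rw [map_smul, Linear.smul_comp, Linear.comp_smul])
      (fun v n n' => by rw [Preadditive.add_comp])
      (fun r v n => by rw [Linear.smul_comp])
  have hB : ∀ v n, B v n = n ≫ repCopowerι k U Z R v ≫ S.p.app (op R) := fun _ _ => rfl
  refine finrank_mul_finrank_le_of_balanced φ (fun c n => n ≫ leftAct Z (σ c)) B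
    (fun c v n => ?_) (fun w => ?_)
  · have h2 := NatTrans.congr_app (S.outerAct_p ht c) (op R)
    rw [NatTrans.comp_app, NatTrans.comp_app, outerAct_app, innerAct_app] at h2
    change n ≫ repCopowerι k U Z R (v ≫ rightAct U (σ c)) ≫ S.p.app (op R) =
      (n ≫ leftAct Z (σ c)) ≫ repCopowerι k U Z R v ≫ S.p.app (op R)
    rw [← rightAct_naturality, ← repCopowerι_map, Category.assoc, h2, Category.assoc,
      leftAct_naturality_assoc]
  · obtain ⟨π, hπ, -⟩ := exists_repCopower_decomposition (k := k) U Z R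
    have hw : w = ∑ s, B (Module.finBasis k (R ⟶ U) s) (w ≫ S.i.app (op R) ≫ π s) := by
      have h1 : w = w ≫ S.i.app (op R) ≫ 𝟙 _ ≫ S.p.app (op R) := by
        rw [Category.id_comp, ← NatTrans.comp_app, S.i_p, NatTrans.id_app, Category.comp_id]
      conv_lhs => rw [h1, ← hπ, Preadditive.sum_comp, Preadditive.comp_sum, Preadditive.comp_sum]
      exact Finset.sum_congr rfl fun s _ => by
        rw [hB, Category.assoc, Category.assoc, Category.assoc]
    rw [hw]
    exact Submodule.sum_mem _ fun s _ => Submodule.subset_span ⟨_, _, rfl⟩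

include ht in
-- The bound of `C(-, U) ⊗ Z` would be `dim U * dim Z`. The summand gains the degree of `K`, which
-- compensates exactly for the constant in `PerronData.dim_tensorCoend_le`.
lemma bound_mul_le [Module.Finite k K] {U Z : C} (S : BimoduleSummand σ t (repCopower k U Z))
    {Q : C} (p : PerronData k Q) : Module.finrank k K * p.bound S.N ≤ p.dim U * p.dim Z := by
  unfold PerronData.bound PerronData.dim wdim
  rw [Finset.sum_mul_sum, Finset.mul_sum]
  refine Finset.sum_le_sum fun b _ => ?_
  rw [Finset.mul_sum, Finset.mul_sum]
  refine Finset.sum_le_sum fun b' _ => ?_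
  have h : (homDim k (p.R b') (S.N.obj (op (p.R b))) : ℝ) * Module.finrank k K ≤
      homDim k (p.R b) U * homDim k (p.R b') Z := by
    exact_mod_cast S.homDim_mul_le ht (p.R b') (p.R b)
  have := mul_le_mul_of_nonneg_left h (mul_nonneg (p.pos b).le (p.pos b').le)
  linarith

end BimoduleSummand

end Center

end DerivedCoend

end

noncomputable section

namespace DerivedCoend

attribute [local instance] Abelian.hasFiniteBiproducts

/-! ### Counting arguments with the dimension function. -/

namespace PerronData

variable {k : Type u} [Field k] {C : Type w} [Category.{v} C] [Abelian C] [Linear k C]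
  [MonoidalCategory C] [∀ X Y : C, Module.Finite k (X ⟶ Y)] {Q : C} (p : PerronData k Q)

lemma dim_add_le {X Y Z : C} (f : X ⟶ Y) (g : Y ⟶ Z) (w : f ≫ g = 0) [Mono f] [Epi g] :
    p.dim X + p.dim Z ≤ p.dim Y := by
  have hS : (ShortComplex.mk f (cokernel.π f) (cokernel.condition f)).ShortExact :=
    { exact := ShortComplex.exact_cokernel f }
  have h1 := p.dim_shortExact hS
  dsimp only at h1
  have : Epi (cokernel.desc f g w) := by
    have : Epi (cokernel.π f ≫ cokernel.desc f g w) := by rwa [cokernel.π_desc]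
    exact epi_of_epi (cokernel.π f) _
  have h2 := p.dim_le_of_epi (cokernel.desc f g w)
  linarith

/-- The map from `X` to the kernel of `g` is epi. The inequality leaves dimension zero for its
kernel, and only the zero object has dimension zero. -/
lemma mono_of_dim_add_le {X Y Z : C} {f : X ⟶ Y} {g : Y ⟶ Z} {w : f ≫ g = 0}
    (hS : (ShortComplex.mk f g w).Exact) [Epi g] (h : p.dim X + p.dim Z ≤ p.dim Y) : Mono f := by
  have h1 := p.dim_shortExact (S := ShortComplex.mk (kernel.ι g) g (kernel.condition g))
    { exact := ShortComplex.exact_kernel g }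
  dsimp only at h1
  let l : X ⟶ kernel g := kernel.lift g f w
  have hl : Epi l := hS.epi_kernelLift
  have h2 := p.dim_shortExact (S := ShortComplex.mk (kernel.ι l) l (kernel.condition l))
    { exact := ShortComplex.exact_kernel l }
  dsimp only at h2
  have hz : IsZero (kernel l) := p.isZero (by linarith)
  have hm : Mono l := Preadditive.mono_of_kernel_zero (hz.eq_of_src _ _)
  have hf : l ≫ kernel.ι g = f := kernel.lift_ι _ _ _
  rw [← hf]
  infer_instance

include p in
/-- A nonnegative additive function that vanishes on `Q` is zero, if every object is an iterated
extension of quotients of `Q`. -/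
lemma eq_zero_of_additive (hQ : ∀ X : C, ¬ IsZero X → homDim k Q X ≠ 0) {g : C → ℝ}
    (hg : ∀ Z, 0 ≤ g Z) (hadd : ∀ S : ShortComplex C, S.ShortExact → g S.X₂ = g S.X₁ + g S.X₃)
    (hQ0 : g Q = 0) (Z : C) : g Z = 0 := by
  induction hn : ∑ b, homDim k (p.R b) Z using Nat.strong_induction_on generalizing Z with
  | _ n ih =>
    subst hn
    by_cases hZ : IsZero Z
    · have := hadd (ShortComplex.mk (𝟙 Z) (𝟙 Z) (hZ.eq_of_src _ _))
        { exact := ShortComplex.exact_of_isZero_X₂ _ hZ }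
      dsimp only at this
      linarith
    -- The image of `f` is a quotient of `Q`, so `g` vanishes on it; the cokernel of its inclusion
    -- is smaller, and the induction applies there.
    obtain ⟨f, hf⟩ := exists_ne_zero_of_homDim_ne_zero (hQ Z hZ)
    have h1 := hadd (ShortComplex.mk (kernel.ι (Abelian.factorThruImage f))
      (Abelian.factorThruImage f) (kernel.condition _)) { exact := ShortComplex.exact_kernel _ }
    have hS : (ShortComplex.mk (Abelian.image.ι f) (cokernel.π (Abelian.image.ι f))
      (cokernel.condition _)).ShortExact := { exact := ShortComplex.exact_cokernel _ }
    have h2 := hadd _ hS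
    dsimp only at h1 h2
    have h3 : ∀ b, homDim k (p.R b) Z = homDim k (p.R b) (Abelian.image f) +
        homDim k (p.R b) (cokernel (Abelian.image.ι f)) :=
      fun b => have := p.projective b; homDim_shortExact _ hS
    have hI : ¬ IsZero (Abelian.image f) := fun h => hf (by
      rw [← Abelian.image.fac f, h.eq_of_tgt (Abelian.factorThruImage f) 0, zero_comp])
    obtain ⟨b, hb⟩ := p.generating _ hI
    have h4 : ∑ b, homDim k (p.R b) (cokernel (Abelian.image.ι f)) < ∑ b, homDim k (p.R b) Z := by
      refine Finset.sum_lt_sum (fun b _ => ?_) ⟨b, Finset.mem_univ b, ?_⟩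
      · rw [h3 b]
        exact Nat.le_add_left _ _
      · rw [h3 b]
        exact Nat.lt_add_of_pos_left (Nat.pos_of_ne_zero hb)
    have h5 := ih _ h4 (cokernel (Abelian.image.ι f)) rfl
    have h6 := hg (kernel (Abelian.factorThruImage f))
    have h7 := hg (Abelian.image f)
    linarith

end PerronData

/-! ### Injectivity of maps of coends. -/

section Injectivity

variable {k : Type u} [Field k] {C : Type w} [Category.{v} C] [Abelian C] [Linear k C]
  [MonoidalCategory C] [MonoidalPreadditive C] [MonoidalLinear k C] [RigidCategory C]
  [Simple (𝟙_ C)] [∀ X Y : C, Module.Finite k (X ⟶ Y)]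
  {K : Type*} [Field K] [Algebra k K] [Module.Finite k K] {σ : K →ₐ[k] End (𝟙_ C)} {t : K ⊗[k] K}
  (hσ : Module.finrank k K = homDim k (𝟙_ C) (𝟙_ C))
  (ht : ∀ s : K, ((1 : K) ⊗ₜ[k] s - s ⊗ₜ[k] (1 : K)) * t = 0)
  (ht' : Algebra.TensorProduct.lmul' k t = 1)
  {ι : Type t} [Finite ι] {P : ι → C} (hP : IsProjectiveGenerating P)
  {Q : C} (p : PerronData k Q)

include σ p ht ht' hP hσ

omit [Module.Finite k K] ht in
lemma dim_tensorCoend_le_bound {M : Cᵒᵖ ⥤ C} [IsBilinear k (M ⋙ tensoringRight C)]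
    (S : BimoduleSummand σ t M) :
    p.dim (𝟙_ C) * p.dim (tensorCoend k P M) ≤ Module.finrank k K * p.bound S.N := by
  rw [hσ]
  exact (mul_le_mul_of_nonneg_left (S.dim_tensorCoend_le ht' p) (p.dim_nonneg _)).trans
    (p.dim_tensorCoend_le hP S.N)

/-- The object `U ⊗ Z` is a quotient of the coend for `C(-, U) ⊗ Z`, and the degree of `K` cancels
between the general bound and the bound of the central summand. -/
lemma dim_tensor_le {U : C} (hU : InAdd P U) (Z : C) :
    p.dim (𝟙_ C) * p.dim (U ⊗ Z) ≤ p.dim U * p.dim Z := by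
  obtain ⟨S⟩ := nonempty_bimoduleSummand (σ := σ) ht ht' (repCopower k U Z)
  obtain ⟨f, hf⟩ := exists_epi_tensorCoend_repCopower (k := k) hU Z
  exact (mul_le_mul_of_nonneg_left (p.dim_le_of_epi f) (p.dim_nonneg _)).trans
    ((dim_tensorCoend_le_bound hσ ht' hP p S).trans (S.bound_mul_le ht p))

/-- The dimension function is multiplicative, up to a constant. -/
lemma dim_tensor {U : C} (hU : InAdd P U) (hQ : ∀ X : C, ¬ IsZero X → homDim k Q X ≠ 0) (Z : C) :
    p.dim (𝟙_ C) * p.dim (U ⊗ Z) = p.dim U * p.dim Z := by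
  have hle := dim_tensor_le (σ := σ) hσ ht ht' hP p hU
  -- For `Z = Q` equality holds by the eigenvalue equation, applied to `U` and to the unit.
  have hQ0 : p.dim (𝟙_ C) * p.dim (U ⊗ Q) = p.dim U * p.dim Q := by
    have h1 : p.dim (U ⊗ Q) = p.eig * p.dim U := p.wdim_tensor U
    have h2 : p.dim (𝟙_ C ⊗ Q) = p.eig * p.dim (𝟙_ C) := p.wdim_tensor (𝟙_ C)
    rw [p.dim_congr (λ_ Q)] at h2
    rw [h1, h2]
    ring
  -- The defect is nonnegative, additive in `Z` by exactness of the tensor product, and zero at `Q`.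
  refine (sub_eq_zero.mp (p.eq_zero_of_additive hQ
    (g := fun Z => p.dim U * p.dim Z - p.dim (𝟙_ C) * p.dim (U ⊗ Z))
    (fun Z => sub_nonneg.mpr (hle Z)) (fun S hS => ?_) (sub_eq_zero.mpr hQ0.symm) Z)).symm
  have h1 := p.dim_shortExact hS
  have h2 := p.dim_shortExact (hS.map_of_exact (tensorLeft U))
  have h3 : p.dim (U ⊗ S.X₂) = p.dim (U ⊗ S.X₁) + p.dim (U ⊗ S.X₃) := by
    dsimp only [ShortComplex.map] at h2
    exact h2
  rw [h1, h3]
  ring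

/-- Coends are right exact, so only the kernel on the left is in question. The upper bounds for the
coends of `V''` and `V` add up to at most the dimension of `U ⊗ Z`, of which the middle coend is an
extension or cover, and this rules out a kernel. -/
lemma mono_tensorCoendMap {U : C} (hU : InAdd P U) (hQ : ∀ X : C, ¬ IsZero X → homDim k Q X ≠ 0)
    {V V'' : Cᵒᵖ ⥤ C} {Z : C} (i : V'' ⟶ repCopower k U Z) (q : repCopower k U Z ⟶ V)
    (w : i ≫ q = 0) (hS : ∀ X, InAdd P X → (ShortComplex.mk (i.app (op X)) (q.app (op X))
      (NatTrans.congr_app w _)).ShortExact) [IsBilinear k (V ⋙ tensoringRight C)]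
    [IsBilinear k (V'' ⋙ tensoringRight C)] : Mono (tensorCoendMap k P i) := by
  obtain ⟨S⟩ := nonempty_bimoduleSummand (σ := σ) ht ht' V
  obtain ⟨S'⟩ := nonempty_bimoduleSummand (σ := σ) ht ht' (repCopower k U Z)
  obtain ⟨S''⟩ := nonempty_bimoduleSummand (σ := σ) ht ht' V''
  have hq : ∀ j, Epi (q.app (op (P j))) := fun j => (hS _ (InAdd.single P j)).epi_g
  have w' : tensorCoendMap k P i ≫ tensorCoendMap k P q = 0 := by
    rw [tensorCoendMap_comp, w]
    refine tensorCoend_hom_ext k fun j => ?_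
    rw [tensorCoendι_map, NatTrans.app_zero, MonoidalPreadditive.whiskerLeft_zero, zero_comp,
      comp_zero]
  have hex := exact_tensorCoendMap q (tensorCoendMap k P i) w' fun u hu j => by
    have hj := (hS _ (InAdd.single P j)).map_of_exact (tensorLeft (P j))
    have h0 : P j ◁ i.app (op (P j)) ≫ tensorCoendι k P _ j ≫ u = 0 := by
      rw [← tensorCoendι_map_assoc, hu, comp_zero]
    exact ⟨@ShortComplex.Exact.desc _ _ _ _ _ hj.exact _ _ h0 hj.epi_g,
      @ShortComplex.Exact.g_desc _ _ _ _ _ hj.exact _ _ h0 hj.epi_g⟩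
  -- The action of `K ⊗ K` is natural, so the sequence restricts to the central summands. A
  -- monomorphism and an epimorphism with zero composite suffice for the inequality.
  have hbound : p.bound S''.N + p.bound S.N ≤ p.bound S'.N := by
    unfold PerronData.bound
    rw [← Finset.sum_add_distrib]
    refine Finset.sum_le_sum fun b _ => ?_
    rw [← mul_add]
    refine mul_le_mul_of_nonneg_left ?_ (p.pos b).le
    have := p.projective b
    have hb := hS (p.R b) (hP.inAdd _)
    let α : S''.N ⟶ S'.N := S''.i ≫ i ≫ S'.p
    let β : S'.N ⟶ S.N := S'.i ≫ q ≫ S.p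
    have hα : α ≫ S'.i = S''.i ≫ i := by
      simp only [α, Category.assoc]
      rw [S'.p_i, ← bimoduleAct_naturality, ← S''.p_i, Category.assoc, S''.i_p_assoc]
    have hβ : S'.p ≫ β = q ≫ S.p := by
      have : S'.p ≫ β = (S'.p ≫ S'.i) ≫ q ≫ S.p := by simp only [β, Category.assoc]
      rw [this, S'.p_i, ← Category.assoc, bimoduleAct_naturality, ← S.p_i, Category.assoc,
        Category.assoc, S.i_p, Category.comp_id]
    have hαβ : α ≫ β = 0 := by
      have : α ≫ β = S''.i ≫ i ≫ S'.p ≫ β := by simp only [α, Category.assoc]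
      rw [this, hβ, reassoc_of% w, zero_comp, comp_zero]
    have h1 : Mono (α.app (op (p.R b))) := by
      have h0 : Mono (S''.i.app (op (p.R b))) :=
        ⟨fun f g e => by
          rw [← Category.comp_id f, ← Category.comp_id g, ← NatTrans.id_app, ← S''.i_p,
            NatTrans.comp_app, reassoc_of% e]⟩
      have := hb.mono_f
      have h2 : Mono (α.app (op (p.R b)) ≫ S'.i.app (op (p.R b))) := by
        rw [← NatTrans.comp_app, hα, NatTrans.comp_app]
        exact mono_comp _ _
      exact mono_of_mono _ (S'.i.app (op (p.R b)))
    have h2 : Epi (β.app (op (p.R b))) := by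
      have h0 : Epi (S.p.app (op (p.R b))) :=
        ⟨fun f g e => by
          rw [← Category.id_comp f, ← Category.id_comp g, ← NatTrans.id_app, ← S.i_p,
            NatTrans.comp_app, Category.assoc, e, Category.assoc]⟩
      have := hb.epi_g
      have h3 : Epi (S'.p.app (op (p.R b)) ≫ β.app (op (p.R b))) := by
        rw [← NatTrans.comp_app, hβ, NatTrans.comp_app]
        exact epi_comp _ _
      exact epi_of_epi (S'.p.app (op (p.R b))) _
    exact p.dim_add_le (α.app (op (p.R b))) (β.app (op (p.R b))) (NatTrans.congr_app hαβ _)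
  have hepi := epi_tensorCoendMap (k := k) (P := P) q
  refine p.mono_of_dim_add_le hex ?_
  obtain ⟨f, hf⟩ := exists_epi_tensorCoend_repCopower (k := k) hU Z
  rw [← mul_le_mul_iff_of_pos_left p.dim_unit_pos]
  have e1 := dim_tensorCoend_le_bound hσ ht' hP p S
  have e2 := dim_tensorCoend_le_bound hσ ht' hP p S''
  have e3 := S'.bound_mul_le ht p
  have e4 := dim_tensor (σ := σ) hσ ht ht' hP p hU hQ Z
  have e5 := mul_le_mul_of_nonneg_left (p.dim_le_of_epi f) (p.dim_nonneg (𝟙_ C))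
  have e6 := mul_le_mul_of_nonneg_left hbound (Nat.cast_nonneg (α := ℝ) (Module.finrank k K))
  linarith

end Injectivity

end DerivedCoend

end

noncomputable section

namespace DerivedCoend

attribute [local instance] Abelian.hasFiniteBiproducts

/-! ### Acyclicity and resolutions in finite tensor categories. -/

section TensorDual

variable {k : Type u} [Field k] {C : Type w} [Category.{v} C] [Abelian C] [Linear k C]
  [MonoidalCategory C] [MonoidalPreadditive C] [MonoidalLinear k C] [RigidCategory C]
  [Simple (𝟙_ C)] [∀ X Y : C, Module.Finite k (X ⟶ Y)]

variable (C) in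
/-- The endomorphisms of the unit object form a field. -/
abbrev unitField : Field (End (𝟙_ C)) :=
  { (inferInstance : DivisionRing (End (𝟙_ C))) with
    mul_comm := fun c d => unit_comp_comm d c }

instance flip_tensoringRight_additive (Y : C) : ((tensoringRight C).flip.obj Y).Additive :=
  inferInstanceAs (tensorLeft Y).Additive

instance flip_tensoringRight_linear (Y : C) : ((tensoringRight C).flip.obj Y).Linear k :=
  inferInstanceAs ((tensorLeft Y).Linear k)

instance flip_tensoringRight_preservesFiniteLimits (Y : C) :
    PreservesFiniteLimits ((tensoringRight C).flip.obj Y) :=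
  inferInstanceAs (PreservesFiniteLimits (tensorLeft Y))

instance flip_tensoringRight_preservesFiniteColimits (Y : C) :
    PreservesFiniteColimits ((tensoringRight C).flip.obj Y) :=
  inferInstanceAs (PreservesFiniteColimits (tensorLeft Y))

variable {ι : Type t} [Finite ι] {P : ι → C}

/-- The derived coends of bimodules `(X, Y) ↦ Y ⊗ V(X)` are acyclic. -/
theorem exactAt_succ_tensor (hsep : Algebra.IsSeparable k (End (𝟙_ C)))
    (hP : IsProjectiveGenerating P) (V : Cᵒᵖ ⥤ C) [IsBilinear k (V ⋙ tensoringRight C)] (n : ℕ) :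
    (barComplex k P (V ⋙ tensoringRight C)).ExactAt (n + 1) := by
  obtain ⟨U, hU, _, hPU⟩ := hP.exists_generator
  let _ := unitField C
  have hsep' : Algebra.IsSeparable k (End (𝟙_ C)) := hsep
  have : Module.Finite k (End (𝟙_ C)) := inferInstanceAs (Module.Finite k (𝟙_ C ⟶ 𝟙_ C))
  have := Algebra.FormallyUnramified.of_isSeparable k (End (𝟙_ C))
  -- Separability enters here, in the form of a separability idempotent in `End(𝟙) ⊗ End(𝟙)`.
  obtain ⟨s, hs, hs'⟩ := Algebra.FormallyUnramified.iff_exists_tensorProduct.mp this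
  have hgen := hP.homDim_ne_zero (k := k) hPU
  obtain ⟨p⟩ := nonempty_perronData (k := k) (U := U)
    (fun X hX => (hP.inAdd X).trans hPU) hgen
  refine exactAt_succ_of_mono (tensoringRight C) hU hPU (fun V hV => ?_) (fun V hV => ?_)
    (fun V V'' Z i q w hS _ hV hV'' _ => ?_) V n
  · exact ⟨fun {X Y f g} => map_add_of_isBilinear k f.unop g.unop⟩
  · exact fun r f => map_smul_of_isBilinear k r f
  -- The field `K` is `End(𝟙)` itself, and `U^∨ ⊗ U` has nonzero morphisms to all nonzero objects,
  -- as the multiplicativity of the dimension requires.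
  · exact mono_tensorCoendMap (σ := AlgHom.id k _) rfl hs hs' hP p hU
      (fun X hX => homDim_dual_self_ne_zero hgen hX) i q w hS

theorem resolvesCoend_tensorDual (hsep : Algebra.IsSeparable k (End (𝟙_ C)))
    (hP : IsProjectiveGenerating P) (G : C ⥤ C) [G.Additive] [G.Linear k] :
    ResolvesCoend k P (tensorDual G) := by
  have h1 : ∀ X, PreservesFiniteColimits ((tensorDual G).obj X) := fun X =>
    inferInstanceAs (PreservesFiniteColimits (tensorRight (G.obj X.unop)ᘁ))
  have h2 : ∀ i j, Projective (((tensorDual G).obj (op (P i))).obj (P j)) := fun i j =>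
    have := hP.projective j
    projective_tensor_left (P j) _
  have h3 : IsBilinear k ((G.op ⋙ dualFunctor C) ⋙ tensoringRight C) := tensorDual_isBilinear k G
  exact resolvesCoend_of_exactAt hP (exactAt_succ_tensor hsep hP (G.op ⋙ dualFunctor C))

end TensorDual

end DerivedCoend

end

theorem corollary3p7 {k : Type u} [Field k] {C : Type w} [Category.{v} C] [Abelian C] [Linear k C]
    [IsFiniteLinear k C] :
    -- finite generating families of projective objects exist
    (∃ (m : ℕ) (P : Fin m → C), IsProjectiveGenerating P) ∧
    -- exact functors on the Deligne product
    (∀ {A : Type u} [Ring A] [Algebra k A] [Module.Finite k A] (e : C ≌ FGModuleCat.{u} A)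
        [e.functor.Additive] [e.functor.Linear k] (F : DeligneProduct k A ⥤ C) [F.Additive]
        [F.Linear k] [PreservesFiniteLimits F] [PreservesFiniteColimits F],
      (∀ X Y : C, Projective X → Projective Y →
        Projective (((ofDeligne k e F).obj (op X)).obj Y)) →
      ∀ {ι : Type t} [Finite ι] (P : ι → C), IsProjectiveGenerating P →
        ResolvesCoend k P (ofDeligne k e F)) ∧
    -- finite tensor categories
    (∀ [MonoidalCategory C] [MonoidalPreadditive C] [MonoidalLinear k C] [RigidCategory C]
        [Simple (𝟙_ C)] {ι : Type t} [Finite ι] (P : ι → C) (hP : IsProjectiveGenerating P),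
      (Algebra.IsSeparable k (End (𝟙_ C)) →
        (∀ (G : C ⥤ C) [G.Additive] [G.Linear k] [PreservesFiniteLimits G]
          [PreservesFiniteColimits G], ResolvesCoend k P (tensorDual G)) ∧
        ResolvesCoend k P (tensorDual (𝟭 C))) ∧
      ∃ φ : ((homFrom.{u, v, w} k (𝟙_ C)).mapHomologicalComplex (ComplexShape.down ℕ)).obj
          (barComplex k P (tensorDual (𝟭 C))) ⟶ hochschildComplex.{u, v, w} k C,
        QuasiIso φ ∧
        ∀ (n : ℕ) (X : Fin (n + 1) → ι) (f : ∀ i, Strings P X i)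
            (g : P (X 0) ⟶ P (X (Fin.last n))),
          φ.f n (ULift.up ((η_ (P (X 0)) (P (X 0))ᘁ ≫ g ▷ (P (X 0))ᘁ) ≫
              chainι k P (tensorDual (𝟭 C)) n X f)) =
            chainι k (projFamily C) (homBifunctor.{u, v, w} k C) n
              (fun i => ⟨P (X i), hP.projective (X i)⟩) f (ULift.up g)) := by
  refine ⟨?_, ?_, ?_⟩
  · obtain ⟨A, _, _, _, e, _, _⟩ := IsFiniteLinear.exists_equivalence (k := k) (C := C)
    exact ⟨1, exists_isProjectiveGenerating k e⟩
  · intro A _ _ _ e _ _ F _ _ _ _ hF ι _ P hP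
    exact resolvesCoend_ofDeligne e F hF hP
  · intro _ _ _ _ _ ι _ P hP
    refine ⟨fun hsep => ⟨fun G _ _ _ _ => resolvesCoend_tensorDual hsep hP G,
      resolvesCoend_tensorDual hsep hP (𝟭 C)⟩, exists_quasiIso_hochschild hP⟩
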